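/- Let $p$ be a prime; all formal group laws (FGLs) are commutative and one-dimensional, and are considered over commutative $\mathbb{Z}_{(p)}$-algebras. An FGL $F$ over $A$ is *$p$-typical* if for every prime $q\neq p$ one has $\sum^{F}_{0\le i<q}\zeta^i x=0$ over $A[\zeta]=A[t]/(\Phi_q(t))$, where $\Phi_q$ is the $q$-th cyclotomic polynomial (that is, Cartier's Frobenius operators $f_q$ kill the curve $x$). For $n\ge 1$ it is *$p^n$-typical* if it is $p$-typical and the series $p\cdot_F x=x+_F\cdots+_F x$ ($p$ summands) has the form $\sum_{j\ge 0}a_jx^{1+j(p^n-1)}$. A $\mathbb{Z}_{(p)}$-algebra $R$ with an FGL $F$ of a given kind *classifies* FGLs of that kind if for every $\mathbb{Z}_{(p)}$-algebra $A$ and every FGL $G$ of that kind over $A$ there is a unique $\mathbb{Z}_{(p)}$-algebra homomorphism $R\to A$ carrying $F$ to $G$. There is an FGL $F$ over $BP=\mathbb{Z}_{(p)}[v_1,v_2,\ldots]$ such that $(BP,F)$ classifies $p$-typical FGLs, and such that the $v_i$ are the Araki generators: the logarithm of $F$ over $BP\otimes\mathbb{Q}$ is $\sum_{i\ge 0} l_ix^{p^i}$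 with $p\,l_m=\sum_{i=0}^m l_i v_{m-i}^{p^i}$ for all $m\ge 0$, where $v_0=p$. With $\deg v_i=1-p^i$, the series $F(x,y)$ is homogeneous of degree $1$, where $\deg x=\deg y=1$. For every $n\ge1$, put $BP\{n\}=BP/(v_i : n\nmid i)$ and let $F_{BP\{n\}}$ be the image of $F$ over $BP\{n\}$. Then: 1. $(BP\{n\},F_{BP\{n\}})$ classifies $p^n$-typical FGLs; the grading of $BP$ induces a grading of the ring $BP\{n\}$, for which $F_{BP\{n\}}$ is homogeneous of degree $1$. 2. There is an isomorphism of graded $\mathbb{Z}_{(p)}$-algebras from $BP\{n\}$ to the polynomial ring $\mathbb{Z}_{(p)}[v_n,v_{2n},\ldots]$ with $\deg v_{mn}=1-p^{mn}$, under which the class of $v_i$ goes to $0$ if $n\nmid i$ and the class of $v_{mn}$ goes to $v_{mn}$ for $m\ge1$. 3. $BP\to BP\{1\}$ is an isomorphism, and for every $k\ge 1$ the projection $BP\to BP\{kn\}$ factors through a surjective homomorphism $BP\{n\}\to BP\{kn\}$, which carries $F_{BP\{n\}}$ to $F_{BP\{kn\}}$. -/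

import Mathlib

open scoped TensorProduct

universe u v

noncomputable section

namespace PnTypical

instance isPrime_span (p : ℕ) [hp : Fact p.Prime] : (Ideal.span {(p : ℤ)}).IsPrime :=
  (Ideal.span_singleton_prime (by exact_mod_cast hp.out.ne_zero)).2
    (Nat.prime_iff_prime_int.1 hp.out)

/-- The ring `ℤ_(p)` of integers localized at the prime ideal `(p)`. -/
abbrev ZLoc (p : ℕ) [Fact p.Prime] : Type :=
  Localization.AtPrime (Ideal.span {(p : ℤ)})

section Series

variable {A : Type u} [CommRing A]

/-- The curve `c x` on the formal group law `F`, for a scalar `c`. -/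
def linearCurve (F : FormalGroup A) (c : A) : F.Point Unit :=
  ⟨c • (PowerSeries.X : PowerSeries A), PowerSeries.HasSubst.smul_X' c⟩

/-- The series `m ·_F x = x +_F x +_F ⋯ +_F x` (`m` summands). -/
def multSeries (F : FormalGroup A) (m : ℕ) : PowerSeries A :=
  (m • linearCurve F 1).val

/-- The series `x +_F ζ x +_F ζ² x +_F ⋯ +_F ζ^(q-1) x` over `A[ζ] = A[t]/(Φ_q(t))`, where `Φ_q` is
the `q`-th cyclotomic polynomial. Substituting `x ↦ x^(1/q)` in it gives Cartier's Frobenius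
operator `f_q` applied to the identity curve of `F`. -/
def rootOfUnitySum (F : FormalGroup A) (q : ℕ) :
    PowerSeries (AdjoinRoot (Polynomial.cyclotomic q A)) :=
  ((List.range q).map fun i =>
    linearCurve (F.map (AdjoinRoot.of (Polynomial.cyclotomic q A)))
      (AdjoinRoot.root (Polynomial.cyclotomic q A) ^ i)).sum.val

/-- Cartier's notion: a (commutative, one-dimensional) formal group law is `p`-typical if for every
prime `q ≠ p` the Frobenius operator `f_q` kills the identity curve. -/
def IsPTypical (p : ℕ) (F : FormalGroup A) : Prop :=
  F.IsComm ∧ ∀ q : ℕ, q.Prime → q ≠ p → rootOfUnitySum F q = 0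

/-- A series is `p^n`-gradable if it is of the form `∑_{j ≥ 0} a_j x^(1 + j (p^n - 1))`. -/
def IsGradable (p n : ℕ) (γ : PowerSeries A) : Prop :=
  ∀ m : ℕ, γ.coeff m ≠ 0 → ∃ j : ℕ, m = 1 + j * (p ^ n - 1)

/-- A formal group law is `p^n`-typical if it is `p`-typical and `p ·_F x` is `p^n`-gradable. -/
def IsPnTypical (p n : ℕ) (F : FormalGroup A) : Prop :=
  IsPTypical p F ∧ IsGradable p n (multSeries F p)

/-- `L` is a logarithm of `F`: `L(x) = x + ⋯` and `L(F(x, y)) = L(x) + L(y)`. -/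
def IsLogarithm (F : FormalGroup A) (L : PowerSeries A) : Prop :=
  L.constantCoeff = 0 ∧ L.coeff 1 = 1 ∧
    L.subst F.toPowerSeries =
      L.subst (MvPowerSeries.X 0 : MvPowerSeries (Fin 2) A) +
        L.subst (MvPowerSeries.X 1 : MvPowerSeries (Fin 2) A)

/-- `v` is the sequence of Araki generators attached to `F`: over `ℚ ⊗ A` the logarithm of `F` is
of the form `∑ l_i x^(p^i)` and, with `v_0 = p`, one has `p l_m = ∑_{i=0}^m l_i v_{m-i}^(p^i)`
for all `m`. -/
def IsArakiSequence (p : ℕ) (F : FormalGroup A) (v : ℕ → A) : Prop :=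
  v 0 = (p : A) ∧
    ∃ L : PowerSeries (ℚ ⊗[ℤ] A),
      IsLogarithm
        (F.map (Algebra.TensorProduct.includeRight : A →ₐ[ℤ] ℚ ⊗[ℤ] A).toRingHom) L ∧
      (∀ m : ℕ, (∀ i : ℕ, m ≠ p ^ i) → L.coeff m = 0) ∧
      ∀ m : ℕ, (p : ℚ ⊗[ℤ] A) * L.coeff (p ^ m) =
        ∑ i ∈ Finset.range (m + 1),
          L.coeff (p ^ i) *
            (Algebra.TensorProduct.includeRight : A →ₐ[ℤ] ℚ ⊗[ℤ] A) (v (m - i)) ^ (p ^ i)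

end Series

section Universal

variable (p : ℕ) [Fact p.Prime] {R : Type v} [CommRing R] [Algebra (ZLoc p) R]

/-- The `ℤ_(p)`-algebra `R` with the formal group law `F` classifies `p`-typical formal group laws
over `ℤ_(p)`-algebras (in the universe `u`). -/
def ClassifiesPTypical (F : FormalGroup R) : Prop :=
  IsPTypical p F ∧
    ∀ (A : Type u) [CommRing A] [Algebra (ZLoc p) A] (G : FormalGroup A), IsPTypical p G →
      ∃! φ : R →ₐ[ZLoc p] A, F.map φ.toRingHom = G

/-- The `ℤ_(p)`-algebra `R` with the formal group law `F` classifies `p^n`-typical formal group laws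
over `ℤ_(p)`-algebras (in the universe `u`). -/
def ClassifiesPnTypical (n : ℕ) (F : FormalGroup R) : Prop :=
  IsPnTypical p n F ∧
    ∀ (A : Type u) [CommRing A] [Algebra (ZLoc p) A] (G : FormalGroup A), IsPnTypical p n G →
      ∃! φ : R →ₐ[ZLoc p] A, F.map φ.toRingHom = G

/-- `F(x, y)` is homogeneous of degree `1`, where `x` and `y` have degree `1`, with respect to the
family of homogeneous components `𝒜` of `R`. -/
def IsGradedFGL (𝒜 : ℤ → Submodule (ZLoc p) R) (F : FormalGroup R) : Prop :=
  ∀ d : Fin 2 →₀ ℕ, F.toPowerSeries.coeff d ∈ 𝒜 (1 - ((d 0 : ℤ) + (d 1 : ℤ)))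

end Universal

section Rings

variable (p : ℕ) [Fact p.Prime]

/-- The polynomial ring `ℤ_(p)[v_1, v_2, …]`. -/
abbrev PolyRing : Type := MvPolynomial ℕ+ (ZLoc p)

/-- The sequence `v_0 = p, v_1, v_2, …` in `ℤ_(p)[v_1, v_2, …]`. -/
def vSeq (i : ℕ) : PolyRing p :=
  if h : 0 < i then MvPolynomial.X ⟨i, h⟩ else (p : PolyRing p)

/-- The degree-`d` part of the polynomial ring over `ℤ_(p)` on variables indexed by `m ≥ 1`, the
`m`-th variable having degree `1 - p^(n m)`. -/
def polyGrading (n : ℕ+) (d : ℤ) : Submodule (ZLoc p) (PolyRing p) :=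
  MvPolynomial.weightedHomogeneousSubmodule (ZLoc p)
    (fun m : ℕ+ => (1 : ℤ) - (p : ℤ) ^ ((n * m : ℕ+) : ℕ)) d

/-- The ideal generated by the `v_i` with `n ∤ i`. -/
def vIdeal (n : ℕ+) : Ideal (PolyRing p) :=
  Ideal.span {f | ∃ i : ℕ+, ¬ n ∣ i ∧ f = MvPolynomial.X i}

/-- The quotient of `ℤ_(p)[v_1, v_2, …]` by the `v_i` with `n ∤ i`. -/
abbrev BPn (n : ℕ+) : Type := PolyRing p ⧸ vIdeal p n

/-- The projection `ℤ_(p)[v_1, v_2, …] → BPn p n`. -/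
abbrev toBPn (n : ℕ+) : PolyRing p →ₐ[ZLoc p] BPn p n :=
  Ideal.Quotient.mkₐ (ZLoc p) (vIdeal p n)

/-- The image over `BPn p n` of a formal group law over `ℤ_(p)[v_1, v_2, …]`. -/
def reduceFGL (F : FormalGroup (PolyRing p)) (n : ℕ+) : FormalGroup (BPn p n) :=
  F.map (toBPn p n).toRingHom

/-- The grading on `BPn p n` induced from the grading `deg v_i = 1 - p^i`. -/
def bpnGrading (n : ℕ+) (d : ℤ) : Submodule (ZLoc p) (BPn p n) :=
  (polyGrading p 1 d).map (toBPn p n).toLinearMap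

end Rings

end PnTypical

end

/-! The universal law is built over `ℚ[v_1, v_2, …]` as `L⁻¹(L(x) + L(y))`, with `L` the Araki
logarithm, and then descended to `ℤ_(p)`. Integrality is Hazewinkel's functional equation lemma
(`coeff_mem_range_of_functionalEquation`). With `σ(v_i) = v_i^p` one writes `p l_m = ∑ s_i
σ^i(l_{m-i})`, and the Araki recursion forces the `s_i` to be integral (`arakiTwist_mem_range`). A
logarithm `∑ l_k x^(p^k)` makes the law `p`-typical, because for a prime `q ≠ p` the sum of the
powers `ζ^(i p^k)`, `0 ≤ i < q`, is zero.

Universality rests on a uniqueness theorem, `IsPTypical.eq_of_coeff_eq`: over a ring where the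
integers prime to `p` are units, a `p`-typical law is determined by its coefficients at `x^(p^k)
y^(p^(k+1) - p^k)`. Indeed, if two laws agree below degree `m`, their difference in degree `m` is a
symmetric two-cocycle. It is a multiple of `(x+y)^m - x^m - y^m` when `m` is not a power of `p`, and
`p`-typicality kills that multiple; when `m = p^(k+1)` it vanishes with the distinguished
coefficient.

All coefficients of the Araki law are homogeneous, so the distinguished coefficient of degree `1 -
p^v` is a multiple of `v_v` plus a polynomial in the earlier `v_i`. The multiple is a unit of
`ℤ_(p)`, since a nontrivial binomial coefficient at `(p^(k+1), p^k)` has `p`-adic valuation exactly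
one. Hence values of the distinguished coefficients can be prescribed freely and uniquely, which
gives the classifying map.

For `p^n`-typical laws the same triangularity is applied to `p ·_F x`. Its coefficient at `x^(p^v)`
has `v_v`-coefficient exactly `1`; this is where the Araki generators matter. If `n ∤ v`, then `p^v`
is not of the form `1 + j (p^n - 1)`, so gradability forces `v_v ↦ 0` by induction on `v`.
Conversely, after killing these `v_v` every degree is divisible by `p^n - 1`, and homogeneity gives
gradability. The remaining claims are formal properties of a polynomial ring modulo some of its
variables. -/

noncomputable section

namespace PnTypical

open MvPowerSeries

/-! ### Power series filtered by total degree -/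

section OrdIdeal

variable {τ : Type*} {A : Type*} [CommRing A]

theorem coeff_mul_eq_zero_of_degree_lt {a b : ℕ} {f g : MvPowerSeries τ A}
    (hf : ∀ d : τ →₀ ℕ, d.degree < a → coeff d f = 0)
    (hg : ∀ d : τ →₀ ℕ, d.degree < b → coeff d g = 0) (d : τ →₀ ℕ) (hd : d.degree < a + b) :
    coeff d (f * g) = 0 := by
  classical
  rw [coeff_mul]
  refine Finset.sum_eq_zero fun x hx => ?_
  rw [Finset.HasAntidiagonal.mem_antidiagonal] at hx
  have h : x.1.degree + x.2.degree = d.degree := by rw [← hx, map_add]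
  rcases lt_or_ge x.1.degree a with h1 | h1
  · rw [hf _ h1, zero_mul]
  · rw [hg _ (by omega), mul_zero]

variable (τ A) in
/-- The ideal of power series all of whose terms have total degree at least `k`. -/
def ordIdeal (k : ℕ) : Ideal (MvPowerSeries τ A) where
  carrier := {f | ∀ d : τ →₀ ℕ, d.degree < k → coeff d f = 0}
  add_mem' hf hg d hd := by rw [map_add, hf d hd, hg d hd, add_zero]
  zero_mem' d _ := by simp
  smul_mem' c f hf d hd := by
    rw [smul_eq_mul]
    exact coeff_mul_eq_zero_of_degree_lt (a := 0) (by simp) hf d (by simpa using hd)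

theorem mem_ordIdeal {k : ℕ} {f : MvPowerSeries τ A} :
    f ∈ ordIdeal τ A k ↔ ∀ d : τ →₀ ℕ, d.degree < k → coeff d f = 0 := Iff.rfl

theorem mem_ordIdeal_one {f : MvPowerSeries τ A} :
    f ∈ ordIdeal τ A 1 ↔ constantCoeff f = 0 := by
  rw [mem_ordIdeal, ← coeff_zero_eq_constantCoeff_apply]
  refine ⟨fun h => h 0 (by simp), fun h d hd => ?_⟩
  rw [Nat.lt_one_iff, Finsupp.degree_eq_zero_iff] at hd
  rw [hd, h]

theorem X_mem_ordIdeal (s : τ) : (X s : MvPowerSeries τ A) ∈ ordIdeal τ A 1 :=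
  mem_ordIdeal_one.2 (by simp)

theorem ordIdeal_anti {a b : ℕ} (h : a ≤ b) : ordIdeal τ A b ≤ ordIdeal τ A a :=
  fun _ hf d hd => hf d (hd.trans_le h)

theorem mul_mem_ordIdeal {a b : ℕ} {f g : MvPowerSeries τ A} (hf : f ∈ ordIdeal τ A a)
    (hg : g ∈ ordIdeal τ A b) : f * g ∈ ordIdeal τ A (a + b) :=
  coeff_mul_eq_zero_of_degree_lt hf hg

theorem pow_mem_ordIdeal {f : MvPowerSeries τ A} {a : ℕ} (hf : f ∈ ordIdeal τ A a) (n : ℕ) :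
    f ^ n ∈ ordIdeal τ A (n * a) := by
  induction n with
  | zero => intro d hd; simp at hd
  | succ n ih => rw [pow_succ, add_mul, one_mul]; exact mul_mem_ordIdeal ih hf

theorem pow_mem_ordIdeal_one {f : MvPowerSeries τ A} (hf : f ∈ ordIdeal τ A 1) (n : ℕ) :
    f ^ n ∈ ordIdeal τ A n := by
  simpa using pow_mem_ordIdeal hf n

theorem eq_of_forall_sub_mem_ordIdeal {f g : MvPowerSeries τ A}
    (h : ∀ k, f - g ∈ ordIdeal τ A k) : f = g := by
  ext d
  have := h (d.degree + 1) d (Nat.lt_succ_self _)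
  rwa [map_sub, sub_eq_zero] at this

theorem coeff_eq_of_sub_mem_ordIdeal {f g : MvPowerSeries τ A} {k : ℕ}
    (h : f - g ∈ ordIdeal τ A k) {d : τ →₀ ℕ} (hd : d.degree < k) : coeff d f = coeff d g := by
  have := h d hd
  rwa [map_sub, sub_eq_zero] at this

/-- The difference of powers is `f - f'` times a sum of products of `n` factors, each without
constant term; this gains `n` degrees. It lets an approximation be improved by one degree in all
nonlinear terms. -/
theorem pow_succ_sub_mem_ordIdeal {f f' : MvPowerSeries τ A} {m : ℕ} (hf : f ∈ ordIdeal τ A 1)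
    (hf' : f' ∈ ordIdeal τ A 1) (h : f - f' ∈ ordIdeal τ A m) (n : ℕ) :
    f ^ (n + 1) - f' ^ (n + 1) ∈ ordIdeal τ A (m + n) := by
  induction n with
  | zero => simpa using h
  | succ n ih =>
    have e : f ^ (n + 1 + 1) - f' ^ (n + 1 + 1) =
        (f ^ (n + 1) - f' ^ (n + 1)) * f + (f - f') * f' ^ (n + 1) := by ring
    rw [e, ← add_assoc]
    refine add_mem (mul_mem_ordIdeal ih hf) ?_
    rw [add_assoc]
    exact mul_mem_ordIdeal h (pow_mem_ordIdeal_one hf' _)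

theorem pow_sub_pow_mem_ordIdeal {f f' : MvPowerSeries τ A} {m : ℕ} (hf : f ∈ ordIdeal τ A 1)
    (hf' : f' ∈ ordIdeal τ A 1) (h : f - f' ∈ ordIdeal τ A m) {n k : ℕ} (hn : k + 1 ≤ m + n) :
    f ^ n - f' ^ n ∈ ordIdeal τ A k := by
  rcases n with _ | n
  · simp
  · exact ordIdeal_anti (by omega) (pow_succ_sub_mem_ordIdeal hf hf' h n)

theorem pow_mul_pow_sub_mem_ordIdeal {f f' g g' : MvPowerSeries τ A} {m : ℕ}
    (hf : f ∈ ordIdeal τ A 1) (hf' : f' ∈ ordIdeal τ A 1) (hg : g ∈ ordIdeal τ A 1)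
    (hg' : g' ∈ ordIdeal τ A 1) (h : f - f' ∈ ordIdeal τ A m) (h' : g - g' ∈ ordIdeal τ A m)
    {i j k : ℕ} (hn : k + 1 ≤ m + (i + j)) :
    f ^ i * g ^ j - f' ^ i * g' ^ j ∈ ordIdeal τ A k := by
  have e : f ^ i * g ^ j - f' ^ i * g' ^ j =
      (f ^ i - f' ^ i) * g ^ j + (g ^ j - g' ^ j) * f' ^ i := by ring
  rw [e]
  refine add_mem ?_ ?_
  · rcases i with _ | i
    · simp
    · exact ordIdeal_anti (by omega)
        (mul_mem_ordIdeal (pow_succ_sub_mem_ordIdeal hf hf' h i) (pow_mem_ordIdeal_one hg j))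
  · rcases j with _ | j
    · simp
    · exact ordIdeal_anti (by omega)
        (mul_mem_ordIdeal (pow_succ_sub_mem_ordIdeal hg hg' h' j) (pow_mem_ordIdeal_one hf' i))

theorem mapsTo_ordIdeal {B : Type*} [CommRing B] (φ : A →+* B) {k : ℕ} {f : MvPowerSeries τ A}
    (hf : f ∈ ordIdeal τ A k) : MvPowerSeries.map φ f ∈ ordIdeal τ B k :=
  fun d hd => by rw [coeff_map, hf d hd, map_zero]

/-- The power series with prescribed coefficients. -/
def ofCoeff (c : (τ →₀ ℕ) → A) : MvPowerSeries τ A := c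

@[simp] theorem coeff_ofCoeff (c : (τ →₀ ℕ) → A) (d : τ →₀ ℕ) : coeff d (ofCoeff c) = c d := rfl

open Classical in
/-- The sum of the terms of degree less than `n` of a power series. -/
def truncDegree (n : ℕ) (f : MvPowerSeries τ A) : MvPowerSeries τ A :=
  ofCoeff fun d => if d.degree < n then coeff d f else 0

theorem sub_truncDegree_mem_ordIdeal (n : ℕ) (f : MvPowerSeries τ A) :
    f - truncDegree n f ∈ ordIdeal τ A n := fun d hd => by
  rw [map_sub, truncDegree, coeff_ofCoeff, if_pos hd, sub_self]

theorem truncDegree_mem_ordIdeal {n k : ℕ} {f : MvPowerSeries τ A} (hf : f ∈ ordIdeal τ A k) :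
    truncDegree n f ∈ ordIdeal τ A k := fun d hd => by
  rw [truncDegree, coeff_ofCoeff, hf d hd, ite_self]

theorem coeff_truncDegree_mem {S : Type*} [SetLike S A] [ZeroMemClass S A] {n : ℕ}
    {f : MvPowerSeries τ A} {M : (τ →₀ ℕ) → S}
    (h : ∀ d : τ →₀ ℕ, d.degree < n → coeff d f ∈ M d) (d : τ →₀ ℕ) :
    coeff d (truncDegree n f) ∈ M d := by
  rw [truncDegree, coeff_ofCoeff]
  split_ifs with hd
  · exact h d hd
  · exact zero_mem _

end OrdIdeal

/-! ### Substitution into two-variable series, modulo high degree -/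

section Subst

variable {τ : Type*} {A : Type*} [CommRing A]

/-- The exponent of the monomial `x^i y^j`. -/
def bidegree (i j : ℕ) : Fin 2 →₀ ℕ := Finsupp.single 0 i + Finsupp.single 1 j

@[simp] theorem bidegree_zero (i j : ℕ) : bidegree i j 0 = i := by simp [bidegree]

@[simp] theorem bidegree_one (i j : ℕ) : bidegree i j 1 = j := by simp [bidegree]

@[simp] theorem degree_bidegree (i j : ℕ) : (bidegree i j).degree = i + j := by
  simp [bidegree]

theorem bidegree_eta (d : Fin 2 →₀ ℕ) : bidegree (d 0) (d 1) = d := by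
  ext i; fin_cases i <;> simp

theorem degree_fin_two (d : Fin 2 →₀ ℕ) : d.degree = d 0 + d 1 := by
  rw [← bidegree_eta d]; simp

theorem hasSubst_pair {f g : MvPowerSeries τ A} (hf : f ∈ ordIdeal τ A 1)
    (hg : g ∈ ordIdeal τ A 1) : HasSubst ![f, g] :=
  hasSubst_of_constantCoeff_zero fun s => by
    rw [mem_ordIdeal_one] at hf hg
    fin_cases s <;> simpa

theorem hasSubst_of_mem {f : MvPowerSeries τ A} (hf : f ∈ ordIdeal τ A 1) :
    PowerSeries.HasSubst f :=
  PowerSeries.HasSubst.of_constantCoeff_zero (mem_ordIdeal_one.1 hf)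

theorem coeff_subst_pair {f g : MvPowerSeries τ A} (hf : f ∈ ordIdeal τ A 1)
    (hg : g ∈ ordIdeal τ A 1) (F : MvPowerSeries (Fin 2) A) {N : ℕ} {e : τ →₀ ℕ}
    (he : e.degree < N) :
    coeff e (F.subst ![f, g]) = ∑ i ∈ Finset.range N, ∑ j ∈ Finset.range N,
      coeff (bidegree i j) F * coeff e (f ^ i * g ^ j) := by
  classical
  rw [coeff_subst (hasSubst_pair hf hg), ← Finset.sum_product',
    finsum_eq_sum_of_support_subset (s := (Finset.range N ×ˢ Finset.range N).image
      fun x => bidegree x.1 x.2), Finset.sum_image]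
  · refine Finset.sum_congr rfl fun x _ => ?_
    rw [smul_eq_mul, Finsupp.prod_fintype _ _ (by simp)]
    simp
  · intro x _ y _ h
    have h0 := DFunLike.congr_fun h 0
    have h1 := DFunLike.congr_fun h 1
    simp only [bidegree_zero, bidegree_one] at h0 h1
    exact Prod.ext h0 h1
  · intro d hd
    rw [Function.mem_support, smul_eq_mul, Finsupp.prod_fintype _ _ (by simp)] at hd
    simp only [Finset.coe_image, Set.mem_image, Finset.mem_coe, Finset.mem_product,
      Finset.mem_range]
    by_contra hc
    apply hd
    have hdeg : N ≤ d 0 + d 1 := by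
      by_contra hlt
      exact hc ⟨(d 0, d 1), ⟨by dsimp only; omega, by dsimp only; omega⟩, bidegree_eta d⟩
    have := mul_mem_ordIdeal (pow_mem_ordIdeal_one hf (d 0)) (pow_mem_ordIdeal_one hg (d 1))
    simp only [Fin.prod_univ_two, Matrix.cons_val_zero, Matrix.cons_val_one]
    rw [this e (by omega), mul_zero]

/-- Since `f` and `g` have no constant term, only finitely many monomials matter below degree `N`;
substitutions become finite sums in all later congruences. -/
theorem subst_pair_sub_sum_mem_ordIdeal {f g : MvPowerSeries τ A} (hf : f ∈ ordIdeal τ A 1)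
    (hg : g ∈ ordIdeal τ A 1) (F : MvPowerSeries (Fin 2) A) (N : ℕ) :
    F.subst ![f, g] - ∑ i ∈ Finset.range N, ∑ j ∈ Finset.range N,
      C (coeff (bidegree i j) F) * (f ^ i * g ^ j) ∈ ordIdeal τ A N := by
  intro e he
  rw [map_sub, coeff_subst_pair hf hg F he, sub_eq_zero]
  simp only [map_sum, coeff_C_mul]

theorem subst_pair_mem_ordIdeal {f g : MvPowerSeries τ A} (hf : f ∈ ordIdeal τ A 1)
    (hg : g ∈ ordIdeal τ A 1) {F : MvPowerSeries (Fin 2) A} (hF : constantCoeff F = 0) :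
    F.subst ![f, g] ∈ ordIdeal τ A 1 := by
  have := subst_pair_sub_sum_mem_ordIdeal hf hg F 1
  have h0 : bidegree 0 0 = 0 := by simp [bidegree]
  simpa [h0, hF] using this

theorem coeff_bidegree_one_zero (F : FormalGroup A) :
    coeff (bidegree 1 0) F.toPowerSeries = 1 := by
  simpa [bidegree] using F.lin_coeff_X

theorem coeff_bidegree_zero_one (F : FormalGroup A) :
    coeff (bidegree 0 1) F.toPowerSeries = 1 := by
  simpa [bidegree] using F.lin_coeff_Y

theorem coeff_bidegree_zero_zero (F : FormalGroup A) :
    coeff (bidegree 0 0) F.toPowerSeries = 0 := by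
  simpa [bidegree] using F.zero_constantCoeff

theorem subst_pair_sub_add_mem_ordIdeal (F : FormalGroup A) {f g : MvPowerSeries τ A}
    (hf : f ∈ ordIdeal τ A 1) (hg : g ∈ ordIdeal τ A 1) :
    F.toPowerSeries.subst ![f, g] - (f + g) ∈ ordIdeal τ A 2 := by
  have h := subst_pair_sub_sum_mem_ordIdeal hf hg F.toPowerSeries 2
  simp only [Finset.sum_range_succ, Finset.sum_range_zero, coeff_bidegree_one_zero,
    coeff_bidegree_zero_one, coeff_bidegree_zero_zero] at h
  have h2 : C (coeff (bidegree 1 1) F.toPowerSeries) * (f ^ 1 * g ^ 1) ∈ ordIdeal τ A 2 := by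
    rw [pow_one, pow_one]
    exact Ideal.mul_mem_left _ _ (mul_mem_ordIdeal hf hg)
  convert add_mem h h2 using 1
  simp only [map_one, map_zero]
  ring

/-- If `F` and `G` agree below degree `m`, the difference of their values is, modulo terms of
degree greater than `m`, the difference of the arguments plus the degree `m` part of `F - G`
evaluated at the linear parts of the arguments. -/
theorem subst_pair_sub_subst_pair_mem_ordIdeal {F G : FormalGroup A} {m : ℕ} (hm : 1 ≤ m)
    (hFG : F.toPowerSeries - G.toPowerSeries ∈ ordIdeal (Fin 2) A m)
    {f f' g g' f₁ g₁ : MvPowerSeries τ A}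
    (hf : f ∈ ordIdeal τ A 1) (hf' : f' ∈ ordIdeal τ A 1) (hg : g ∈ ordIdeal τ A 1)
    (hg' : g' ∈ ordIdeal τ A 1) (hf₁ : f₁ ∈ ordIdeal τ A 1) (hg₁ : g₁ ∈ ordIdeal τ A 1)
    (h : f - f' ∈ ordIdeal τ A m) (h' : g - g' ∈ ordIdeal τ A m)
    (h₁ : f' - f₁ ∈ ordIdeal τ A 2) (h₁' : g' - g₁ ∈ ordIdeal τ A 2) :
    F.toPowerSeries.subst ![f, g] - G.toPowerSeries.subst ![f', g'] -
      ((f - f') + (g - g') + ∑ i ∈ Finset.range (m + 1),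
        C (coeff (bidegree i (m - i)) (F.toPowerSeries - G.toPowerSeries)) *
          (f₁ ^ i * g₁ ^ (m - i))) ∈ ordIdeal τ A (m + 1) := by
  have hF := subst_pair_sub_sum_mem_ordIdeal hf hg F.toPowerSeries (m + 1)
  have hG := subst_pair_sub_sum_mem_ordIdeal hf' hg' G.toPowerSeries (m + 1)
  set c : ℕ → ℕ → A := fun i j => coeff (bidegree i j) (F.toPowerSeries - G.toPowerSeries) with hc
  -- The comparison is made monomial by monomial: the two linear monomials give the differences of
  -- the arguments, those with `i + j = m` give the degree `m` part of `F - G`, and all others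
  -- contribute nothing modulo degree `m + 1`.
  have key : ∀ i ∈ Finset.range (m + 1), ∀ j ∈ Finset.range (m + 1),
      C (coeff (bidegree i j) F.toPowerSeries) * (f ^ i * g ^ j) -
        C (coeff (bidegree i j) G.toPowerSeries) * (f' ^ i * g' ^ j) -
      ((if i = 1 then (if j = 0 then f - f' else 0) else 0) +
        (if i = 0 then (if j = 1 then g - g' else 0) else 0) +
        (if j = m - i then C (c i j) * (f₁ ^ i * g₁ ^ j) else 0)) ∈ ordIdeal τ A (m + 1) := by
    intro i hi j hj
    rw [Finset.mem_range] at hi hj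
    have e : C (coeff (bidegree i j) F.toPowerSeries) * (f ^ i * g ^ j) -
        C (coeff (bidegree i j) G.toPowerSeries) * (f' ^ i * g' ^ j) -
      ((if i = 1 then (if j = 0 then f - f' else 0) else 0) +
        (if i = 0 then (if j = 1 then g - g' else 0) else 0) +
        (if j = m - i then C (c i j) * (f₁ ^ i * g₁ ^ j) else 0)) =
      (C (coeff (bidegree i j) F.toPowerSeries) * (f ^ i * g ^ j - f' ^ i * g' ^ j) -
        ((if i = 1 then (if j = 0 then f - f' else 0) else 0) +
        (if i = 0 then (if j = 1 then g - g' else 0) else 0))) +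
      (C (c i j) * (f' ^ i * g' ^ j) -
        (if j = m - i then C (c i j) * (f₁ ^ i * g₁ ^ j) else 0)) := by
      simp only [hc, map_sub]; ring
    rw [e]
    refine add_mem ?_ ?_
    · rcases lt_or_ge (i + j) 2 with hij | hij
      · obtain ⟨rfl, rfl⟩ | ⟨rfl, rfl⟩ | ⟨rfl, rfl⟩ :
          (i = 0 ∧ j = 0) ∨ (i = 1 ∧ j = 0) ∨ (i = 0 ∧ j = 1) := by omega
        · simp
        · simp [coeff_bidegree_one_zero]
        · simp [coeff_bidegree_zero_one]
      · have h1 : (if i = 1 then (if j = 0 then f - f' else 0) else 0) +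
            (if i = 0 then (if j = 1 then g - g' else 0) else 0) = 0 := by
          split_ifs <;> first | omega | simp
        rw [h1, sub_zero]
        exact Ideal.mul_mem_left _ _
          (pow_mul_pow_sub_mem_ordIdeal hf hf' hg hg' h h' (by omega))
    · rcases lt_trichotomy (i + j) m with hij | hij | hij
      · have : c i j = 0 := hFG _ (by simpa using hij)
        simp [this]
      · rw [if_pos (by omega), ← mul_sub]
        exact Ideal.mul_mem_left _ _
          (pow_mul_pow_sub_mem_ordIdeal hf' hf₁ hg' hg₁ h₁ h₁' (by omega))
      · rw [if_neg (by omega), sub_zero]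
        exact Ideal.mul_mem_left _ _ (ordIdeal_anti hij
          (mul_mem_ordIdeal (pow_mem_ordIdeal_one hf' i) (pow_mem_ordIdeal_one hg' j)))
  have hsum := Ideal.sum_mem _ fun i hi => Ideal.sum_mem _ (key i hi)
  have hT : ∑ i ∈ Finset.range (m + 1), ∑ j ∈ Finset.range (m + 1),
      ((if i = 1 then (if j = 0 then f - f' else 0) else 0) +
        (if i = 0 then (if j = 1 then g - g' else 0) else 0) +
        (if j = m - i then C (c i j) * (f₁ ^ i * g₁ ^ j) else 0)) =
      (f - f') + (g - g') + ∑ i ∈ Finset.range (m + 1),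
        C (c i (m - i)) * (f₁ ^ i * g₁ ^ (m - i)) := by
    simp only [Finset.sum_add_distrib]
    congr 1
    · congr 1
      · rw [Finset.sum_eq_single 1 (by intros; simp_all) (by simp; omega),
          Finset.sum_eq_single 0 (by intros; simp_all) (by simp)]
        simp
      · rw [Finset.sum_eq_single 0 (by intros; simp_all) (by simp),
          Finset.sum_eq_single 1 (by intros; simp_all) (by simp; omega)]
        simp
    · refine Finset.sum_congr rfl fun i hi => ?_
      rw [Finset.sum_ite_eq', if_pos]
      rw [Finset.mem_range] at hi ⊢
      omega
  simp only [Finset.sum_sub_distrib] at hsum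
  rw [hT] at hsum
  convert add_mem (sub_mem hF hG) hsum using 1
  ring

end Subst

end PnTypical

end

noncomputable section

namespace PnTypical

open MvPowerSeries

/-! ### Binomial coefficients modulo p and vanishing of cocycles -/

section Arithmetic

/-- Lucas' theorem applied `r` times: the last `r` base `p` digits of `p ^ r * t` are zero, so each
contributes a factor `1`. -/
theorem choose_pow_mul_modEq {p : ℕ} [Fact p.Prime] (r n t : ℕ) :
    n.choose (p ^ r * t) ≡ (n / p ^ r).choose t [MOD p] := by
  induction r generalizing n with
  | zero => simp; rfl
  | succ r ih =>
    have h := Choose.choose_modEq_choose_mod_mul_choose_div_nat (p := p) (n := n)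
      (k := p ^ (r + 1) * t)
    have hp := (Fact.out : p.Prime).pos
    have h1 : p ^ (r + 1) * t = p * (p ^ r * t) := by ring
    rw [h1, Nat.mul_mod_right, Nat.choose_zero_right, one_mul, Nat.mul_div_cancel_left _ hp] at h
    rw [h1, pow_succ', ← Nat.div_div_eq_div_mul]
    exact h.trans (ih _)

theorem not_dvd_choose_of_modEq {p a b : ℕ} (h : a ≡ b [MOD p]) (hb : ¬ p ∣ b) : ¬ p ∣ a :=
  fun ha => hb ((h.dvd_iff dvd_rfl).1 ha)

/-- A symmetric two-cocycle of degree `m = p ^ r * u` whose coefficient at `p ^ r` vanishes is zero,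
if `u` is not a sum of two positive multiples of `p`. -/
theorem cocycle_eq_zero {p : ℕ} [Fact p.Prime] {A : Type*} [CommRing A]
    (hA : ∀ n : ℕ, ¬ p ∣ n → IsUnit (n : A)) {m r u : ℕ} (hm : m = p ^ r * u) (hu : 2 ≤ u)
    (hpu : ∀ t, 0 < t → t < u → ¬ p ∣ t ∨ ¬ p ∣ u - t) {c : ℕ → A}
    (hsymm : ∀ i ≤ m, c (m - i) = c i)
    (hc : ∀ a b k, 0 < a → 0 < b → 0 < k → a + b + k = m →
      ((a + b).choose a : A) * c (a + b) = ((b + k).choose b : A) * c a)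
    (hr : c (p ^ r) = 0) {n : ℕ} (hn : 0 < n) (hnm : n < m) : c n = 0 := by
  have hpr : 0 < p ^ r := pow_pos (Fact.out : p.Prime).pos r
  -- The cocycle relation for `(a, n - a, m - n)` expresses a binomial multiple of `c n` through `c
  -- a`; vanishing propagates when the binomial is a unit.
  have cancel : ∀ {a n : ℕ}, 0 < a → a < n → n < m → ¬ p ∣ n.choose a → c a = 0 → c n = 0 := by
    intro a n ha han hnm h h0
    have := hc a (n - a) (m - n) ha (by omega) (by omega) (by omega)
    rw [h0, mul_zero, show a + (n - a) = n by omega] at this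
    exact (hA _ h).mul_right_eq_zero.1 this
  have mult : ∀ t, 0 < t → t < u → ¬ p ∣ t → c (p ^ r * t) = 0 := by
    intro t ht htu hpt
    rcases Nat.lt_or_ge 1 t with h1 | h1
    · refine cancel hpr (by nlinarith) (by rw [hm]; exact Nat.mul_lt_mul_of_pos_left htu hpr) ?_ hr
      have := choose_pow_mul_modEq (p := p) r (p ^ r * t) 1
      rw [mul_one, Nat.mul_div_cancel_left _ hpr, Nat.choose_one_right] at this
      exact not_dvd_choose_of_modEq this hpt
    · obtain rfl : t = 1 := by omega
      rwa [mul_one]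
  -- When `p ∣ t`, the hypothesis on `u` makes `u - t` prime to `p`, and symmetry reduces to that
  -- case.
  have mult' : ∀ t, 0 < t → t < u → c (p ^ r * t) = 0 := by
    intro t ht htu
    rcases hpu t ht htu with h | h
    · exact mult t ht htu h
    · rw [← hsymm _ (by rw [hm]; exact Nat.mul_le_mul_left _ htu.le), hm, ← Nat.mul_sub]
      exact mult _ (by omega) (by omega) h
  -- Propagation starts from the largest multiple of `p ^ r` that is at most `n`; the binomial
  -- coefficient is then `1` modulo `p`.
  have large : ∀ n, p ^ r ≤ n → n < m → c n = 0 := by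
    intro n h1 h2
    have hq : 0 < n / p ^ r := Nat.div_pos h1 hpr
    have hqu : n / p ^ r < u := by
      rw [Nat.div_lt_iff_lt_mul hpr, mul_comm]; omega
    have h0 := mult' _ hq hqu
    rcases (Nat.mul_div_le n (p ^ r)).lt_or_eq with h3 | h3
    · refine cancel (Nat.mul_pos hpr hq) h3 h2 ?_ h0
      have := choose_pow_mul_modEq (p := p) r n (n / p ^ r)
      rw [Nat.choose_self] at this
      exact not_dvd_choose_of_modEq this (Fact.out : p.Prime).not_dvd_one
    · rwa [h3] at h0
  rcases le_or_gt (p ^ r) n with h | h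
  · exact large n h hnm
  · rw [← hsymm n hnm.le]
    have : p ^ r * 2 ≤ m := hm ▸ Nat.mul_le_mul_left _ hu
    exact large _ (by omega) (by omega)

end Arithmetic

/-! ### The leading difference of two formal group laws is a cocycle -/

section Cocycle

variable {A : Type*} [CommRing A]

theorem X_pow_mul_X_pow_mul_X_pow_eq_monomial (s t u : ℕ) :
    (X 0 ^ s * X 1 ^ t * X 2 ^ u : MvPowerSeries (Fin 3) A) =
      monomial (Finsupp.single 0 s + Finsupp.single 1 t + Finsupp.single 2 u) 1 := by
  simp only [X_pow_eq, monomial_mul_monomial, mul_one]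

theorem coeff_X_pow_mul_X_pow_mul_X_pow (a b k s t u : ℕ) :
    coeff (Finsupp.single 0 a + Finsupp.single 1 b + Finsupp.single 2 k)
      (X 0 ^ s * X 1 ^ t * X 2 ^ u : MvPowerSeries (Fin 3) A) =
      if a = s ∧ b = t ∧ k = u then 1 else 0 := by
  classical
  rw [X_pow_mul_X_pow_mul_X_pow_eq_monomial, coeff_monomial]
  congr 1
  rw [eq_iff_iff]
  constructor
  · intro h
    have h0 := DFunLike.congr_fun h 0
    have h1 := DFunLike.congr_fun h 1
    have h2 := DFunLike.congr_fun h 2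
    simpa using And.intro h0 (And.intro h1 h2)
  · rintro ⟨rfl, rfl, rfl⟩; rfl

theorem coeff_X_add_X_pow_mul_X_pow {a b k n l : ℕ} (h : n + l = a + b + k) :
    coeff (Finsupp.single 0 a + Finsupp.single 1 b + Finsupp.single 2 k)
      ((X 0 + X 1) ^ n * X 2 ^ l : MvPowerSeries (Fin 3) A) =
      if n = a + b then ((a + b).choose a : A) else 0 := by
  have e : ((X 0 + X 1) ^ n * X 2 ^ l : MvPowerSeries (Fin 3) A) =
      ∑ i ∈ Finset.range (n + 1), C (n.choose i : A) * (X 0 ^ i * X 1 ^ (n - i) * X 2 ^ l) := by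
    rw [add_pow, Finset.sum_mul]
    refine Finset.sum_congr rfl fun i _ => ?_
    rw [map_natCast]; ring
  rw [e, map_sum]
  simp only [coeff_C_mul, coeff_X_pow_mul_X_pow_mul_X_pow]
  split_ifs with hn
  · rw [Finset.sum_eq_single a, if_pos (by omega), mul_one, hn]
    · intro i _ hi
      rw [if_neg (by omega), mul_zero]
    · simp; omega
  · refine Finset.sum_eq_zero fun i hi => ?_
    rw [if_neg (by omega), mul_zero]

theorem coeff_X_pow_mul_X_add_X_pow {a b k n l : ℕ} (h : l + n = a + b + k) :
    coeff (Finsupp.single 0 a + Finsupp.single 1 b + Finsupp.single 2 k)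
      (X 0 ^ l * (X 1 + X 2) ^ n : MvPowerSeries (Fin 3) A) =
      if l = a then ((b + k).choose b : A) else 0 := by
  have e : (X 0 ^ l * (X 1 + X 2) ^ n : MvPowerSeries (Fin 3) A) =
      ∑ i ∈ Finset.range (n + 1), C (n.choose i : A) * (X 0 ^ l * X 1 ^ i * X 2 ^ (n - i)) := by
    rw [add_pow, Finset.mul_sum]
    refine Finset.sum_congr rfl fun i _ => ?_
    rw [map_natCast]; ring
  rw [e, map_sum]
  simp only [coeff_C_mul, coeff_X_pow_mul_X_pow_mul_X_pow]
  split_ifs with hn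
  · rw [Finset.sum_eq_single b, if_pos (by omega), mul_one, show n = b + k by omega]
    · intro i _ hi
      rw [if_neg (by omega), mul_zero]
    · simp; omega
  · refine Finset.sum_eq_zero fun i hi => ?_
    rw [if_neg (by omega), mul_zero]

variable {F G : FormalGroup A} {m : ℕ}

theorem formalGroup_sub_mem_ordIdeal_two (F G : FormalGroup A) :
    F.toPowerSeries - G.toPowerSeries ∈ ordIdeal (Fin 2) A 2 := by
  intro d hd
  rw [← bidegree_eta d] at hd ⊢
  generalize d 0 = i at hd ⊢
  generalize d 1 = j at hd ⊢
  rw [degree_bidegree] at hd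
  rw [map_sub]
  obtain ⟨rfl, rfl⟩ | ⟨rfl, rfl⟩ | ⟨rfl, rfl⟩ :
    (i = 0 ∧ j = 0) ∨ (i = 1 ∧ j = 0) ∨ (i = 0 ∧ j = 1) := by omega
  · simp [coeff_bidegree_zero_zero]
  · simp [coeff_bidegree_one_zero]
  · simp [coeff_bidegree_zero_one]

theorem sum_coeff_mul_mem_ordIdeal {τ : Type*} (hm : 1 ≤ m)
    (hFG : F.toPowerSeries - G.toPowerSeries ∈ ordIdeal (Fin 2) A m) {f g : MvPowerSeries τ A}
    (hf : f ∈ ordIdeal τ A 1) (hg : g ∈ ordIdeal τ A 1) :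
    F.toPowerSeries.subst ![f, g] - G.toPowerSeries.subst ![f, g] -
      ∑ i ∈ Finset.range (m + 1),
        C (coeff (bidegree i (m - i)) (F.toPowerSeries - G.toPowerSeries)) *
          (f ^ i * g ^ (m - i)) ∈ ordIdeal τ A (m + 1) := by
  have := subst_pair_sub_subst_pair_mem_ordIdeal hm hFG hf hf hg hg hf hg (by simp) (by simp)
    (by simp) (by simp)
  simpa using this

/-- Both laws satisfy the unit axiom, so substituting `(0, x)` leaves only the pure power of the
second variable. -/
theorem coeff_sub_zero_left (hm : 1 ≤ m)
    (hFG : F.toPowerSeries - G.toPowerSeries ∈ ordIdeal (Fin 2) A m) :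
    coeff (bidegree 0 m) (F.toPowerSeries - G.toPowerSeries) = 0 := by
  have hX : (PowerSeries.X : PowerSeries A) ∈ ordIdeal Unit A 1 := X_mem_ordIdeal ()
  have h := sum_coeff_mul_mem_ordIdeal hm hFG (zero_mem _) hX
  rw [F.zero_add (hasSubst_of_mem hX), G.zero_add (hasSubst_of_mem hX), Finset.sum_eq_single 0] at h
  · have := h (Finsupp.single () m) (by simp)
    rw [sub_self, zero_sub, map_neg, neg_eq_zero, coeff_C_mul, pow_zero, one_mul, Nat.sub_zero] at this
    rwa [PowerSeries.X, X_pow_eq, coeff_monomial_same, mul_one] at this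
  · intro i _ hi
    rw [zero_pow hi, zero_mul, mul_zero]
  · simp

theorem bidegree_swap_coeff (F : FormalGroup A) [F.IsComm] (i j : ℕ) :
    coeff (bidegree i j) F.toPowerSeries = coeff (bidegree j i) F.toPowerSeries := by
  have h : F.toPowerSeries = F.toPowerSeries.subst ![X 1, X 0] := FormalGroup.IsComm.comm
  conv_lhs => rw [h]
  rw [coeff_subst_pair (X_mem_ordIdeal 1) (X_mem_ordIdeal 0) _ (N := i + j + 1) (by simp),
    Finset.sum_eq_single j, Finset.sum_eq_single i]
  · have : (X 1 ^ j * X 0 ^ i : MvPowerSeries (Fin 2) A) = monomial (bidegree i j) 1 := by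
      simp only [X_pow_eq, monomial_mul_monomial, mul_one, bidegree, add_comm]
    rw [this, coeff_monomial_same, mul_one]
  · intro k _ hk
    have : (X 1 ^ j * X 0 ^ k : MvPowerSeries (Fin 2) A) = monomial (bidegree k j) 1 := by
      simp only [X_pow_eq, monomial_mul_monomial, mul_one, bidegree, add_comm]
    rw [this, coeff_monomial_ne, mul_zero]
    intro h
    exact hk (by simpa using (DFunLike.congr_fun h 0).symm)
  · intro h; exact absurd (Finset.mem_range.2 (by omega)) h
  · intro l _ hl
    refine Finset.sum_eq_zero fun k _ => ?_
    have : (X 1 ^ l * X 0 ^ k : MvPowerSeries (Fin 2) A) = monomial (bidegree k l) 1 := by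
      simp only [X_pow_eq, monomial_mul_monomial, mul_one, bidegree, add_comm]
    rw [this, coeff_monomial_ne, mul_zero]
    intro h
    exact hl (by simpa using (DFunLike.congr_fun h 1).symm)
  · intro h; exact absurd (Finset.mem_range.2 (by omega)) h

/-- Subtracting the associativity identities of `F` and `G` and keeping degree `m` gives the cocycle
equation for the leading difference; the relation is its coefficient at `x^a y^b z^k`. -/
theorem coeff_sub_cocycle (hm : 2 ≤ m)
    (hFG : F.toPowerSeries - G.toPowerSeries ∈ ordIdeal (Fin 2) A m) {a b k : ℕ} (ha : 0 < a)
    (_hb : 0 < b) (hk : 0 < k) (habk : a + b + k = m) :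
    ((a + b).choose a : A) *
        coeff (bidegree (a + b) (m - (a + b))) (F.toPowerSeries - G.toPowerSeries) =
      ((b + k).choose b : A) * coeff (bidegree a (m - a)) (F.toPowerSeries - G.toPowerSeries) := by
  have hm1 : 1 ≤ m := by omega
  have hX : ∀ i : Fin 3, (X i : MvPowerSeries (Fin 3) A) ∈ ordIdeal (Fin 3) A 1 := X_mem_ordIdeal
  set c : ℕ → A := fun i => coeff (bidegree i (m - i)) (F.toPowerSeries - G.toPowerSeries) with hcdef
  have hval : ∀ (H : FormalGroup A) (i j : Fin 3),
      H.toPowerSeries.subst ![X i, X j] ∈ ordIdeal (Fin 3) A 1 := fun H i j =>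
    subst_pair_mem_ordIdeal (hX i) (hX j) H.zero_constantCoeff
  have hdiff : ∀ i j : Fin 3, F.toPowerSeries.subst ![X i, X j] - G.toPowerSeries.subst ![X i, X j]
      ∈ ordIdeal (Fin 3) A m := by
    intro i j
    have h := sum_coeff_mul_mem_ordIdeal hm1 hFG (hX i) (hX j)
    rw [← sub_add_cancel (F.toPowerSeries.subst ![X i, X j] - _)]
    refine add_mem (ordIdeal_anti (Nat.le_succ m) h) (Ideal.sum_mem _ fun l hl => ?_)
    refine Ideal.mul_mem_left _ _ (ordIdeal_anti ?_ (mul_mem_ordIdeal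
      (pow_mem_ordIdeal_one (hX i) l) (pow_mem_ordIdeal_one (hX j) (m - l))))
    omega
  have h1 := sum_coeff_mul_mem_ordIdeal hm1 hFG (hX 0) (hX 1)
  have h2 := sum_coeff_mul_mem_ordIdeal hm1 hFG (hX 1) (hX 2)
  have h3 := subst_pair_sub_subst_pair_mem_ordIdeal hm1 hFG (hval F 0 1) (hval G 0 1) (hX 2) (hX 2)
    (add_mem (hX 0) (hX 1)) (hX 2) (hdiff 0 1) (by simp)
    (subst_pair_sub_add_mem_ordIdeal G (hX 0) (hX 1)) (by simp)
  have h4 := subst_pair_sub_subst_pair_mem_ordIdeal hm1 hFG (hX 0) (hX 0) (hval F 1 2) (hval G 1 2)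
    (hX 0) (add_mem (hX 1) (hX 2)) (by simp) (hdiff 1 2) (by simp)
    (subst_pair_sub_add_mem_ordIdeal G (hX 1) (hX 2))
  rw [F.assoc' (hasSubst_of_mem (hX 0)) (hasSubst_of_mem (hX 1)) (hasSubst_of_mem (hX 2)),
    G.assoc' (hasSubst_of_mem (hX 0)) (hasSubst_of_mem (hX 1)) (hasSubst_of_mem (hX 2))] at h3
  -- Associativity has given `h3` and `h4` the same outer substitutions. Subtracting `h1` and `h2`
  -- removes the inner ones, and only values of the degree `m` form remain.
  have h5 := sub_mem (sub_mem h4 h3) (sub_mem h1 h2)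
  have h6 : (∑ i ∈ Finset.range (m + 1), C (c i) * ((X 0 + X 1) ^ i * X 2 ^ (m - i)) -
      ∑ i ∈ Finset.range (m + 1), C (c i) * (X 0 ^ i * (X 1 + X 2) ^ (m - i))) +
      (∑ i ∈ Finset.range (m + 1), C (c i) * (X 0 ^ i * X 1 ^ (m - i)) -
      ∑ i ∈ Finset.range (m + 1), C (c i) * (X 1 ^ i * X 2 ^ (m - i))) ∈
        ordIdeal (Fin 3) A (m + 1) := by
    convert h5 using 1
    ring
  have h7 := h6 (Finsupp.single 0 a + Finsupp.single 1 b + Finsupp.single 2 k) (by simp; omega)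
  simp only [map_add, map_sub, map_sum, coeff_C_mul] at h7
  have e1 : ∀ i ∈ Finset.range (m + 1), c i * coeff (Finsupp.single 0 a + Finsupp.single 1 b +
      Finsupp.single 2 k) ((X 0 + X 1) ^ i * X 2 ^ (m - i) : MvPowerSeries (Fin 3) A) =
      if i = a + b then c i * ((a + b).choose a : A) else 0 := by
    intro i hi
    rw [Finset.mem_range] at hi
    rw [coeff_X_add_X_pow_mul_X_pow (by omega), mul_ite, mul_zero]
  have e2 : ∀ i ∈ Finset.range (m + 1), c i * coeff (Finsupp.single 0 a + Finsupp.single 1 b +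
      Finsupp.single 2 k) (X 0 ^ i * (X 1 + X 2) ^ (m - i) : MvPowerSeries (Fin 3) A) =
      if i = a then c i * ((b + k).choose b : A) else 0 := by
    intro i hi
    rw [Finset.mem_range] at hi
    rw [coeff_X_pow_mul_X_add_X_pow (by omega), mul_ite, mul_zero]
  -- The terms in only two variables do not meet the monomial, as its three exponents are positive.
  have e3 : ∀ i ∈ Finset.range (m + 1), c i * coeff (Finsupp.single 0 a + Finsupp.single 1 b +
      Finsupp.single 2 k) (X 0 ^ i * X 1 ^ (m - i) : MvPowerSeries (Fin 3) A) = 0 := by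
    intro i _
    have := coeff_X_pow_mul_X_pow_mul_X_pow (A := A) a b k i (m - i) 0
    rw [pow_zero, mul_one, if_neg (by omega)] at this
    rw [this, mul_zero]
  have e4 : ∀ i ∈ Finset.range (m + 1), c i * coeff (Finsupp.single 0 a + Finsupp.single 1 b +
      Finsupp.single 2 k) (X 1 ^ i * X 2 ^ (m - i) : MvPowerSeries (Fin 3) A) = 0 := by
    intro i _
    have := coeff_X_pow_mul_X_pow_mul_X_pow (A := A) a b k 0 i (m - i)
    rw [pow_zero, one_mul, if_neg (by omega)] at this
    rw [this, mul_zero]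
  rw [Finset.sum_congr rfl e1, Finset.sum_congr rfl e2, Finset.sum_congr rfl e3,
    Finset.sum_congr rfl e4, Finset.sum_const_zero, Finset.sum_ite_eq', Finset.sum_ite_eq',
    if_pos (by simp; omega), if_pos (by simp; omega)] at h7
  rw [sub_zero, add_zero, sub_eq_zero] at h7
  rw [mul_comm, h7, mul_comm]

end Cocycle

end PnTypical

end

noncomputable section

namespace PnTypical

open MvPowerSeries

/-! ### Formal sums of linear curves and base change -/

section ListSum

variable {A : Type*} [CommRing A]

/-- The sum on a formal group law of the curves `c x`, for the scalars `c` in a list. -/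
def listSum (F : FormalGroup A) (l : List A) : F.Point Unit := (l.map (linearCurve F)).sum

theorem linearCurve_val (F : FormalGroup A) (c : A) :
    (linearCurve F c).val = C c * X () := by
  change c • (X () : MvPowerSeries Unit A) = _
  rw [smul_eq_C_mul]

theorem listSum_nil_val (F : FormalGroup A) : (listSum F []).val = 0 := rfl

theorem listSum_cons_val (F : FormalGroup A) (c : A) (l : List A) :
    (listSum F (c :: l)).val = F.toPowerSeries.subst ![C c * X (), (listSum F l).val] := by
  rw [← linearCurve_val F c]; rfl

theorem C_mul_X_mem_ordIdeal (c : A) : (C c * X () : MvPowerSeries Unit A) ∈ ordIdeal Unit A 1 :=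
  Ideal.mul_mem_left _ _ (X_mem_ordIdeal ())

theorem listSum_val_mem_ordIdeal (F : FormalGroup A) (l : List A) :
    (listSum F l).val ∈ ordIdeal Unit A 1 := by
  induction l with
  | nil => exact zero_mem _
  | cons c l ih =>
    rw [listSum_cons_val]
    exact subst_pair_mem_ordIdeal (C_mul_X_mem_ordIdeal c) ih F.zero_constantCoeff

theorem listSum_val_sub_mem_ordIdeal (F : FormalGroup A) (l : List A) :
    (listSum F l).val - C l.sum * X () ∈ ordIdeal Unit A 2 := by
  induction l with
  | nil => simp [listSum_nil_val]
  | cons c l ih =>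
    rw [listSum_cons_val]
    have := subst_pair_sub_add_mem_ordIdeal F (C_mul_X_mem_ordIdeal c)
      (listSum_val_mem_ordIdeal F l)
    convert add_mem this ih using 1
    rw [List.sum_cons, map_add]
    ring

theorem rootOfUnitySum_eq (F : FormalGroup A) (q : ℕ) :
    rootOfUnitySum F q =
      (listSum (F.map (AdjoinRoot.of (Polynomial.cyclotomic q A)))
        ((List.range q).map fun i => AdjoinRoot.root (Polynomial.cyclotomic q A) ^ i)).val := by
  rw [listSum, List.map_map]; rfl

theorem multSeries_eq (F : FormalGroup A) (m : ℕ) :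
    multSeries F m = (listSum F (List.replicate m 1)).val := by
  rw [listSum, List.map_replicate, List.sum_replicate]; rfl

theorem map_listSum_val {B : Type*} [CommRing B] (φ : A →+* B) (F : FormalGroup A) (l : List A) :
    MvPowerSeries.map φ (listSum F l).val = (listSum (F.map φ) (l.map φ)).val := by
  induction l with
  | nil => rw [listSum_nil_val, map_zero]; rfl
  | cons c l ih =>
    rw [List.map_cons, listSum_cons_val, listSum_cons_val, ← ih,
      map_subst (hasSubst_pair (C_mul_X_mem_ordIdeal c) (listSum_val_mem_ordIdeal F l))]
    congr 1
    ext1 i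
    fin_cases i <;> simp

theorem multSeries_map {B : Type*} [CommRing B] (φ : A →+* B) (F : FormalGroup A) (m : ℕ) :
    multSeries (F.map φ) m = MvPowerSeries.map φ (multSeries F m) := by
  rw [multSeries_eq, multSeries_eq, map_listSum_val, List.map_replicate, map_one]

theorem formalGroup_map_map {B D : Type*} [CommRing B] [CommRing D] (φ : A →+* B) (ψ : B →+* D)
    (F : FormalGroup A) : (F.map φ).map ψ = F.map (ψ.comp φ) := by
  ext1
  ext d
  simp

theorem isComm_map {B : Type*} [CommRing B] (φ : A →+* B) {F : FormalGroup A} (hF : F.IsComm) :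
    (F.map φ).IsComm := by
  constructor
  have h : F.toPowerSeries = F.toPowerSeries.subst ![X 1, X 0] := hF.comm
  change MvPowerSeries.map φ F.toPowerSeries =
    (MvPowerSeries.map φ F.toPowerSeries).subst ![X 1, X 0]
  conv_lhs => rw [h, map_subst HasSubst.X_X]
  congr 1
  ext1 i
  fin_cases i <;> simp

theorem rootOfUnitySum_map {B : Type*} [CommRing B] (φ : A →+* B) (F : FormalGroup A) (q : ℕ) :
    rootOfUnitySum (F.map φ) q = MvPowerSeries.map (AdjoinRoot.map φ (Polynomial.cyclotomic q A)
      (Polynomial.cyclotomic q B) (by rw [Polynomial.map_cyclotomic])) (rootOfUnitySum F q) := by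
  rw [rootOfUnitySum_eq, rootOfUnitySum_eq, map_listSum_val, formalGroup_map_map,
    formalGroup_map_map, List.map_map]
  have h1 : (AdjoinRoot.of (Polynomial.cyclotomic q B)).comp φ =
      (AdjoinRoot.map φ (Polynomial.cyclotomic q A) (Polynomial.cyclotomic q B)
        (by rw [Polynomial.map_cyclotomic])).comp (AdjoinRoot.of (Polynomial.cyclotomic q A)) := by
    ext x; simp
  have h2 : (fun i : ℕ => AdjoinRoot.root (Polynomial.cyclotomic q B) ^ i) =
      (AdjoinRoot.map φ (Polynomial.cyclotomic q A) (Polynomial.cyclotomic q B)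
        (by rw [Polynomial.map_cyclotomic])) ∘
        fun i : ℕ => AdjoinRoot.root (Polynomial.cyclotomic q A) ^ i := by
    ext x; simp
  rw [h1, h2]

theorem IsPTypical.map {B : Type*} [CommRing B] (φ : A →+* B) {p : ℕ} {F : FormalGroup A}
    (hF : IsPTypical p F) : IsPTypical p (F.map φ) :=
  ⟨isComm_map φ hF.1, fun q hq hqp => by rw [rootOfUnitySum_map, hF.2 q hq hqp, map_zero]⟩

/-- By `hc` the leading difference is `a ((x+y)^m - x^m - y^m)`. Adding one curve `c x` to a sum
with linear part `s x` changes the difference by `a ((c+s)^m - c^m - s^m)`, and these contributions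
telescope along the list. -/
theorem listSum_val_sub_listSum_val_mem_ordIdeal {F G : FormalGroup A} {m : ℕ} (hm : 1 ≤ m)
    (hFG : F.toPowerSeries - G.toPowerSeries ∈ ordIdeal (Fin 2) A m) {a : A}
    (hc : ∀ i ≤ m, coeff (bidegree i (m - i)) (F.toPowerSeries - G.toPowerSeries) =
      a * ((m.choose i : A) - (if i = 0 then 1 else 0) - (if i = m then 1 else 0)))
    (l : List A) :
    (listSum F l).val - (listSum G l).val -
      C (a * (l.sum ^ m - (l.map (· ^ m)).sum)) * X () ^ m ∈ ordIdeal Unit A (m + 1) := by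
  have hX : (X () ^ m : MvPowerSeries Unit A) ∈ ordIdeal Unit A m :=
    pow_mem_ordIdeal_one (X_mem_ordIdeal ()) m
  induction l with
  | nil => simp [listSum_nil_val, show m ≠ 0 by omega]
  | cons c l ih =>
    have hd : (listSum F l).val - (listSum G l).val ∈ ordIdeal Unit A m := by
      have := add_mem (ordIdeal_anti (Nat.le_succ m) ih) (Ideal.mul_mem_left _
        (C (a * (l.sum ^ m - (l.map (· ^ m)).sum))) hX)
      rwa [sub_add_cancel] at this
    have h := subst_pair_sub_subst_pair_mem_ordIdeal hm hFG (C_mul_X_mem_ordIdeal c)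
      (C_mul_X_mem_ordIdeal c) (listSum_val_mem_ordIdeal F l) (listSum_val_mem_ordIdeal G l)
      (C_mul_X_mem_ordIdeal c) (C_mul_X_mem_ordIdeal l.sum) (by simp) hd (by simp)
      (listSum_val_sub_mem_ordIdeal G l)
    have hs : ∑ i ∈ Finset.range (m + 1),
        C (coeff (bidegree i (m - i)) (F.toPowerSeries - G.toPowerSeries)) *
          ((C c * X ()) ^ i * (C l.sum * X ()) ^ (m - i)) =
        (C (a * ((c + l.sum) ^ m - c ^ m - l.sum ^ m)) * X () ^ m : MvPowerSeries Unit A) := by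
      have h1 : ∀ i ∈ Finset.range (m + 1),
          C (coeff (bidegree i (m - i)) (F.toPowerSeries - G.toPowerSeries)) *
          ((C c * X ()) ^ i * (C l.sum * X ()) ^ (m - i)) =
          (C (a * ((c ^ i * l.sum ^ (m - i) * (m.choose i : A)) -
            (if i = 0 then c ^ i * l.sum ^ (m - i) else 0) -
            (if i = m then c ^ i * l.sum ^ (m - i) else 0))) * X () ^ m :
              MvPowerSeries Unit A) := by
        intro i hi
        have him : i ≤ m := by rw [Finset.mem_range] at hi; omega
        rw [hc i him, mul_pow, mul_pow, mul_mul_mul_comm, ← pow_add, Nat.add_sub_cancel' him,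
          ← map_pow, ← map_pow, ← map_mul, ← mul_assoc, ← map_mul]
        congr 2
        split_ifs <;> ring
      rw [Finset.sum_congr rfl h1, ← Finset.sum_mul, ← map_sum, ← Finset.mul_sum,
        Finset.sum_sub_distrib, Finset.sum_sub_distrib, ← add_pow, Finset.sum_ite_eq',
        Finset.sum_ite_eq', if_pos (by simp), if_pos (by simp)]
      simp only [pow_zero, Nat.sub_zero, Nat.sub_self, one_mul, mul_one]
      congr 3
      ring
    rw [hs, ← listSum_cons_val, ← listSum_cons_val, sub_self, zero_add] at h
    convert add_mem h ih using 1
    rw [List.sum_cons, List.map_cons, List.sum_cons]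
    simp only [map_mul, map_sub, map_add]
    ring

end ListSum

/-! ### A p-typical law is determined by one coefficient in each degree p^(k+1) -/

section Uniqueness

variable {p : ℕ} [Fact p.Prime] {A : Type*} [CommRing A]

theorem adjoinRoot_of_injective {f : Polynomial A} (hf : f.Monic) (hd : f.natDegree ≠ 0) :
    Function.Injective (AdjoinRoot.of f) := by
  rw [injective_iff_map_eq_zero]
  intro a ha
  by_contra h
  rw [← AdjoinRoot.mk_C, AdjoinRoot.mk_eq_zero] at ha
  exact hf.not_dvd_of_natDegree_lt (by simpa using h) (by simp; omega) ha

theorem geom_sum_root_cyclotomic {q : ℕ} (hq : q.Prime) :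
    ∑ i ∈ Finset.range q, AdjoinRoot.root (Polynomial.cyclotomic q A) ^ i = 0 := by
  have := Fact.mk hq
  have h : AdjoinRoot.mk (Polynomial.cyclotomic q A) (∑ i ∈ Finset.range q, Polynomial.X ^ i) = 0 := by
    rw [← Polynomial.cyclotomic_prime]; exact AdjoinRoot.mk_self
  simpa only [map_sum, map_pow, AdjoinRoot.mk_X] using h

theorem list_sum_map_range {M : Type*} [AddCommMonoid M] (f : ℕ → M) (n : ℕ) :
    ((List.range n).map f).sum = ∑ i ∈ Finset.range n, f i := by
  induction n with
  | zero => simp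
  | succ n ih => simp [List.range_succ, Finset.sum_range_succ, ih]

theorem root_cyclotomic_pow {q : ℕ} (hq : q.Prime) :
    AdjoinRoot.root (Polynomial.cyclotomic q A) ^ q = 1 := by
  have := geom_sum_mul (AdjoinRoot.root (Polynomial.cyclotomic q A)) q
  rw [geom_sum_root_cyclotomic hq, zero_mul] at this
  exact (sub_eq_zero.1 this.symm)

/-- Binomial coefficients themselves form a symmetric cocycle. Subtracting `a` times them makes the
coefficient at `p ^ r` vanish, and `cocycle_eq_zero` kills the rest. -/
theorem coeff_sub_eq_zero_of_cocycle (hA : ∀ n : ℕ, ¬ p ∣ n → IsUnit (n : A))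
    {F G : FormalGroup A} (hF : F.IsComm) (hG : G.IsComm) {m r u : ℕ} (hm : m = p ^ r * u)
    (hu : 2 ≤ u) (hpu : ∀ t, 0 < t → t < u → ¬ p ∣ t ∨ ¬ p ∣ u - t)
    (hFG : F.toPowerSeries - G.toPowerSeries ∈ ordIdeal (Fin 2) A m) {a : A}
    (hr : coeff (bidegree (p ^ r) (m - p ^ r)) (F.toPowerSeries - G.toPowerSeries) =
      a * (m.choose (p ^ r) : A)) {i : ℕ} (hi : i ≤ m) :
    coeff (bidegree i (m - i)) (F.toPowerSeries - G.toPowerSeries) =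
      a * ((m.choose i : A) - (if i = 0 then 1 else 0) - (if i = m then 1 else 0)) := by
  have hpr : 0 < p ^ r := pow_pos (Fact.out : p.Prime).pos r
  have hm2 : p ^ r * 2 ≤ m := hm ▸ Nat.mul_le_mul_left _ hu
  have hsym : ∀ i ≤ m, coeff (bidegree (m - i) (m - (m - i))) (F.toPowerSeries - G.toPowerSeries) =
      coeff (bidegree i (m - i)) (F.toPowerSeries - G.toPowerSeries) := by
    intro i hi
    rw [map_sub, map_sub, bidegree_swap_coeff F, bidegree_swap_coeff G, Nat.sub_sub_self hi]
  have h0 := coeff_sub_zero_left (by omega) hFG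
  rcases Nat.eq_zero_or_pos i with rfl | hi0
  · rw [Nat.sub_zero, h0, if_neg (show 0 ≠ m by omega)]; simp
  rcases hi.eq_or_lt with rfl | him
  · have := hsym 0 (Nat.zero_le _)
    rw [Nat.sub_zero, h0] at this
    rw [this, if_neg (show i ≠ 0 by omega)]; simp
  rw [if_neg hi0.ne', if_neg him.ne, sub_zero, sub_zero, ← sub_eq_zero]
  refine cocycle_eq_zero hA hm hu hpu (c := fun i =>
    coeff (bidegree i (m - i)) (F.toPowerSeries - G.toPowerSeries) - a * (m.choose i : A))
    (fun i hi => ?_) (fun b d k hb hd hk h => ?_) (by rw [hr, sub_self]) hi0 him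
  · rw [hsym i hi, Nat.choose_symm hi]
  · rw [mul_sub, mul_sub, coeff_sub_cocycle (by omega) hFG hb hd hk h]
    congr 1
    have := Nat.choose_mul (n := m) (k := b + d) (s := b) (by omega)
    rw [show m - b = d + k by omega, Nat.add_sub_cancel_left] at this
    have h' := congrArg (Nat.cast : ℕ → A) this
    push_cast at h'
    linear_combination a * h'

/-- Induction on the degree up to which the laws agree. The distinguished coefficients settle the
degrees that are powers of `p`; in any other degree some prime `q ≠ p` divides it, and the vanishing
of the sum over `q`-th roots of unity settles it. -/
theorem IsPTypical.eq_of_coeff_eq (hA : ∀ n : ℕ, ¬ p ∣ n → IsUnit (n : A)) {F G : FormalGroup A}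
    (hF : IsPTypical p F) (hG : IsPTypical p G)
    (h : ∀ k, coeff (bidegree (p ^ k) (p ^ (k + 1) - p ^ k)) F.toPowerSeries =
      coeff (bidegree (p ^ k) (p ^ (k + 1) - p ^ k)) G.toPowerSeries) : F = G := by
  have hp : p.Prime := Fact.out
  rcases subsingleton_or_nontrivial A with hA' | hA'
  · ext1; ext d; exact Subsingleton.elim _ _
  suffices H : ∀ m, F.toPowerSeries - G.toPowerSeries ∈ ordIdeal (Fin 2) A (m + 2) from
    FormalGroup.ext (eq_of_forall_sub_mem_ordIdeal fun k =>
      ordIdeal_anti (Nat.le_add_right k 2) (H k))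
  intro m
  induction m with
  | zero => exact formalGroup_sub_mem_ordIdeal_two F G
  | succ m ih =>
    obtain ⟨M, hM⟩ : ∃ M, M = m + 2 := ⟨_, rfl⟩
    rw [← hM] at ih
    rw [show m + 1 + 2 = M + 1 by omega]
    suffices key : ∀ i ≤ M, coeff (bidegree i (M - i)) (F.toPowerSeries - G.toPowerSeries) = 0 by
      intro d hd
      rcases (Nat.lt_succ_iff.1 hd).lt_or_eq with hlt | heq
      · exact ih d hlt
      · rw [degree_fin_two] at heq
        rw [← bidegree_eta d, show d 1 = M - d 0 by omega]
        exact key _ (by omega)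
    obtain ⟨r, u, hpu, hMu⟩ := Nat.exists_eq_pow_mul_and_not_dvd (n := M) (by omega) p hp.ne_one
    have hu0 : u ≠ 0 := by rintro rfl; simp at hpu
    rcases Nat.lt_or_ge 1 u with hu | hu
    -- This binomial coefficient is `u` modulo `p`; being a unit, it can be used to normalise the
    -- cocycle at `p ^ r`.
    · have hcu : IsUnit ((M.choose (p ^ r) : ℕ) : A) := by
        apply hA
        have := choose_pow_mul_modEq (p := p) r M 1
        rw [mul_one, Nat.choose_one_right] at this
        rw [hMu, Nat.mul_div_cancel_left _ (pow_pos hp.pos r)] at this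
        rw [hMu]
        exact not_dvd_choose_of_modEq this hpu
      obtain ⟨a, ha⟩ : ∃ a, coeff (bidegree (p ^ r) (M - p ^ r)) (F.toPowerSeries - G.toPowerSeries) =
          a * (M.choose (p ^ r) : A) := by
        obtain ⟨b, hb⟩ := hcu.exists_left_inv
        exact ⟨_ * b, by rw [mul_assoc, hb, mul_one]⟩
      have hpu' : ∀ t, 0 < t → t < u → ¬ p ∣ t ∨ ¬ p ∣ u - t := by
        intro t _ htu
        by_contra! hc
        exact hpu (by have := Nat.dvd_add hc.1 hc.2; rwa [Nat.add_sub_cancel' htu.le] at this)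
      have hcoef := fun i hi => coeff_sub_eq_zero_of_cocycle hA hF.1 hG.1 hMu hu hpu' ih ha
        (i := i) hi
      suffices ha0 : a = 0 by
        intro i hi; rw [hcoef i hi, ha0, zero_mul]
      obtain ⟨q, hq, hqu⟩ := Nat.exists_prime_and_dvd hu.ne'
      have hqp : q ≠ p := by rintro rfl; exact hpu hqu
      have hqM : q ∣ M := hMu ▸ hqu.mul_left _
      have hFq := hF.2 q hq hqp
      have hGq := hG.2 q hq hqp
      rw [rootOfUnitySum_eq] at hFq hGq
      set o := AdjoinRoot.of (Polynomial.cyclotomic q A) with ho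
      have hinj : Function.Injective o := adjoinRoot_of_injective
        (Polynomial.cyclotomic.monic q A) (by
          rw [Polynomial.natDegree_cyclotomic]; exact (Nat.totient_pos.2 hq.pos).ne')
      have hmap : (F.map o).toPowerSeries - (G.map o).toPowerSeries =
          MvPowerSeries.map o (F.toPowerSeries - G.toPowerSeries) := by
        rw [map_sub]; rfl
      have hS := listSum_val_sub_listSum_val_mem_ordIdeal (F := F.map o) (G := G.map o)
        (m := M) (by omega) (by rw [hmap]; exact mapsTo_ordIdeal o ih) (a := o a) (by
          intro i hi
          rw [hmap, coeff_map, hcoef i hi]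
          simp only [map_mul, map_sub, map_natCast, apply_ite o, map_one, map_zero])
        ((List.range q).map fun i => AdjoinRoot.root (Polynomial.cyclotomic q A) ^ i)
      rw [hFq, hGq] at hS
      have hsum : ((List.range q).map fun i =>
          AdjoinRoot.root (Polynomial.cyclotomic q A) ^ i).sum = 0 := by
        rw [list_sum_map_range, geom_sum_root_cyclotomic hq]
      -- Since `q ∣ M`, every `ζ^(i M)` is `1`. The two root-of-unity sums therefore differ in
      -- degree `M` by `-a q`, and `q` is invertible.
      have hpow : (((List.range q).map fun i =>
          AdjoinRoot.root (Polynomial.cyclotomic q A) ^ i).map (· ^ M)).sum = q := by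
        rw [List.map_map, list_sum_map_range, Finset.sum_congr rfl (g := fun _ => 1) fun i _ => ?_]
        · simp
        · obtain ⟨s, hs⟩ := hqM
          rw [Function.comp_apply, hs, ← pow_mul, mul_comm, mul_assoc, pow_mul,
            root_cyclotomic_pow hq, one_pow]
      rw [hsum, hpow, zero_pow (by omega)] at hS
      have hS' := hS (Finsupp.single () M) (by simp)
      rw [sub_self, zero_sub, map_neg, neg_eq_zero, coeff_C_mul, X_pow_eq, coeff_monomial_same,
        mul_one, zero_sub, mul_neg, neg_eq_zero] at hS'
      have hqu' : IsUnit (q : A) := hA q fun hpq =>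
        hqp ((Nat.prime_dvd_prime_iff_eq hp hq).1 hpq).symm
      have hqo := hqu'.map o
      rw [map_natCast] at hqo
      exact hinj ((hqo.mul_left_eq_zero.1 hS').trans (map_zero o).symm)
    · obtain rfl : u = 1 := by omega
      rcases r with _ | r
      · simp at hMu; omega
      -- A power of `p` is split as `p ^ r * p`: with cofactor `p`, no positive `t < p` is divisible
      -- by `p`, and the normalising coefficient is the one given by `h`.
      have hMp : M = p ^ r * p := by rw [hMu, mul_one, pow_succ]
      have hpu' : ∀ t, 0 < t → t < p → ¬ p ∣ t ∨ ¬ p ∣ p - t :=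
        fun t h0 ht => Or.inl (Nat.not_dvd_of_pos_of_lt h0 ht)
      intro i hi
      rw [coeff_sub_eq_zero_of_cocycle hA hF.1 hG.1 hMp hp.two_le hpu' ih (a := 0) ?_ hi, zero_mul]
      rw [zero_mul, map_sub, sub_eq_zero]
      have := h r
      rwa [pow_succ, ← hMp] at this

end Uniqueness

end PnTypical

end

noncomputable section

namespace PnTypical

open MvPowerSeries

/-! ### Logarithms, and the formal group law of a given logarithm -/

section Logarithm

variable {τ : Type*} {A : Type*} [CommRing A]

theorem subst_powerSeries_subst {σ : Type*} {a : MvPowerSeries τ A} (ha : a ∈ ordIdeal τ A 1)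
    {b : τ → MvPowerSeries σ A} (hb : HasSubst b) (L : PowerSeries A) :
    MvPowerSeries.subst b (PowerSeries.subst a L) =
      PowerSeries.subst (MvPowerSeries.subst b a) L :=
  subst_comp_subst_apply (hasSubst_of_mem ha).const hb L

theorem powerSeries_subst_sub_sum_mem_ordIdeal {f : MvPowerSeries τ A} (hf : f ∈ ordIdeal τ A 1)
    (L : PowerSeries A) (N : ℕ) :
    PowerSeries.subst f L - ∑ i ∈ Finset.range N, C (PowerSeries.coeff i L) * f ^ i ∈
      ordIdeal τ A N := by
  intro e he
  rw [map_sub, PowerSeries.coeff_subst (hasSubst_of_mem hf),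
    finsum_eq_sum_of_support_subset (s := Finset.range N), map_sum, sub_eq_zero]
  · simp only [coeff_C_mul, smul_eq_mul]
  · intro i hi
    rw [Finset.coe_range, Set.mem_Iio]
    by_contra hc
    apply hi
    dsimp only
    rw [pow_mem_ordIdeal_one hf i e (by omega), smul_zero]

theorem powerSeries_subst_mem_ordIdeal {f : MvPowerSeries τ A} (hf : f ∈ ordIdeal τ A 1)
    {L : PowerSeries A} (hL : PowerSeries.constantCoeff L = 0) :
    PowerSeries.subst f L ∈ ordIdeal τ A 1 := by
  have := powerSeries_subst_sub_sum_mem_ordIdeal hf L 1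
  simpa [hL] using this

theorem powerSeries_subst_sub_self_mem_ordIdeal {f : MvPowerSeries τ A} (hf : f ∈ ordIdeal τ A 1)
    {L : PowerSeries A} (hL : PowerSeries.constantCoeff L = 0) (hL1 : PowerSeries.coeff 1 L = 1) :
    PowerSeries.subst f L - f ∈ ordIdeal τ A 2 := by
  have := powerSeries_subst_sub_sum_mem_ordIdeal hf L 2
  simpa [Finset.sum_range_succ, hL, hL1] using this

/-- The compositional inverse of a power series `x + ⋯`. -/
def expSeries (L : PowerSeries A) (hL1 : PowerSeries.coeff 1 L = 1) : PowerSeries A :=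
  L.substInvOfIsUnit (hL1 ▸ isUnit_one)

variable {L : PowerSeries A} (hL : PowerSeries.constantCoeff L = 0)
  (hL1 : PowerSeries.coeff 1 L = 1)

theorem constantCoeff_expSeries : PowerSeries.constantCoeff (expSeries L hL1) = 0 :=
  PowerSeries.constantCoeff_substInvOfIsUnit _ _

theorem coeff_one_expSeries : PowerSeries.coeff 1 (expSeries L hL1) = 1 := by
  rw [expSeries, PowerSeries.coeff_one_substInvOfIsUnit]
  have : (IsUnit.unit (hL1 ▸ isUnit_one : IsUnit (PowerSeries.coeff 1 L))) = 1 := by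
    ext; simpa using hL1
  rw [this]; simp

include hL in
theorem log_exp {f : MvPowerSeries τ A} (hf : f ∈ ordIdeal τ A 1) :
    PowerSeries.subst (PowerSeries.subst f (expSeries L hL1)) L = f := by
  have h : (expSeries L hL1 : MvPowerSeries Unit A) ∈ ordIdeal Unit A 1 :=
    mem_ordIdeal_one.2 (constantCoeff_expSeries hL1)
  have := subst_powerSeries_subst (A := A) h (hasSubst_of_mem hf).const L
  have h2 : PowerSeries.subst (expSeries L hL1) L = PowerSeries.X :=
    PowerSeries.subst_substInvOfIsUnit_right L hL _
  rw [h2] at this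
  exact this.symm.trans (PowerSeries.subst_X (hasSubst_of_mem hf))

include hL in
theorem exp_log {f : MvPowerSeries τ A} (hf : f ∈ ordIdeal τ A 1) :
    PowerSeries.subst (PowerSeries.subst f L) (expSeries L hL1) = f := by
  have h : (L : MvPowerSeries Unit A) ∈ ordIdeal Unit A 1 := mem_ordIdeal_one.2 hL
  have := subst_powerSeries_subst (A := A) h (hasSubst_of_mem hf).const (expSeries L hL1)
  have h2 : PowerSeries.subst L (expSeries L hL1) = PowerSeries.X :=
    PowerSeries.subst_substInvOfIsUnit_left L hL _
  rw [h2] at this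
  exact this.symm.trans (PowerSeries.subst_X (hasSubst_of_mem hf))

include hL hL1 in
theorem log_injective {f g : MvPowerSeries τ A} (hf : f ∈ ordIdeal τ A 1)
    (hg : g ∈ ordIdeal τ A 1) (h : PowerSeries.subst f L = PowerSeries.subst g L) : f = g := by
  rw [← exp_log hL hL1 hf, h, exp_log hL hL1 hg]

theorem powerSeries_subst_zero {L : PowerSeries A} (hL : PowerSeries.constantCoeff L = 0) :
    PowerSeries.subst (0 : MvPowerSeries τ A) L = 0 :=
  PowerSeries.subst_zero_of_constantCoeff_zero hL

theorem log_subst_pair_of_eq {P : MvPowerSeries (Fin 2) A} (hP : P ∈ ordIdeal (Fin 2) A 1)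
    (h : PowerSeries.subst P L = PowerSeries.subst (X 0 : MvPowerSeries (Fin 2) A) L +
      PowerSeries.subst (X 1 : MvPowerSeries (Fin 2) A) L) {f g : MvPowerSeries τ A}
    (hf : f ∈ ordIdeal τ A 1) (hg : g ∈ ordIdeal τ A 1) :
    PowerSeries.subst (P.subst ![f, g]) L = PowerSeries.subst f L + PowerSeries.subst g L := by
  have hfg := hasSubst_pair hf hg
  rw [← subst_powerSeries_subst hP hfg, h, subst_add hfg,
    subst_powerSeries_subst (X_mem_ordIdeal 0) hfg, subst_powerSeries_subst (X_mem_ordIdeal 1) hfg,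
    subst_X hfg, subst_X hfg]
  rfl

theorem IsLogarithm.subst_pair {F : FormalGroup A} {L : PowerSeries A} (h : IsLogarithm F L)
    {f g : MvPowerSeries τ A} (hf : f ∈ ordIdeal τ A 1) (hg : g ∈ ordIdeal τ A 1) :
    PowerSeries.subst (F.toPowerSeries.subst ![f, g]) L =
      PowerSeries.subst f L + PowerSeries.subst g L :=
  log_subst_pair_of_eq (mem_ordIdeal_one.2 F.zero_constantCoeff) h.2.2 hf hg

theorem IsLogarithm.listSum {F : FormalGroup A} {L : PowerSeries A} (h : IsLogarithm F L)
    (l : List A) : PowerSeries.subst (listSum F l).val L =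
      (l.map fun c => PowerSeries.subst (C c * X () : MvPowerSeries Unit A) L).sum := by
  induction l with
  | nil => rw [listSum_nil_val, powerSeries_subst_zero h.1]; rfl
  | cons c l ih =>
    rw [listSum_cons_val, h.subst_pair (C_mul_X_mem_ordIdeal c) (listSum_val_mem_ordIdeal F l), ih,
      List.map_cons, List.sum_cons]

theorem IsLogarithm.map {B : Type*} [CommRing B] (φ : A →+* B) {F : FormalGroup A}
    {L : PowerSeries A} (h : IsLogarithm F L) :
    IsLogarithm (F.map φ) (PowerSeries.map φ L) := by
  refine ⟨?_, ?_, ?_⟩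
  · rw [← PowerSeries.coeff_zero_eq_constantCoeff_apply, PowerSeries.coeff_map,
      PowerSeries.coeff_zero_eq_constantCoeff_apply, h.1, map_zero]
  · rw [PowerSeries.coeff_map, h.2.1, map_one]
  · have hs : ∀ f : MvPowerSeries (Fin 2) A, f ∈ ordIdeal (Fin 2) A 1 →
        PowerSeries.subst (MvPowerSeries.map φ f) (PowerSeries.map φ L) =
          MvPowerSeries.map φ (PowerSeries.subst f L) := fun f hf =>
      (PowerSeries.map_subst (hasSubst_of_mem hf) L).symm
    have h0 := hs _ (X_mem_ordIdeal 0)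
    have h1 := hs _ (X_mem_ordIdeal 1)
    rw [map_X] at h0 h1
    have hF := hs F.toPowerSeries (mem_ordIdeal_one.2 F.zero_constantCoeff)
    rw [h.2.2, map_add, ← h0, ← h1] at hF
    exact hF

/-- The power series `L⁻¹(L(x) + L(y))`. -/
def logLawSeries (L : PowerSeries A) (hL1 : PowerSeries.coeff 1 L = 1) :
    MvPowerSeries (Fin 2) A :=
  PowerSeries.subst (PowerSeries.subst (X 0 : MvPowerSeries (Fin 2) A) L +
    PowerSeries.subst (X 1 : MvPowerSeries (Fin 2) A) L) (expSeries L hL1)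

include hL in
theorem log_X_add_log_X_mem_ordIdeal : PowerSeries.subst (X 0 : MvPowerSeries (Fin 2) A) L +
    PowerSeries.subst (X 1 : MvPowerSeries (Fin 2) A) L ∈ ordIdeal (Fin 2) A 1 :=
  add_mem (powerSeries_subst_mem_ordIdeal (X_mem_ordIdeal 0) hL)
    (powerSeries_subst_mem_ordIdeal (X_mem_ordIdeal 1) hL)

include hL in
theorem logLawSeries_mem_ordIdeal : logLawSeries L hL1 ∈ ordIdeal (Fin 2) A 1 :=
  powerSeries_subst_mem_ordIdeal (log_X_add_log_X_mem_ordIdeal hL) (constantCoeff_expSeries hL1)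

include hL in
theorem log_logLawSeries : PowerSeries.subst (logLawSeries L hL1) L =
    PowerSeries.subst (X 0 : MvPowerSeries (Fin 2) A) L +
      PowerSeries.subst (X 1 : MvPowerSeries (Fin 2) A) L :=
  log_exp hL hL1 (log_X_add_log_X_mem_ordIdeal hL)

include hL in
theorem logLawSeries_sub_mem_ordIdeal :
    logLawSeries L hL1 - (X 0 + X 1) ∈ ordIdeal (Fin 2) A 2 := by
  have h1 := powerSeries_subst_sub_self_mem_ordIdeal (log_X_add_log_X_mem_ordIdeal hL)
    (constantCoeff_expSeries hL1) (coeff_one_expSeries hL1)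
  have h2 := powerSeries_subst_sub_self_mem_ordIdeal (X_mem_ordIdeal (A := A) (0 : Fin 2)) hL hL1
  have h3 := powerSeries_subst_sub_self_mem_ordIdeal (X_mem_ordIdeal (A := A) (1 : Fin 2)) hL hL1
  convert add_mem (add_mem h1 h2) h3 using 1
  rw [logLawSeries]
  ring

/-- The formal group law with logarithm `L`. -/
def logFormalGroup (L : PowerSeries A) (hL : PowerSeries.constantCoeff L = 0)
    (hL1 : PowerSeries.coeff 1 L = 1) : FormalGroup A where
  toPowerSeries := logLawSeries L hL1
  zero_constantCoeff := mem_ordIdeal_one.1 (logLawSeries_mem_ordIdeal hL hL1)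
  lin_coeff_X := by
    rw [coeff_eq_of_sub_mem_ordIdeal (logLawSeries_sub_mem_ordIdeal hL hL1) (by simp)]
    simp [coeff_index_single_X]
  lin_coeff_Y := by
    rw [coeff_eq_of_sub_mem_ordIdeal (logLawSeries_sub_mem_ordIdeal hL hL1) (by simp)]
    simp [coeff_index_single_X]
  assoc := by
    have hP := logLawSeries_mem_ordIdeal hL hL1
    have hX : ∀ i : Fin 3, (X i : MvPowerSeries (Fin 3) A) ∈ ordIdeal (Fin 3) A 1 := X_mem_ordIdeal
    have hP0 := mem_ordIdeal_one.1 hP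
    have hlog := log_logLawSeries hL hL1
    have h01 := subst_pair_mem_ordIdeal (hX 0) (hX 1) hP0
    have h12 := subst_pair_mem_ordIdeal (hX 1) (hX 2) hP0
    -- Associativity is tested after applying `L`, which turns both sides into `L(x) + L(y) + L(z)`.
    refine log_injective hL hL1 (subst_pair_mem_ordIdeal h01 (hX 2) hP0)
      (subst_pair_mem_ordIdeal (hX 0) h12 hP0) ?_
    rw [log_subst_pair_of_eq hP hlog h01 (hX 2), log_subst_pair_of_eq hP hlog (hX 0) h12,
      log_subst_pair_of_eq hP hlog (hX 0) (hX 1), log_subst_pair_of_eq hP hlog (hX 1) (hX 2),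
      add_assoc]

theorem isLogarithm_logFormalGroup : IsLogarithm (logFormalGroup L hL hL1) L :=
  ⟨hL, hL1, log_logLawSeries hL hL1⟩

theorem isComm_of_isLogarithm {F : FormalGroup A} {L : PowerSeries A} (h : IsLogarithm F L) :
    F.IsComm := by
  constructor
  have hF : F.toPowerSeries ∈ ordIdeal (Fin 2) A 1 := mem_ordIdeal_one.2 F.zero_constantCoeff
  refine log_injective h.1 h.2.1 hF
    (subst_pair_mem_ordIdeal (X_mem_ordIdeal 1) (X_mem_ordIdeal 0) F.zero_constantCoeff) ?_
  have h1 := h.subst_pair (X_mem_ordIdeal (1 : Fin 2)) (X_mem_ordIdeal (0 : Fin 2))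
  exact (h.2.2.trans (add_comm _ _)).trans h1.symm

end Logarithm

/-! ### Series supported on powers of p -/

section PowerLog

variable {τ : Type*} {A : Type*} [CommRing A] (p : ℕ) [Fact p.Prime]

/-- The power series `∑ l_k x^(p^k)`. -/
def pLogSeries (l : ℕ → A) : PowerSeries A :=
  PowerSeries.mk fun m => if m = p ^ Nat.log p m then l (Nat.log p m) else 0

theorem coeff_pLogSeries_pow (l : ℕ → A) (k : ℕ) :
    PowerSeries.coeff (p ^ k) (pLogSeries p l) = l k := by
  rw [pLogSeries, PowerSeries.coeff_mk, Nat.log_pow (Fact.out : p.Prime).one_lt, if_pos rfl]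

theorem coeff_pLogSeries_of_ne (l : ℕ → A) {m : ℕ} (hm : ∀ k, m ≠ p ^ k) :
    PowerSeries.coeff m (pLogSeries p l) = 0 := by
  rw [pLogSeries, PowerSeries.coeff_mk, if_neg (hm _)]

theorem constantCoeff_pLogSeries (l : ℕ → A) :
    PowerSeries.constantCoeff (pLogSeries p l) = 0 := by
  rw [← PowerSeries.coeff_zero_eq_constantCoeff_apply]
  exact coeff_pLogSeries_of_ne p l fun k => (pow_pos (Fact.out : p.Prime).pos k).ne

theorem coeff_one_pLogSeries (l : ℕ → A) (h0 : l 0 = 1) :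
    PowerSeries.coeff 1 (pLogSeries p l) = 1 := by
  rw [← pow_zero p, coeff_pLogSeries_pow, h0]

theorem pLogSeries_subst_sub_sum_mem_ordIdeal {f : MvPowerSeries τ A} (hf : f ∈ ordIdeal τ A 1)
    (l : ℕ → A) (N : ℕ) :
    PowerSeries.subst f (pLogSeries p l) - ∑ k ∈ Finset.range N, C (l k) * f ^ p ^ k ∈
      ordIdeal τ A (p ^ N) := by
  have hp : p.Prime := Fact.out
  have h := powerSeries_subst_sub_sum_mem_ordIdeal hf (pLogSeries p l) (p ^ N)
  rwa [← Finset.sum_subset (s₁ := (Finset.range N).image (p ^ ·)),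
    Finset.sum_image fun a _ b _ => (Nat.pow_right_injective hp.two_le).eq_iff.1,
    Finset.sum_congr rfl fun k _ => by rw [coeff_pLogSeries_pow]] at h
  · intro i hi
    obtain ⟨k, hk, rfl⟩ := Finset.mem_image.1 hi
    exact Finset.mem_range.2 (Nat.pow_lt_pow_right hp.one_lt (Finset.mem_range.1 hk))
  · intro i hi hi'
    rw [coeff_pLogSeries_of_ne, map_zero, zero_mul]
    rintro k rfl
    exact hi' (Finset.mem_image.2 ⟨k, Finset.mem_range.2
      ((Nat.pow_lt_pow_iff_right hp.one_lt).1 (Finset.mem_range.1 hi)), rfl⟩)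

theorem map_pLogSeries {B : Type*} [CommRing B] (φ : A →+* B) (l : ℕ → A) :
    PowerSeries.map φ (pLogSeries p l) = pLogSeries p fun k => φ (l k) := by
  ext m
  rw [PowerSeries.coeff_map, pLogSeries, pLogSeries, PowerSeries.coeff_mk, PowerSeries.coeff_mk,
    apply_ite φ, map_zero]

end PowerLog

end PnTypical

end

noncomputable section

namespace PnTypical

open MvPowerSeries

/-! ### Hazewinkel's functional equation lemma -/

section FunctionalEquation

variable {τ : Type*} {p : ℕ} [hp : Fact p.Prime] {K : Type*} [CommRing K]

variable (τ p) in
/-- The operator `f(x) ↦ (σ f)(x^p)` on power series. -/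
def twistExpand (σ : K →+* K) : MvPowerSeries τ K →+* MvPowerSeries τ K :=
  (expand p hp.out.ne_zero).toRingHom.comp (MvPowerSeries.map σ)

theorem twistExpand_apply (σ : K →+* K) (f : MvPowerSeries τ K) :
    twistExpand τ p σ f = expand p hp.out.ne_zero (MvPowerSeries.map σ f) := rfl

theorem twistExpand_C (σ : K →+* K) (a : K) :
    twistExpand τ p σ (C a) = C (σ a) := by
  rw [twistExpand_apply, map_C, expand_C]

theorem twistExpand_pow_C (σ : K →+* K) (i : ℕ) (a : K) :
    (twistExpand τ p σ ^ i) (C a) = C ((σ ^ i) a) := by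
  induction i with
  | zero => rfl
  | succ i ih => rw [pow_succ', pow_succ', RingHom.mul_def, RingHom.mul_def, RingHom.comp_apply,
      RingHom.comp_apply, ih, twistExpand_C]

theorem twistExpand_pow_X (σ : K →+* K) (i : ℕ) (s : τ) :
    (twistExpand τ p σ ^ i) (X s) = X s ^ p ^ i := by
  induction i with
  | zero => simp
  | succ i ih =>
    rw [pow_succ', RingHom.mul_def, RingHom.comp_apply, ih, map_pow, twistExpand_apply, map_X,
      expand_X, ← pow_mul, pow_succ']

theorem expand_mem_ordIdeal {f : MvPowerSeries τ K} {n : ℕ} (hf : f ∈ ordIdeal τ K n) :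
    expand p hp.out.ne_zero f ∈ ordIdeal τ K (p * n) := by
  intro d hd
  by_cases h : ∀ i, p ∣ d i
  · obtain ⟨m, rfl⟩ : ∃ m, p • m = d := ⟨d.mapRange (fun a ↦ a / p) (by simp),
      by ext i; simp [(Nat.mul_div_cancel' (h i))]⟩
    rw [coeff_expand_smul]
    refine hf m ?_
    rw [map_nsmul, smul_eq_mul] at hd
    exact Nat.lt_of_mul_lt_mul_left hd
  · push Not at h
    obtain ⟨i, hi⟩ := h
    exact coeff_expand_of_not_dvd p _ f hi

theorem twistExpand_pow_mem_ordIdeal (σ : K →+* K) {f : MvPowerSeries τ K} {n : ℕ}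
    (hf : f ∈ ordIdeal τ K n) (i : ℕ) :
    (twistExpand τ p σ ^ i) f ∈ ordIdeal τ K (p ^ i * n) := by
  induction i with
  | zero => simpa using hf
  | succ i ih =>
    rw [pow_succ' (twistExpand τ p σ), RingHom.mul_def, RingHom.comp_apply, pow_succ' p, mul_assoc]
    exact expand_mem_ordIdeal (mapsTo_ordIdeal σ ih)

theorem twistExpand_pow_map {A : Type*} [CommRing A] {ι : A →+* K} {σA : A →+* A} {σ : K →+* K}
    (hσ : σ.comp ι = ι.comp σA) (i : ℕ) (g : MvPowerSeries τ A) :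
    (twistExpand τ p σ ^ i) (MvPowerSeries.map ι g) =
      MvPowerSeries.map ι ((twistExpand τ p σA ^ i) g) := by
  induction i with
  | zero => rfl
  | succ i ih =>
    rw [pow_succ', pow_succ', RingHom.mul_def, RingHom.mul_def, RingHom.comp_apply,
      RingHom.comp_apply, ih, twistExpand_apply, twistExpand_apply, map_expand, map_map, map_map, hσ]

theorem natCast_dvd_of_forall_coeff {A : Type*} [CommRing A] {n : ℕ} {f : MvPowerSeries τ A}
    (h : ∀ d, (n : A) ∣ coeff d f) : (n : MvPowerSeries τ A) ∣ f := by
  choose c hc using h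
  refine ⟨ofCoeff c, ?_⟩
  ext d
  rw [hc d, ← map_natCast (C (σ := τ) (R := A)), coeff_C_mul, coeff_ofCoeff]

/-- A lift `σ` of Frobenius satisfies `(σ^i g)(x^(p^i)) ≡ g(x)^(p^i)` modulo `p`. -/
theorem dvd_twistExpand_pow_sub {A : Type*} [CommRing A] {σ : A →+* A}
    [CharP (A ⧸ Ideal.span {(p : A)}) p] (hσ : ∀ a, (p : A) ∣ σ a - a ^ p) (i : ℕ)
    (g : MvPowerSeries τ A) : (p : MvPowerSeries τ A) ∣ (twistExpand τ p σ ^ i) g - g ^ p ^ i := by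
  set mk := Ideal.Quotient.mk (Ideal.span {(p : A)})
  have hmk : mk.comp σ = (frobenius _ p).comp mk := by
    ext a
    rw [RingHom.comp_apply, RingHom.comp_apply, frobenius_def, ← map_pow, Ideal.Quotient.mk_eq_mk_iff_sub_mem,
      Ideal.mem_span_singleton]
    exact hσ a
  have h1 : ∀ g : MvPowerSeries τ A,
      MvPowerSeries.map mk (twistExpand τ p σ g) = MvPowerSeries.map mk g ^ p := by
    intro g
    rw [twistExpand_apply, map_expand, map_map, hmk, ← map_map, ← map_expand, map_frobenius_expand]
  have h2 : MvPowerSeries.map mk ((twistExpand τ p σ ^ i) g) = MvPowerSeries.map mk g ^ p ^ i := by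
    induction i with
    | zero => simp
    | succ i ih => rw [pow_succ', RingHom.mul_def, RingHom.comp_apply, h1, ih, ← pow_mul, pow_succ]
  refine natCast_dvd_of_forall_coeff fun d => ?_
  rw [← Ideal.mem_span_singleton, ← Ideal.Quotient.eq_zero_iff_mem]
  change mk _ = 0
  rw [← coeff_map, map_sub, h2, map_pow, sub_self, map_zero]

/-- Only the linear term sees the degree `N` part of `f`; in higher powers `f` may be replaced by
its approximation `g`. This isolates the unknown coefficient in an induction on degree. -/
theorem pLogSeries_subst_sub_add_sum_mem_ordIdeal {l : ℕ → K} (h0 : l 0 = 1)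
    {f g : MvPowerSeries τ K} (hf : f ∈ ordIdeal τ K 1) (hg : g ∈ ordIdeal τ K 1) {N : ℕ}
    (hfg : f - g ∈ ordIdeal τ K N) :
    PowerSeries.subst f (pLogSeries p l) -
      (f + ∑ k ∈ Finset.range N, C (l (k + 1)) * g ^ p ^ (k + 1)) ∈ ordIdeal τ K (N + 1) := by
  have hlt : ∀ k, k + 1 ≤ p ^ k := fun k => Nat.lt_pow_self hp.out.two_le
  have h1 := ordIdeal_anti ((Nat.le_succ _).trans (hlt (N + 1)))
    (pLogSeries_subst_sub_sum_mem_ordIdeal p hf l (N + 1))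
  have h2 : ∑ k ∈ Finset.range N, C (l (k + 1)) * (f ^ p ^ (k + 1) - g ^ p ^ (k + 1)) ∈
      ordIdeal τ K (N + 1) := Ideal.sum_mem _ fun k _ => Ideal.mul_mem_left _ _
    (pow_sub_pow_mem_ordIdeal hf hg hfg (by have := hlt (k + 1); omega))
  convert add_mem h1 h2 using 1
  rw [Finset.sum_range_succ', h0]
  simp only [mul_sub, Finset.sum_sub_distrib, map_one, one_mul, pow_zero, pow_one]
  ring

variable (σ : K →+* K) {l : ℕ → K} {c : ℕ → K}

/-- The functional equation, modulo terms of degree greater than `N`. -/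
theorem functionalEquation_mem_ordIdeal (h0 : l 0 = 1)
    (hl : ∀ m, l (m + 1) = ∑ i ∈ Finset.range (m + 1), c i * (σ ^ (i + 1)) (l (m - i)))
    {f g : MvPowerSeries τ K} (hf : f ∈ ordIdeal τ K 1) (hg : g ∈ ordIdeal τ K 1) {N : ℕ}
    (hN : 1 ≤ N) (hfg : f - g ∈ ordIdeal τ K N) :
    f - (PowerSeries.subst f (pLogSeries p l) - ∑ i ∈ Finset.range N,
      C (c i) * (twistExpand τ p σ ^ (i + 1)) (PowerSeries.subst f (pLogSeries p l))) -
    ∑ i ∈ Finset.range N, ∑ j ∈ Finset.range (N - i), C (c i * (σ ^ (i + 1)) (l j)) *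
      (((twistExpand τ p σ ^ (i + 1)) g) ^ p ^ j - (g ^ p ^ (i + 1)) ^ p ^ j) ∈
      ordIdeal τ K (N + 1) := by
  have hp2 : 2 ≤ p := hp.out.two_le
  have hpos : ∀ k, 1 ≤ p ^ k := fun k => Nat.one_le_pow _ _ hp.out.pos
  have hlt : ∀ k, k + 1 ≤ p ^ k := fun k => Nat.lt_pow_self hp2
  set h := PowerSeries.subst f (pLogSeries p l) with hh
  set Ψ := twistExpand τ p σ
  have e1 : h - (f + ∑ k ∈ Finset.range N, C (l (k + 1)) * g ^ p ^ (k + 1)) ∈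
      ordIdeal τ K (N + 1) := pLogSeries_subst_sub_add_sum_mem_ordIdeal h0 hf hg hfg
  have e2 : ∀ i ∈ Finset.range N, C (c i) * (Ψ ^ (i + 1)) h - ∑ j ∈ Finset.range (N - i),
      C (c i * (σ ^ (i + 1)) (l j)) * ((Ψ ^ (i + 1)) g) ^ p ^ j ∈ ordIdeal τ K (N + 1) := by
    intro i hi
    rw [Finset.mem_range] at hi
    have h1 := twistExpand_pow_mem_ordIdeal (p := p) σ
      (pLogSeries_subst_sub_sum_mem_ordIdeal p hf l (N - i)) (i + 1)
    rw [← pow_add, show i + 1 + (N - i) = N + 1 by omega] at h1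
    replace h1 := ordIdeal_anti ((Nat.le_succ _).trans (hlt (N + 1))) h1
    rw [map_sub, map_sum] at h1
    simp only [map_mul, map_pow, twistExpand_pow_C] at h1
    have hΨ : ∀ {f : MvPowerSeries τ K}, f ∈ ordIdeal τ K 1 → (Ψ ^ (i + 1)) f ∈ ordIdeal τ K 1 :=
      fun hf => ordIdeal_anti (by rw [mul_one]; exact hpos _)
        (twistExpand_pow_mem_ordIdeal (p := p) σ hf (i + 1))
    -- The substitution `x ↦ x^(p^(i+1))` multiplies the order by `p^(i+1) ≥ 2`, so here even the
    -- linear term may be replaced.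
    have hΨfg : (Ψ ^ (i + 1)) f - (Ψ ^ (i + 1)) g ∈ ordIdeal τ K (N + 1) := by
      rw [← map_sub]
      refine ordIdeal_anti ?_ (twistExpand_pow_mem_ordIdeal (p := p) σ hfg (i + 1))
      have := hlt (i + 1)
      nlinarith
    have h2 : ∑ j ∈ Finset.range (N - i), C ((σ ^ (i + 1)) (l j)) *
        (((Ψ ^ (i + 1)) f) ^ p ^ j - ((Ψ ^ (i + 1)) g) ^ p ^ j) ∈ ordIdeal τ K (N + 1) :=
      Ideal.sum_mem _ fun j _ => Ideal.mul_mem_left _ _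
        (pow_sub_pow_mem_ordIdeal (hΨ hf) (hΨ hg) hΨfg (by have := hpos j; omega))
    convert Ideal.mul_mem_left _ (C (c i)) (add_mem h1 h2) using 1
    simp only [mul_sub, Finset.sum_sub_distrib, map_mul, mul_add, Finset.mul_sum, mul_assoc]
    ring
  -- The recursion for `l` is inserted and the triangular sum is reindexed, so that it matches the
  -- twisted sum term by term.
  have e3 : ∑ k ∈ Finset.range N, C (l (k + 1)) * g ^ p ^ (k + 1) = ∑ i ∈ Finset.range N,
      ∑ j ∈ Finset.range (N - i), C (c i * (σ ^ (i + 1)) (l j)) * (g ^ p ^ (i + 1)) ^ p ^ j := by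
    rw [← Finset.sum_range_diag_flip N fun i j =>
      C (c i * (σ ^ (i + 1)) (l j)) * (g ^ p ^ (i + 1)) ^ p ^ j]
    refine Finset.sum_congr rfl fun k _ => ?_
    rw [hl, map_sum, Finset.sum_mul]
    refine Finset.sum_congr rfl fun i hi => ?_
    rw [Finset.mem_range] at hi
    rw [← pow_mul g, ← pow_add, show i + 1 + (k - i) = k + 1 by omega]
  have e4 := Ideal.sum_mem _ e2
  rw [Finset.sum_sub_distrib] at e4
  convert sub_mem e4 e1 using 1
  rw [e3]
  simp only [mul_sub, Finset.sum_sub_distrib]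
  ring

/-- Hazewinkel's functional equation lemma. -/
theorem coeff_mem_range_of_functionalEquation {A : Type*} [CommRing A] {ι : A →+* K}
    {σA : A →+* A} [CharP (A ⧸ Ideal.span {(p : A)}) p] (hσA : ∀ a, (p : A) ∣ σA a - a ^ p)
    (hσ : σ.comp ι = ι.comp σA) (h0 : l 0 = 1)
    (hl : ∀ m, l (m + 1) = ∑ i ∈ Finset.range (m + 1), c i * (σ ^ (i + 1)) (l (m - i)))
    (hc : ∀ i, (p : K) * c i ∈ ι.range) (hden : ∀ k, (p : K) ^ k * l k ∈ ι.range)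
    {f : MvPowerSeries τ K} (hf : f ∈ ordIdeal τ K 1)
    (hint : ∀ N, ∀ e : τ →₀ ℕ, e.degree ≤ N →
      coeff e (PowerSeries.subst f (pLogSeries p l) - ∑ i ∈ Finset.range N,
      C (c i) * (twistExpand τ p σ ^ (i + 1)) (PowerSeries.subst f (pLogSeries p l))) ∈ ι.range)
    (e : τ →₀ ℕ) : coeff e f ∈ ι.range := by
  suffices H : ∀ N, ∀ e : τ →₀ ℕ, e.degree < N → coeff e f ∈ ι.range from
    H _ e (Nat.lt_succ_self _)
  intro N
  induction N with
  | zero => intro e he; simp at he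
  | succ N ih =>
    intro e he
    rcases Nat.eq_zero_or_pos N with rfl | hN
    · rw [hf e he]; exact zero_mem _
    -- By induction the truncation of `f` below degree `N` lifts to `A`, where Frobenius congruences
    -- make sense.
    have hg := coeff_truncDegree_mem (M := fun _ => ι.range) ih
    choose g' hg' using hg
    have hmap : MvPowerSeries.map ι (ofCoeff g') = truncDegree N f := by
      ext d; rw [coeff_map, coeff_ofCoeff, hg']
    have key := functionalEquation_mem_ordIdeal (p := p) σ h0 hl hf
      (truncDegree_mem_ordIdeal (n := N) hf) hN (sub_truncDegree_mem_ordIdeal N f)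
    have hS : ∀ i ∈ Finset.range N, ∀ j ∈ Finset.range (N - i),
        coeff e (C (c i * (σ ^ (i + 1)) (l j)) *
        (((twistExpand τ p σ ^ (i + 1)) (truncDegree N f)) ^ p ^ j -
          (truncDegree N f ^ p ^ (i + 1)) ^ p ^ j)) ∈ ι.range := by
      intro i _ j _
      obtain ⟨s, hs⟩ := hc i
      obtain ⟨b, hb⟩ := hden j
      obtain ⟨y, hy⟩ := dvd_sub_pow_of_dvd_sub (dvd_twistExpand_pow_sub hσA (i + 1) (ofCoeff g')) j
      have hσi : ∀ x, (σ ^ (i + 1)) (ι x) = ι ((σA ^ (i + 1)) x) := by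
        intro x
        have := twistExpand_pow_map (τ := τ) (p := p) hσ (i + 1) (C x)
        rw [map_C, twistExpand_pow_C, twistExpand_pow_C, map_C] at this
        exact C_injective this
      -- The bases agree modulo `p`, so their `p^j`-th powers agree modulo `p^(j+1)`.
      have e1 : (((twistExpand τ p σ ^ (i + 1)) (truncDegree N f)) ^ p ^ j -
          (truncDegree N f ^ p ^ (i + 1)) ^ p ^ j) =
          C ((p : K) ^ (j + 1)) * MvPowerSeries.map ι y := by
        rw [← hmap, twistExpand_pow_map hσ, ← map_pow (MvPowerSeries.map ι),
          ← map_pow (MvPowerSeries.map ι), ← map_pow (MvPowerSeries.map ι),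
          ← map_sub (MvPowerSeries.map ι), hy, map_mul, map_pow, map_natCast, map_pow, map_natCast]
      rw [e1, ← mul_assoc, ← map_mul, coeff_C_mul, coeff_map]
      refine mul_mem ?_ ⟨_, rfl⟩
      -- One factor `p` clears the denominator of `c i`, and the other `j` factors clear that of `l
      -- j`.
      have e2 : c i * (σ ^ (i + 1)) (l j) * (p : K) ^ (j + 1) =
          ((p : K) * c i) * (σ ^ (i + 1)) ((p : K) ^ j * l j) := by
        rw [map_mul, map_pow, map_natCast]; ring
      rw [e2, ← hs, ← hb, hσi]
      exact mul_mem ⟨_, rfl⟩ ⟨_, rfl⟩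
    have h1 := key e he
    rw [map_sub, map_sub, sub_eq_zero, sub_eq_iff_eq_add] at h1
    rw [h1]
    refine add_mem ?_ (hint N e (by omega))
    simp only [map_sum]
    exact sum_mem fun i hi => sum_mem fun j hj => hS i hi j hj

/-- The twist sends a variable exactly to its `p`-th power, so every error term of the functional
equation vanishes for `f = g = X s`. -/
theorem functionalEquation_X_mem_ordIdeal (h0 : l 0 = 1)
    (hl : ∀ m, l (m + 1) = ∑ i ∈ Finset.range (m + 1), c i * (σ ^ (i + 1)) (l (m - i)))
    (s : τ) (N : ℕ) :
    PowerSeries.subst (X s : MvPowerSeries τ K) (pLogSeries p l) - (∑ i ∈ Finset.range N,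
      C (c i) * (twistExpand τ p σ ^ (i + 1)) (PowerSeries.subst (X s) (pLogSeries p l))) - X s ∈
      ordIdeal τ K (N + 1) := by
  rcases Nat.eq_zero_or_pos N with rfl | hN
  · rw [Finset.range_zero, Finset.sum_empty, sub_zero]
    exact sub_mem (powerSeries_subst_mem_ordIdeal (X_mem_ordIdeal s)
      (constantCoeff_pLogSeries p l)) (X_mem_ordIdeal s)
  have h := functionalEquation_mem_ordIdeal (p := p) σ h0 hl (X_mem_ordIdeal s)
    (X_mem_ordIdeal s) hN (by simp)
  simp only [twistExpand_pow_X, sub_self, mul_zero, Finset.sum_const_zero, sub_zero] at h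
  rw [← neg_mem_iff]
  convert h using 1
  ring

/-- The formal group law whose logarithm satisfies a functional equation is integral. -/
theorem coeff_logLawSeries_mem_range {A : Type*} [CommRing A] {ι : A →+* K}
    {σA : A →+* A} [CharP (A ⧸ Ideal.span {(p : A)}) p] (hσA : ∀ a, (p : A) ∣ σA a - a ^ p)
    (hσ : σ.comp ι = ι.comp σA) (h0 : l 0 = 1)
    (hl : ∀ m, l (m + 1) = ∑ i ∈ Finset.range (m + 1), c i * (σ ^ (i + 1)) (l (m - i)))
    (hc : ∀ i, (p : K) * c i ∈ ι.range) (hden : ∀ k, (p : K) ^ k * l k ∈ ι.range)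
    (e : Fin 2 →₀ ℕ) :
    coeff e (logLawSeries (pLogSeries p l) (coeff_one_pLogSeries p l h0)) ∈ ι.range := by
  have hL := constantCoeff_pLogSeries p l
  refine coeff_mem_range_of_functionalEquation (p := p) σ hσA hσ h0 hl hc hden
    (logLawSeries_mem_ordIdeal hL _) (fun N e he => ?_) e
  rw [log_logLawSeries hL]
  have h := add_mem (functionalEquation_X_mem_ordIdeal (p := p) σ h0 hl (0 : Fin 2) N)
    (functionalEquation_X_mem_ordIdeal (p := p) σ h0 hl (1 : Fin 2) N)
  have h2 := coeff_eq_of_sub_mem_ordIdeal (f := PowerSeries.subst (X 0 : MvPowerSeries (Fin 2) K)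
    (pLogSeries p l) + PowerSeries.subst (X 1) (pLogSeries p l) - ∑ i ∈ Finset.range N,
      C (c i) * (twistExpand (Fin 2) p σ ^ (i + 1)) (PowerSeries.subst (X 0) (pLogSeries p l) +
        PowerSeries.subst (X 1) (pLogSeries p l))) (g := X 0 + X 1) (k := N + 1) (by
      convert h using 1
      simp only [map_add, mul_add, Finset.sum_add_distrib]
      ring) (Nat.lt_succ_of_le he)
  rw [h2, map_add, coeff_X, coeff_X]
  refine add_mem ?_ ?_ <;> split_ifs <;> first | exact one_mem _ | exact zero_mem _

end FunctionalEquation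

end PnTypical

end

noncomputable section

namespace PnTypical

/-! ### The ring ℤ_(p) and its polynomial rings -/

section Localized

variable (p : ℕ) [hp : Fact p.Prime]

theorem isUnit_intCast_zLoc {n : ℤ} (hn : ¬ (p : ℤ) ∣ n) : IsUnit (n : ZLoc p) := by
  have := IsLocalization.map_units (ZLoc p)
    (⟨n, fun h => hn (Ideal.mem_span_singleton.1 h)⟩ : (Ideal.span {(p : ℤ)}).primeCompl)
  simpa using this

theorem isUnit_natCast_of_algebra (A : Type*) [CommRing A] [Algebra (ZLoc p) A] (n : ℕ)
    (hn : ¬ p ∣ n) : IsUnit (n : A) := by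
  have h : IsUnit ((n : ℤ) : ZLoc p) := isUnit_intCast_zLoc p (by exact_mod_cast hn)
  have := h.map (algebraMap (ZLoc p) A)
  simpa using this

theorem not_isUnit_prime_zLoc : ¬ IsUnit (p : ZLoc p) := by
  have := (IsLocalization.AtPrime.isUnit_to_map_iff (ZLoc p) (Ideal.span {(p : ℤ)}) (p : ℤ)).not.2
    (fun h => h (Ideal.mem_span_singleton_self _))
  simpa using this

/-- The inclusion of `ℤ_(p)` into `ℚ`. -/
def zLocToRat : ZLoc p →+* ℚ :=
  IsLocalization.lift (M := (Ideal.span {(p : ℤ)}).primeCompl) (g := Int.castRingHom ℚ) (by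
    intro y
    refine isUnit_iff_ne_zero.2 ?_
    have : (y : ℤ) ≠ 0 := fun h => y.2 (h ▸ Ideal.zero_mem _)
    simpa using this)

theorem exists_mul_intCast_eq (a : ZLoc p) :
    ∃ n s : ℤ, ¬ (p : ℤ) ∣ s ∧ a * s = n := by
  obtain ⟨⟨n, s⟩, h⟩ := IsLocalization.surj (Ideal.span {(p : ℤ)}).primeCompl a
  refine ⟨n, s, fun h => s.2 (Ideal.mem_span_singleton.2 h), ?_⟩
  simpa using h

theorem zLocToRat_injective : Function.Injective (zLocToRat p) := by
  rw [injective_iff_map_eq_zero]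
  intro a ha
  obtain ⟨n, s, hs, h⟩ := exists_mul_intCast_eq p a
  have h' := congrArg (zLocToRat p) h
  rw [map_mul, ha, zero_mul, map_intCast] at h'
  have hn : n = 0 := by exact_mod_cast h'.symm
  rw [hn, Int.cast_zero] at h
  exact (isUnit_intCast_zLoc p hs).mul_left_eq_zero.1 h

theorem exists_zLocToRat_eq_inv {n : ℤ} (hn : ¬ (p : ℤ) ∣ n) :
    ∃ z, zLocToRat p z = (n : ℚ)⁻¹ := by
  obtain ⟨z, hz⟩ := (isUnit_intCast_zLoc p hn).exists_right_inv
  refine ⟨z, ?_⟩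
  have := congrArg (zLocToRat p) hz
  rw [map_mul, map_intCast, map_one] at this
  exact eq_inv_of_mul_eq_one_right this

theorem dvd_sub_pow_zLoc (a : ZLoc p) : (p : ZLoc p) ∣ a - a ^ p := by
  obtain ⟨n, s, hs, h⟩ := exists_mul_intCast_eq p a
  have hsu := isUnit_intCast_zLoc p hs
  have fermat : ∀ k : ℤ, (p : ZLoc p) ∣ (k : ZLoc p) - k ^ p := by
    intro k
    have : (p : ℤ) ∣ k - k ^ p := by
      rw [← ZMod.intCast_zmod_eq_zero_iff_dvd]
      push_cast
      rw [ZMod.pow_card, sub_self]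
    obtain ⟨y, hy⟩ := this
    exact ⟨y, by exact_mod_cast congrArg (Int.cast : ℤ → ZLoc p) hy⟩
  have h1 : (a - a ^ p) * (s : ZLoc p) ^ p = (n - n ^ p) - a * (s - s ^ p) := by
    rw [← h]; ring
  rw [← (hsu.pow p).dvd_mul_right, h1]
  exact dvd_sub (fermat n) (Dvd.dvd.mul_left (fermat s) _)

/-- The polynomial ring `ℚ[v_1, v_2, …]`. -/
abbrev RatPoly : Type := MvPolynomial ℕ+ ℚ

/-- The inclusion of `ℤ_(p)[v_1, v_2, …]` into `ℚ[v_1, v_2, …]`. -/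
def polyToRat : PolyRing p →+* RatPoly := MvPolynomial.map (zLocToRat p)

theorem polyToRat_injective : Function.Injective (polyToRat p) :=
  MvPolynomial.map_injective _ (zLocToRat_injective p)

theorem dvd_expand_sub_pow (a : PolyRing p) : (p : PolyRing p) ∣ MvPolynomial.expand p a - a ^ p := by
  induction a using MvPolynomial.induction_on with
  | C a =>
    obtain ⟨y, hy⟩ := dvd_sub_pow_zLoc p a
    rw [MvPolynomial.expand_C, ← map_pow, ← map_sub, hy, map_mul, map_natCast]
    exact dvd_mul_right _ _
  | add a b ha hb =>
    obtain ⟨r, hr⟩ := exists_add_pow_prime_eq hp.out a b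
    rw [map_add, hr]
    have h := dvd_sub (dvd_add ha hb) (Dvd.intro (a * b * r) rfl : (p : PolyRing p) ∣ _)
    convert h using 1
    ring
  | mul_X a i ha =>
    rw [map_mul, MvPolynomial.expand_X, mul_pow, ← sub_mul]
    exact ha.mul_right _

/-- As `p` is not a unit, the quotient is nonzero and has characteristic exactly `p`; the Frobenius
argument needs this. -/
instance charP_polyRing_quotient : CharP (PolyRing p ⧸ Ideal.span {(p : PolyRing p)}) p := by
  refine CharP.quotient _ p fun h => not_isUnit_prime_zLoc p ?_
  have := h.map (MvPolynomial.constantCoeff (σ := ℕ+) (R := ZLoc p))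
  simpa using this

end Localized

/-! ### The Araki logarithm and its functional equation -/

section Araki

variable (p : ℕ) [hp : Fact p.Prime]

/-- The image of `v_i` in `ℚ[v_1, v_2, …]`. -/
def ratV (i : ℕ) : RatPoly := polyToRat p (vSeq p i)

theorem ratV_zero : ratV p 0 = p := by
  rw [ratV, vSeq, dif_neg (lt_irrefl 0), map_natCast]

theorem ratV_pos {i : ℕ} (hi : 0 < i) : ratV p i = MvPolynomial.X (⟨i, hi⟩ : ℕ+) := by
  rw [ratV, vSeq, dif_pos hi, polyToRat]
  exact MvPolynomial.map_X _ _

theorem ratV_mem_range (i : ℕ) : ratV p i ∈ (polyToRat p).range := RingHom.mem_range_self _ _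

theorem prime_sub_pow_ne_zero (m : ℕ) : (p : ℚ) - (p : ℚ) ^ p ^ (m + 1) ≠ 0 := by
  have h1 : 1 < p ^ (m + 1) := Nat.one_lt_pow (by omega) hp.out.one_lt
  have h2 : p ^ 1 < p ^ p ^ (m + 1) := Nat.pow_lt_pow_right hp.out.one_lt h1
  rw [pow_one] at h2
  have h3 : (p : ℚ) < (p : ℚ) ^ p ^ (m + 1) := by exact_mod_cast h2
  linarith

/-- The coefficients `l_m` of the Araki logarithm: `p l_m = ∑_{i ≤ m} l_i v_{m-i}^(p^i)`. -/
def arakiCoeff : ℕ → RatPoly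
  | 0 => 1
  | m + 1 => MvPolynomial.C ((p : ℚ) - (p : ℚ) ^ p ^ (m + 1))⁻¹ *
      ∑ i : Fin (m + 1), arakiCoeff i * ratV p (m + 1 - i) ^ p ^ (i : ℕ)

theorem arakiCoeff_zero : arakiCoeff p 0 = 1 := by rw [arakiCoeff]

theorem arakiCoeff_succ (m : ℕ) : arakiCoeff p (m + 1) =
    MvPolynomial.C ((p : ℚ) - (p : ℚ) ^ p ^ (m + 1))⁻¹ *
      ∑ i ∈ Finset.range (m + 1), arakiCoeff p i * ratV p (m + 1 - i) ^ p ^ i := by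
  rw [arakiCoeff, Finset.sum_range]

theorem natCast_mul_arakiCoeff (m : ℕ) : (p : RatPoly) * arakiCoeff p m =
    ∑ i ∈ Finset.range (m + 1), arakiCoeff p i * ratV p (m - i) ^ p ^ i := by
  rcases m with _ | m
  · simp [arakiCoeff_zero, ratV_zero]
  · have h : (MvPolynomial.C ((p : ℚ) - (p : ℚ) ^ p ^ (m + 1)) : RatPoly) * arakiCoeff p (m + 1) =
        ∑ i ∈ Finset.range (m + 1), arakiCoeff p i * ratV p (m + 1 - i) ^ p ^ i := by
      rw [arakiCoeff_succ, ← mul_assoc, ← map_mul, mul_inv_cancel₀ (prime_sub_pow_ne_zero p m),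
        map_one, one_mul]
    rw [Finset.sum_range_succ, ← h, Nat.sub_self, ratV_zero, map_sub, map_pow, map_natCast]
    ring

/-- Here `u = 1 / (1 - p^(p^(m+1) - 1))`, whose denominator is prime to `p`: dividing by `p -
p^(p^(m+1))` costs only one factor `p`. -/
theorem exists_C_eq_polyToRat (m : ℕ) : ∃ u : PolyRing p,
    polyToRat p u * ((p : RatPoly) - (p : RatPoly) ^ p ^ (m + 1)) = p ∧
    (p : RatPoly) * MvPolynomial.C ((p : ℚ) - (p : ℚ) ^ p ^ (m + 1))⁻¹ = polyToRat p u := by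
  have h0 := prime_sub_pow_ne_zero p m
  have h1 : 1 < p ^ (m + 1) := Nat.one_lt_pow (by omega) hp.out.one_lt
  obtain ⟨k, hk⟩ : ∃ k, p ^ (m + 1) = k + 2 := ⟨p ^ (m + 1) - 2, by omega⟩
  obtain ⟨z, hz⟩ := exists_zLocToRat_eq_inv p (n := 1 - (p : ℤ) ^ (k + 1)) (by
    intro h
    have h2 : (p : ℤ) ∣ (p : ℤ) ^ (k + 1) := dvd_pow_self _ (by omega)
    have h3 := dvd_add h h2
    rw [sub_add_cancel] at h3
    exact hp.out.not_dvd_one (by exact_mod_cast h3))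
  have hpQ : (p : ℚ) ≠ 0 := by exact_mod_cast hp.out.ne_zero
  have e : (p : ℚ) * ((p : ℚ) - (p : ℚ) ^ p ^ (m + 1))⁻¹ = zLocToRat p z := by
    rw [hz, ← div_eq_mul_inv, div_eq_iff h0, hk]
    push_cast
    have h4 : (1 : ℚ) - (p : ℚ) ^ (k + 1) ≠ 0 := by
      intro h5
      apply h0
      rw [hk, show (p : ℚ) - (p : ℚ) ^ (k + 2) = p * (1 - (p : ℚ) ^ (k + 1)) by ring, h5, mul_zero]
    rw [eq_inv_mul_iff_mul_eq₀ h4]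
    ring
  have e' : (p : RatPoly) * MvPolynomial.C ((p : ℚ) - (p : ℚ) ^ p ^ (m + 1))⁻¹ =
      polyToRat p (MvPolynomial.C z) := by
    rw [polyToRat, MvPolynomial.map_C, ← e, map_mul, map_natCast]
  refine ⟨MvPolynomial.C z, ?_, e'⟩
  rw [← e', mul_assoc, ← map_natCast (MvPolynomial.C (σ := ℕ+) (R := ℚ)), ← map_pow, ← map_sub,
    ← map_mul, inv_mul_cancel₀ h0, map_one, mul_one]

theorem pow_mul_arakiCoeff_mem_range (m : ℕ) :
    (p : RatPoly) ^ m * arakiCoeff p m ∈ (polyToRat p).range := by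
  induction m using Nat.strong_induction_on with
  | _ m ih =>
    rcases m with _ | m
    · rw [arakiCoeff_zero, pow_zero, mul_one]; exact one_mem _
    · obtain ⟨u, -, hu⟩ := exists_C_eq_polyToRat p m
      rw [arakiCoeff_succ, ← mul_assoc, pow_succ, mul_assoc ((p : RatPoly) ^ m), hu,
        mul_comm _ (polyToRat p u), mul_assoc, Finset.mul_sum]
      refine mul_mem ⟨u, rfl⟩ (sum_mem fun i hi => ?_)
      rw [Finset.mem_range] at hi
      have e : (p : RatPoly) ^ m * (arakiCoeff p i * ratV p (m + 1 - i) ^ p ^ i) =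
        (p : RatPoly) ^ (m - i) * ((p : RatPoly) ^ i * arakiCoeff p i) *
          ratV p (m + 1 - i) ^ p ^ i := by
        rw [← mul_assoc, ← mul_assoc, ← pow_add, Nat.sub_add_cancel (by omega)]
      rw [e]
      exact mul_mem (mul_mem (pow_mem (natCast_mem _ p) _) (ih i (by omega)))
        (pow_mem (ratV_mem_range p _) _)

/-- The lift of Frobenius on `ℚ[v_1, v_2, …]` with `v_i ↦ v_i^p`. -/
def ratFrob : RatPoly →+* RatPoly := (MvPolynomial.expand p).toRingHom

/-- The lift of Frobenius on `ℤ_(p)[v_1, v_2, …]` with `v_i ↦ v_i^p`. -/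
def polyFrob : PolyRing p →+* PolyRing p := (MvPolynomial.expand p).toRingHom

theorem ratFrob_comp_polyToRat :
    (ratFrob p).comp (polyToRat p) = (polyToRat p).comp (polyFrob p) := by
  exact RingHom.ext fun x => (MvPolynomial.map_expand _ _ x).symm

theorem ratFrob_pow_mem_range (k : ℕ) {x : RatPoly} (hx : x ∈ (polyToRat p).range) :
    (ratFrob p ^ k) x ∈ (polyToRat p).range := by
  induction k with
  | zero => exact hx
  | succ k ih =>
    rw [pow_succ', RingHom.mul_def, RingHom.comp_apply]
    obtain ⟨y, hy⟩ := ih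
    rw [← hy, ← RingHom.comp_apply, ratFrob_comp_polyToRat]
    exact ⟨_, rfl⟩

theorem ratFrob_pow_ratV {i : ℕ} (hi : 0 < i) (k : ℕ) :
    (ratFrob p ^ k) (ratV p i) = ratV p i ^ p ^ k := by
  induction k with
  | zero => simp
  | succ k ih =>
    rw [pow_succ', RingHom.mul_def, RingHom.comp_apply, ih, map_pow, pow_succ', pow_mul]
    congr 1
    rw [ratV_pos p hi]
    exact MvPolynomial.expand_X _ _

/-- The coefficients `s_{m+1}` of the functional equation `p l_m = ∑_{1 ≤ i ≤ m} s_i σ^i(l_{m-i})`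
of the Araki logarithm. -/
def arakiTwist : ℕ → RatPoly
  | m => (p : RatPoly) * arakiCoeff p (m + 1) -
      ∑ i : Fin m, arakiTwist i * (ratFrob p ^ ((i : ℕ) + 1)) (arakiCoeff p (m - i))

theorem arakiTwist_eq (m : ℕ) : (p : RatPoly) * arakiCoeff p (m + 1) =
    ∑ i ∈ Finset.range (m + 1), arakiTwist p i * (ratFrob p ^ (i + 1)) (arakiCoeff p (m - i)) := by
  rw [Finset.sum_range_succ, Nat.sub_self, arakiCoeff_zero, map_one, mul_one, arakiTwist,
    Finset.sum_range]
  ring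

/-- The functional equation is substituted into `p` times the Araki recursion, and the inner sums
are summed again by the recursion twisted with `σ^(j+1)`. They fail to match only at `v_0 = p`,
which `σ` fixes instead of raising to the power `p`; this produces the differences of powers of `p`.
-/
theorem arakiTwist_relation (m : ℕ) : (p : RatPoly) * ratV p (m + 1) +
    ∑ j ∈ Finset.range (m + 1), arakiTwist p j * ((ratFrob p ^ (j + 1)) (arakiCoeff p (m - j)) *
      ((p : RatPoly) ^ p ^ (m + 1) - (p : RatPoly) ^ p ^ (m - j))) = 0 := by
  have h1 := natCast_mul_arakiCoeff p (m + 1)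
  rw [Finset.sum_range_succ', arakiCoeff_zero, pow_zero, pow_one, one_mul, Nat.sub_zero] at h1
  have h2 : (p : RatPoly) * ∑ k ∈ Finset.range (m + 1),
      arakiCoeff p (k + 1) * ratV p (m + 1 - (k + 1)) ^ p ^ (k + 1) =
      ∑ j ∈ Finset.range (m + 1), ∑ k ∈ Finset.range (m + 1 - j),
        arakiTwist p j * ((ratFrob p ^ (j + 1)) (arakiCoeff p k) *
          ratV p (m - j - k) ^ p ^ (j + k + 1)) := by
    rw [← Finset.sum_range_diag_flip (m + 1) fun j k =>
      arakiTwist p j * ((ratFrob p ^ (j + 1)) (arakiCoeff p k) *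
          ratV p (m - j - k) ^ p ^ (j + k + 1)), Finset.mul_sum]
    refine Finset.sum_congr rfl fun k hk => ?_
    rw [← mul_assoc, arakiTwist_eq, Finset.sum_mul]
    refine Finset.sum_congr rfl fun j hj => ?_
    rw [Finset.mem_range] at hk hj
    rw [show m - j - (k - j) = m + 1 - (k + 1) by omega, show j + (k - j) + 1 = k + 1 by omega,
      mul_assoc]
  have h3 : ∀ j ∈ Finset.range (m + 1), ∑ k ∈ Finset.range (m + 1 - j),
        arakiTwist p j * ((ratFrob p ^ (j + 1)) (arakiCoeff p k) *
          ratV p (m - j - k) ^ p ^ (j + k + 1)) =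
      (p : RatPoly) * (arakiTwist p j * (ratFrob p ^ (j + 1)) (arakiCoeff p (m - j))) +
      arakiTwist p j * ((ratFrob p ^ (j + 1)) (arakiCoeff p (m - j)) *
        ((p : RatPoly) ^ p ^ (m + 1) - (p : RatPoly) ^ p ^ (m - j))) := by
    intro j hj
    rw [Finset.mem_range] at hj
    have h4 := congrArg (ratFrob p ^ (j + 1)) (natCast_mul_arakiCoeff p (m - j))
    rw [map_mul, map_natCast, map_sum, Finset.sum_range_succ] at h4
    rw [← Finset.mul_sum, show m + 1 - j = m - j + 1 by omega, Finset.sum_range_succ]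
    have h5 : ∀ k ∈ Finset.range (m - j), (ratFrob p ^ (j + 1)) (arakiCoeff p k) *
          ratV p (m - j - k) ^ p ^ (j + k + 1) =
        (ratFrob p ^ (j + 1)) (arakiCoeff p k * ratV p (m - j - k) ^ p ^ k) := by
      intro k hk
      rw [Finset.mem_range] at hk
      rw [map_mul, map_pow, ratFrob_pow_ratV p (by omega), ← pow_mul, ← pow_add]
      congr 3
      omega
    rw [Finset.sum_congr rfl h5, show j + (m - j) + 1 = m + 1 by omega]
    rw [Nat.sub_self, ratV_zero, map_mul, map_pow, map_natCast] at h4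
    rw [Nat.sub_self, ratV_zero]
    linear_combination (-arakiTwist p j) * h4
  rw [Finset.sum_congr rfl h3, Finset.sum_add_distrib, ← Finset.mul_sum, ← arakiTwist_eq] at h2
  linear_combination (-(p : RatPoly)) * h1 - h2

/-- Dividing `arakiTwist_relation` by `p` and solving for the last term costs only a unit of
`ℤ_(p)`. The remaining coefficients `l_{m-j}` have denominator at most `p^(m-j)`, absorbed because
`m - j ≤ p^(m-j) - 1`. -/
theorem arakiTwist_mem_range (m : ℕ) : arakiTwist p m ∈ (polyToRat p).range := by
  induction m using Nat.strong_induction_on with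
  | _ m ih =>
    obtain ⟨u, hu, -⟩ := exists_C_eq_polyToRat p m
    have hpow : ∀ k, (p : RatPoly) ^ p ^ k = p * (p : RatPoly) ^ (p ^ k - 1) := by
      intro k
      rw [← pow_succ', Nat.sub_add_cancel (Nat.one_le_pow _ _ hp.out.pos)]
    have hpK : (p : RatPoly) ≠ 0 := by exact_mod_cast hp.out.ne_zero
    have h := arakiTwist_relation p m
    rw [Finset.sum_range_succ, Nat.sub_self, arakiCoeff_zero, map_one, pow_zero, pow_one,
      one_mul] at h
    have key : arakiTwist p m = polyToRat p u * (ratV p (m + 1) + ∑ j ∈ Finset.range m,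
        arakiTwist p j * ((ratFrob p ^ (j + 1)) (arakiCoeff p (m - j)) *
          ((p : RatPoly) ^ (p ^ (m + 1) - 1) - (p : RatPoly) ^ (p ^ (m - j) - 1)))) := by
      apply mul_left_cancel₀ hpK
      have h6 : (p : RatPoly) * (∑ j ∈ Finset.range m,
        arakiTwist p j * ((ratFrob p ^ (j + 1)) (arakiCoeff p (m - j)) *
          ((p : RatPoly) ^ (p ^ (m + 1) - 1) - (p : RatPoly) ^ (p ^ (m - j) - 1)))) =
          ∑ j ∈ Finset.range m,
        arakiTwist p j * ((ratFrob p ^ (j + 1)) (arakiCoeff p (m - j)) *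
          ((p : RatPoly) ^ p ^ (m + 1) - (p : RatPoly) ^ p ^ (m - j))) := by
        rw [Finset.mul_sum]
        refine Finset.sum_congr rfl fun j _ => ?_
        rw [hpow (m + 1), hpow (m - j)]
        ring
      linear_combination (-polyToRat p u) * h6 + (-polyToRat p u) * h - arakiTwist p m * hu
    rw [key]
    refine mul_mem ⟨u, rfl⟩ (add_mem (ratV_mem_range p _) (sum_mem fun j hj => ?_))
    rw [Finset.mem_range] at hj
    have hq := ratFrob_pow_mem_range p (j + 1) (pow_mul_arakiCoeff_mem_range p (m - j))
    rw [map_mul, map_pow, map_natCast] at hq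
    have hlt : ∀ k, m - j ≤ k → m - j ≤ p ^ k - 1 := by
      intro k hk
      have := Nat.lt_pow_self hp.out.one_lt (n := k)
      omega
    have hterm : ∀ k, m - j ≤ k → (ratFrob p ^ (j + 1)) (arakiCoeff p (m - j)) *
        (p : RatPoly) ^ (p ^ k - 1) ∈ (polyToRat p).range := by
      intro k hk
      rw [← Nat.sub_add_cancel (hlt k hk), pow_add (p : RatPoly), mul_left_comm,
        mul_comm _ ((p : RatPoly) ^ (m - j))]
      exact mul_mem (pow_mem (natCast_mem _ p) _) hq
    refine mul_mem (ih j hj) ?_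
    rw [mul_sub]
    exact sub_mem (hterm _ (by omega)) (hterm _ le_rfl)

/-- The Araki logarithm. -/
def arakiLog : PowerSeries RatPoly := pLogSeries p (arakiCoeff p)

theorem constantCoeff_arakiLog : PowerSeries.constantCoeff (arakiLog p) = 0 :=
  constantCoeff_pLogSeries p _

theorem coeff_one_arakiLog : PowerSeries.coeff 1 (arakiLog p) = 1 :=
  coeff_one_pLogSeries p _ (arakiCoeff_zero p)

/-- The formal group law over `ℚ[v_1, v_2, …]` with the Araki logarithm. -/
def arakiRat : FormalGroup RatPoly :=
  logFormalGroup (arakiLog p) (constantCoeff_arakiLog p) (coeff_one_arakiLog p)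

theorem isLogarithm_arakiRat : IsLogarithm (arakiRat p) (arakiLog p) :=
  isLogarithm_logFormalGroup _ _

theorem coeff_arakiRat_mem_range (e : Fin 2 →₀ ℕ) :
    MvPowerSeries.coeff e (arakiRat p).toPowerSeries ∈ (polyToRat p).range := by
  have hpK : (p : RatPoly) * MvPolynomial.C (p : ℚ)⁻¹ = 1 := by
    rw [← map_natCast (MvPolynomial.C (σ := ℕ+) (R := ℚ)), ← map_mul,
      mul_inv_cancel₀ (by exact_mod_cast hp.out.ne_zero), map_one]
  refine coeff_logLawSeries_mem_range (p := p) (ratFrob p)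
    (c := fun i => MvPolynomial.C (p : ℚ)⁻¹ * arakiTwist p i) (σA := polyFrob p)
    (dvd_expand_sub_pow p) (ratFrob_comp_polyToRat p) (arakiCoeff_zero p) (fun m => ?_) (fun i => ?_)
    (pow_mul_arakiCoeff_mem_range p) e
  · simp only [mul_assoc, ← Finset.mul_sum]
    rw [← arakiTwist_eq, ← mul_assoc, mul_comm _ (p : RatPoly), hpK, one_mul]
  · rw [← mul_assoc, hpK, one_mul]
    exact arakiTwist_mem_range p i

end Araki

end PnTypical

end

noncomputable section

namespace PnTypical

open MvPowerSeries

/-! ### Descent along injective ring maps, and p-typicality from the logarithm -/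

section Descent

variable {A K : Type*} [CommRing A] [CommRing K]

theorem mvPowerSeries_map_injective {τ : Type*} {ι : A →+* K} (hι : Function.Injective ι) :
    Function.Injective (MvPowerSeries.map (σ := τ) ι) := by
  intro f g h
  ext d
  apply hι
  rw [← coeff_map, h, coeff_map]

theorem exists_formalGroup_map_eq {ι : A →+* K} (hι : Function.Injective ι) (F : FormalGroup K)
    (hF : ∀ e, coeff e F.toPowerSeries ∈ ι.range) : ∃ G : FormalGroup A, G.map ι = F := by
  choose c hc using hF
  have hmap : MvPowerSeries.map ι (ofCoeff c) = F.toPowerSeries := by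
    ext e; rw [coeff_map, coeff_ofCoeff, hc]
  have h0 : constantCoeff (ofCoeff c) = 0 := by
    apply hι
    rw [← coeff_zero_eq_constantCoeff_apply, ← coeff_map, hmap, map_zero,
      coeff_zero_eq_constantCoeff_apply, F.zero_constantCoeff]
  have hs : ∀ f g : MvPowerSeries (Fin 3) A, f ∈ ordIdeal _ A 1 → g ∈ ordIdeal _ A 1 →
      MvPowerSeries.map ι ((ofCoeff c).subst ![f, g]) =
        F.toPowerSeries.subst ![MvPowerSeries.map ι f, MvPowerSeries.map ι g] := by
    intro f g hf hg
    rw [map_subst (hasSubst_pair hf hg), hmap]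
    congr 1
    ext1 i
    fin_cases i <;> rfl
  have hX : ∀ i : Fin 3, (X i : MvPowerSeries (Fin 3) A) ∈ ordIdeal (Fin 3) A 1 := X_mem_ordIdeal
  refine ⟨⟨ofCoeff c, h0, ?_, ?_, ?_⟩, FormalGroup.ext hmap⟩
  · apply hι
    rw [← coeff_map, hmap, map_one, F.lin_coeff_X]
  · apply hι
    rw [← coeff_map, hmap, map_one, F.lin_coeff_Y]
  · apply mvPowerSeries_map_injective hι
    rw [hs _ _ (subst_pair_mem_ordIdeal (hX 0) (hX 1) h0) (hX 2), hs _ _ (hX 0) (hX 1),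
      hs _ _ (hX 0) (subst_pair_mem_ordIdeal (hX 1) (hX 2) h0), hs _ _ (hX 1) (hX 2),
      map_X, map_X, map_X, F.assoc]

theorem isComm_of_map {ι : A →+* K} (hι : Function.Injective ι) {F : FormalGroup A}
    (h : (F.map ι).IsComm) : F.IsComm := by
  constructor
  apply mvPowerSeries_map_injective hι
  have h1 : MvPowerSeries.map ι F.toPowerSeries =
      (MvPowerSeries.map ι F.toPowerSeries).subst ![X 1, X 0] := h.comm
  rw [h1, map_subst HasSubst.X_X]
  congr 1
  ext1 i
  fin_cases i <;> simp

/-- Divisibility by a monic polynomial can be tested after an injective extension of coefficients.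
This lets root-of-unity sums be checked over the larger ring. -/
theorem adjoinRoot_map_injective {ι : A →+* K} (hι : Function.Injective ι) {f : Polynomial A}
    (hf : f.Monic) {g : Polynomial K} (hg : g = f.map ι) :
    Function.Injective (AdjoinRoot.map ι f g (dvd_of_eq hg)) := by
  subst hg
  rw [injective_iff_map_eq_zero]
  intro x
  induction x using AdjoinRoot.induction_on with
  | ih x =>
    intro h
    have h1 : AdjoinRoot.map ι f (f.map ι) dvd_rfl (AdjoinRoot.mk f x) =
        AdjoinRoot.mk (f.map ι) (x.map ι) := by
      rw [AdjoinRoot.map, AdjoinRoot.lift_mk, ← Polynomial.eval₂_map]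
      exact AdjoinRoot.aeval_eq (x.map ι)
    rw [AdjoinRoot.mk_eq_zero, ← Polynomial.map_dvd_map ι hι hf, ← AdjoinRoot.mk_eq_zero, ← h1]
    exact h

theorem IsPTypical.of_map {ι : A →+* K} (hι : Function.Injective ι) {p : ℕ} {F : FormalGroup A}
    (h : IsPTypical p (F.map ι)) : IsPTypical p F := by
  refine ⟨isComm_of_map hι h.1, fun q hq hqp => ?_⟩
  have h1 := h.2 q hq hqp
  rw [rootOfUnitySum_map] at h1
  exact mvPowerSeries_map_injective (adjoinRoot_map_injective hι
    (Polynomial.cyclotomic.monic q A) (Polynomial.map_cyclotomic q ι).symm)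
    (h1.trans (map_zero _).symm)

/-- For `p ∤ q` one has `Φ_q(x^p) = Φ_{qp}(x) Φ_q(x)`, so the `p`-th power of a root of `Φ_q` is
again a root, over any base ring. -/
theorem eval_root_pow_cyclotomic {p q : ℕ} (hp : p.Prime) (hq : q.Prime) (hqp : q ≠ p) (k : ℕ) :
    (Polynomial.cyclotomic q (AdjoinRoot (Polynomial.cyclotomic q A))).eval
      (AdjoinRoot.root (Polynomial.cyclotomic q A) ^ p ^ k) = 0 := by
  induction k with
  | zero =>
    rw [pow_zero, pow_one, ← Polynomial.map_cyclotomic q (AdjoinRoot.of (Polynomial.cyclotomic q A)),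
      Polynomial.eval_map, AdjoinRoot.eval₂_root]
  | succ k ih =>
    have h := Polynomial.cyclotomic_expand_eq_cyclotomic_mul hp
      (fun h => hqp ((Nat.prime_dvd_prime_iff_eq hp hq).1 h).symm)
      (AdjoinRoot (Polynomial.cyclotomic q A))
    rw [pow_succ, pow_mul, ← Polynomial.expand_eval, h, Polynomial.eval_mul, ih, mul_zero]

theorem sum_root_pow_cyclotomic {p q : ℕ} (hp : p.Prime) (hq : q.Prime) (hqp : q ≠ p) (k : ℕ) :
    ∑ i ∈ Finset.range q, (AdjoinRoot.root (Polynomial.cyclotomic q A) ^ i) ^ p ^ k = 0 := by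
  have := Fact.mk hq
  have h := eval_root_pow_cyclotomic (A := A) hp hq hqp k
  rw [Polynomial.cyclotomic_prime (AdjoinRoot _), Polynomial.eval_geom_sum] at h
  simpa only [← pow_mul, mul_comm] using h

/-- A formal group law with a logarithm of the form `∑ l_k x^(p^k)` is `p`-typical. -/
theorem isPTypical_of_isLogarithm {p : ℕ} [Fact p.Prime] {F : FormalGroup A} {l : ℕ → A}
    (h : IsLogarithm F (pLogSeries p l)) : IsPTypical p F := by
  have hp : p.Prime := Fact.out
  refine ⟨isComm_of_isLogarithm h, fun q hq hqp => ?_⟩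
  set o := AdjoinRoot.of (Polynomial.cyclotomic q A)
  set ζ := AdjoinRoot.root (Polynomial.cyclotomic q A)
  have ho := h.map o
  rw [map_pLogSeries] at ho
  rw [rootOfUnitySum_eq]
  refine log_injective ho.1 ho.2.1 (listSum_val_mem_ordIdeal _ _) (zero_mem _) ?_
  rw [ho.listSum, powerSeries_subst_zero ho.1, List.map_map, list_sum_map_range]
  refine eq_of_forall_sub_mem_ordIdeal fun N => ordIdeal_anti (Nat.lt_pow_self hp.one_lt).le ?_
  have h1 := Ideal.sum_mem _ fun i (_ : i ∈ Finset.range q) =>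
    pLogSeries_subst_sub_sum_mem_ordIdeal p (C_mul_X_mem_ordIdeal (ζ ^ i)) (fun k => o (l k)) N
  have h2 : ∑ i ∈ Finset.range q, ∑ k ∈ Finset.range N,
      C (o (l k)) * (C (ζ ^ i) * X ()) ^ p ^ k =
      (0 : MvPowerSeries Unit (AdjoinRoot (Polynomial.cyclotomic q A))) := by
    rw [Finset.sum_comm]
    refine Finset.sum_eq_zero fun k _ => ?_
    simp only [mul_pow, ← map_pow C]
    rw [← Finset.mul_sum, ← Finset.sum_mul, ← map_sum, sum_root_pow_cyclotomic hp hq hqp, map_zero,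
      zero_mul, mul_zero]
  rwa [Finset.sum_sub_distrib, h2] at h1

end Descent

/-! ### The integral Araki formal group law -/

section Araki

variable (p : ℕ) [hp : Fact p.Prime]

theorem exists_arakiFormalGroup : ∃ G : FormalGroup (PolyRing p), G.map (polyToRat p) = arakiRat p :=
  exists_formalGroup_map_eq (polyToRat_injective p) _ (coeff_arakiRat_mem_range p)

/-- The formal group law over `ℤ_(p)[v_1, v_2, …]` with the Araki logarithm. -/
def arakiFormalGroup : FormalGroup (PolyRing p) := (exists_arakiFormalGroup p).choose

theorem arakiFormalGroup_map : (arakiFormalGroup p).map (polyToRat p) = arakiRat p :=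
  (exists_arakiFormalGroup p).choose_spec

theorem isPTypical_arakiFormalGroup : IsPTypical p (arakiFormalGroup p) := by
  refine IsPTypical.of_map (polyToRat_injective p) ?_
  rw [arakiFormalGroup_map]
  exact isPTypical_of_isLogarithm (isLogarithm_arakiRat p)

open TensorProduct in
/-- The map from `ℚ[v_1, v_2, …]` to `ℚ ⊗ A` induced by a map from `ℤ_(p)[v_1, v_2, …]` to `A`. -/
def ratToTensor {A : Type*} [CommRing A] (θ : PolyRing p →+* A) : RatPoly →+* ℚ ⊗[ℤ] A :=
  MvPolynomial.eval₂Hom (algebraMap ℚ (ℚ ⊗[ℤ] A))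
    fun i => (Algebra.TensorProduct.includeRight : A →ₐ[ℤ] ℚ ⊗[ℤ] A) (θ (MvPolynomial.X i))

open TensorProduct in
theorem ratToTensor_comp_polyToRat {A : Type*} [CommRing A] (θ : PolyRing p →+* A) :
    (ratToTensor p θ).comp (polyToRat p) =
      (Algebra.TensorProduct.includeRight : A →ₐ[ℤ] ℚ ⊗[ℤ] A).toRingHom.comp θ := by
  refine MvPolynomial.ringHom_ext' ?_ fun i => ?_
  · refine IsLocalization.ringHom_ext (Ideal.span {(p : ℤ)}).primeCompl ?_
    exact Subsingleton.elim _ _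
  · simp [ratToTensor, polyToRat]

/-- The logarithm and its recursion are pushed from `ℚ[v_1, …]` to `ℚ ⊗ A` along `ratToTensor`;
injectivity of `A → ℚ ⊗ A` plays no role. -/
theorem isArakiSequence_map {A : Type*} [CommRing A] (θ : PolyRing p →+* A) :
    IsArakiSequence p ((arakiFormalGroup p).map θ) (fun i => θ (vSeq p i)) := by
  have hv : vSeq p 0 = p := dif_neg (lt_irrefl 0)
  refine ⟨(congrArg θ hv).trans (map_natCast θ p),
    PowerSeries.map (ratToTensor p θ) (arakiLog p), ?_, fun m hm => ?_, fun m => ?_⟩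
  · rw [formalGroup_map_map, ← ratToTensor_comp_polyToRat, ← formalGroup_map_map,
      arakiFormalGroup_map]
    exact (isLogarithm_arakiRat p).map _
  · rw [PowerSeries.coeff_map, arakiLog, coeff_pLogSeries_of_ne p _ hm, map_zero]
  · have h := congrArg (ratToTensor p θ) (natCast_mul_arakiCoeff p m)
    rw [map_mul, map_natCast, map_sum] at h
    have hc : ∀ k, PowerSeries.coeff (p ^ k) (PowerSeries.map (ratToTensor p θ) (arakiLog p)) =
        ratToTensor p θ (arakiCoeff p k) := fun k => by
      rw [PowerSeries.coeff_map, arakiLog, coeff_pLogSeries_pow]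
    simp only [hc]
    rw [h]
    refine Finset.sum_congr rfl fun i _ => ?_
    rw [map_mul, map_pow, ratV]
    congr 2
    exact RingHom.congr_fun (ratToTensor_comp_polyToRat p θ) _

theorem isArakiSequence_vSeq : IsArakiSequence p (arakiFormalGroup p) (vSeq p) :=
  isArakiSequence_map p (RingHom.id (PolyRing p))

end Araki

end PnTypical

end

noncomputable section

namespace PnTypical

open MvPowerSeries

/-! ### Degrees of monomials and triangularity -/

section Weights

variable (p : ℕ) [hp : Fact p.Prime]

/-- The degree `1 - p^i` of `v_i`. -/
def vWeight (i : ℕ+) : ℤ := 1 - (p : ℤ) ^ ((1 * i : ℕ+) : ℕ)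

theorem vWeight_eq (i : ℕ+) : vWeight p i = 1 - (p : ℤ) ^ (i : ℕ) := by
  rw [vWeight, one_mul]

theorem vWeight_neg (i : ℕ+) : vWeight p i < 0 := by
  rw [vWeight_eq]
  have : (1 : ℤ) < (p : ℤ) ^ (i : ℕ) := by exact_mod_cast Nat.one_lt_pow i.ne_zero hp.out.one_lt
  omega

theorem weight_vWeight_nonpos (d : ℕ+ →₀ ℕ) : Finsupp.weight (vWeight p) d ≤ 0 := by
  rw [Finsupp.weight_apply]
  exact Finset.sum_nonpos fun i _ => nsmul_nonpos (vWeight_neg p i).le _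

theorem eq_single_add_of_ne_zero {d : ℕ+ →₀ ℕ} {i : ℕ+} (hi : d i ≠ 0) :
    ∃ d' : ℕ+ →₀ ℕ, d = Finsupp.single i 1 + d' := by
  refine ⟨d - Finsupp.single i 1, (add_tsub_cancel_of_le ?_).symm⟩
  rw [Finsupp.single_le_iff]
  omega

theorem weight_vWeight_eq_zero {d : ℕ+ →₀ ℕ} (h : Finsupp.weight (vWeight p) d = 0) : d = 0 := by
  by_contra hd
  obtain ⟨i, hi⟩ := Finsupp.ne_iff.1 hd
  obtain ⟨d', rfl⟩ := eq_single_add_of_ne_zero hi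
  rw [map_add, Finsupp.weight_single, one_smul] at h
  have h1 := weight_vWeight_nonpos p d'
  have h2 := vWeight_neg p i
  omega

/-- A monomial of degree `1 - p^v` other than `v_v` involves only the `v_i` with `i < v`. -/
theorem lt_of_weight_eq {d : ℕ+ →₀ ℕ} {v i : ℕ+}
    (h : Finsupp.weight (vWeight p) d = vWeight p v) (hd : d ≠ Finsupp.single v 1) (hi : d i ≠ 0) :
    i < v := by
  obtain ⟨d', rfl⟩ := eq_single_add_of_ne_zero hi
  rw [map_add, Finsupp.weight_single, one_smul] at h
  have h1 := weight_vWeight_nonpos p d'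
  have hle : i ≤ v := by
    rw [vWeight_eq, vWeight_eq] at h
    have h2 : (p : ℤ) ^ (i : ℕ) ≤ (p : ℤ) ^ (v : ℕ) := by omega
    have h3 : p ^ (i : ℕ) ≤ p ^ (v : ℕ) := by exact_mod_cast h2
    exact (Nat.pow_le_pow_iff_right hp.out.one_lt).1 h3
  refine lt_of_le_of_ne hle ?_
  rintro rfl
  rw [add_eq_left] at h
  rw [weight_vWeight_eq_zero p h, add_zero] at hd
  exact hd rfl

variable {R : Type*} [CommRing R]

/-- Two ring homomorphisms agreeing on `v_i` for `i < v` differ on an element of degree `1 - p^v`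
only through its coefficient at `v_v`. -/
theorem ringHom_sub_ringHom_of_isWeightedHomogeneous {A : Type*} [CommRing A] {v : ℕ+}
    {x : MvPolynomial ℕ+ R} (hx : x.IsWeightedHomogeneous (vWeight p) (vWeight p v))
    {φ ψ : MvPolynomial ℕ+ R →+* A} (hC : φ.comp MvPolynomial.C = ψ.comp MvPolynomial.C)
    (h : ∀ i < v, φ (MvPolynomial.X i) = ψ (MvPolynomial.X i)) :
    φ x - ψ x = φ (MvPolynomial.C (x.coeff (Finsupp.single v 1))) *
      (φ (MvPolynomial.X v) - ψ (MvPolynomial.X v)) := by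
  classical
  set z := x.coeff (Finsupp.single v 1)
  have h1 : φ (x - MvPolynomial.C z * MvPolynomial.X v) =
      ψ (x - MvPolynomial.C z * MvPolynomial.X v) := by
    refine MvPolynomial.hom_congr_vars hC (fun i hi _ => h i ?_) rfl
    rw [MvPolynomial.mem_vars_iff_mem_support] at hi
    obtain ⟨d, hd, hid⟩ := hi
    rw [MvPolynomial.mem_support_iff, MvPolynomial.coeff_sub, MvPolynomial.coeff_C_mul,
      MvPolynomial.coeff_X] at hd
    have hne : d ≠ Finsupp.single v 1 := by
      rintro rfl
      simp [z] at hd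
    rw [if_neg (Ne.symm hne), mul_zero, sub_zero] at hd
    exact lt_of_weight_eq p (hx hd) hne (Finsupp.mem_support_iff.1 hid)
  have h2 := RingHom.congr_fun hC z
  rw [RingHom.comp_apply, RingHom.comp_apply] at h2
  rw [map_sub, map_sub, map_mul, map_mul, ← h2] at h1
  linear_combination h1

end Weights

/-! ### Homogeneity over ℚ and coefficients at a single generator -/

section Homogeneous

variable {τ : Type*} (p : ℕ) [hp : Fact p.Prime]

theorem ratV_coe (v : ℕ+) : ratV p v = MvPolynomial.X v := ratV_pos p v.pos

theorem isWeightedHomogeneous_ratV {i : ℕ} (hi : 0 < i) :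
    (ratV p i).IsWeightedHomogeneous (vWeight p) (1 - (p : ℤ) ^ i) := by
  obtain ⟨v, rfl⟩ : ∃ v : ℕ+, (v : ℕ) = i := ⟨⟨i, hi⟩, rfl⟩
  rw [ratV_coe, ← vWeight_eq]
  exact MvPolynomial.isWeightedHomogeneous_X ℚ (vWeight p) v

theorem isWeightedHomogeneous_arakiCoeff (m : ℕ) :
    (arakiCoeff p m).IsWeightedHomogeneous (vWeight p) (1 - (p : ℤ) ^ m) := by
  induction m using Nat.strong_induction_on with
  | _ m ih =>
    rcases m with _ | m
    · rw [arakiCoeff_zero, pow_zero, sub_self]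
      exact MvPolynomial.isWeightedHomogeneous_one _ _
    · rw [arakiCoeff_succ]
      refine MvPolynomial.IsWeightedHomogeneous.C_mul
        (MvPolynomial.IsWeightedHomogeneous.sum _ _ _ fun i hi => ?_) _
      rw [Finset.mem_range] at hi
      have h := (ih i hi).mul ((isWeightedHomogeneous_ratV p
        (show 0 < m + 1 - i by omega)).pow (p ^ i))
      convert h using 1
      rw [nsmul_eq_mul]
      push_cast
      rw [mul_sub, ← pow_add, Nat.add_sub_cancel' (by omega)]
      ring

/-- A power series over `ℚ[v_1, v_2, …]` is homogeneous of degree `r`, if its variables have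
degree `1`. -/
def IsHomogeneousSeries (r : ℤ) (f : MvPowerSeries τ RatPoly) : Prop :=
  ∀ d : τ →₀ ℕ, (coeff d f).IsWeightedHomogeneous (vWeight p) (r - (d.degree : ℤ))

variable {p}

theorem IsHomogeneousSeries.mul {r s : ℤ} {f g : MvPowerSeries τ RatPoly}
    (hf : IsHomogeneousSeries p r f) (hg : IsHomogeneousSeries p s g) :
    IsHomogeneousSeries p (r + s) (f * g) := by
  classical
  intro d
  rw [coeff_mul]
  refine MvPolynomial.IsWeightedHomogeneous.sum _ _ _ fun x hx => ?_
  rw [Finset.HasAntidiagonal.mem_antidiagonal] at hx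
  convert (hf x.1).mul (hg x.2) using 1
  rw [← hx, map_add]
  push_cast
  ring

theorem IsHomogeneousSeries.pow {r : ℤ} {f : MvPowerSeries τ RatPoly}
    (hf : IsHomogeneousSeries p r f) (n : ℕ) : IsHomogeneousSeries p (n * r) (f ^ n) := by
  induction n with
  | zero =>
    intro d
    classical
    rw [pow_zero, coeff_one]
    split_ifs with h
    · subst h
      simpa using MvPolynomial.isWeightedHomogeneous_one ℚ (vWeight p)
    · exact MvPolynomial.isWeightedHomogeneous_zero _ _ _
  | succ n ih =>
    rw [pow_succ]
    convert ih.mul hf using 1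
    push_cast
    ring

theorem coeff_eq_sub_sum_of_isLog {f g : MvPowerSeries τ RatPoly} (hf : f ∈ ordIdeal τ RatPoly 1)
    (hg : g ∈ ordIdeal τ RatPoly 1) {N : ℕ} (hfg : f - g ∈ ordIdeal τ RatPoly N) {e : τ →₀ ℕ}
    (he : e.degree ≤ N) : coeff e f = coeff e (PowerSeries.subst f (arakiLog p)) -
      ∑ k ∈ Finset.range N, arakiCoeff p (k + 1) * coeff e (g ^ p ^ (k + 1)) := by
  have h := coeff_eq_of_sub_mem_ordIdeal (pLogSeries_subst_sub_add_sum_mem_ordIdeal (p := p)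
    (arakiCoeff_zero p) hf hg hfg) (Nat.lt_succ_of_le he)
  rw [map_add, map_sum] at h
  simp only [coeff_C_mul] at h
  rw [arakiLog, h, add_sub_cancel_right]

/-- Solving `L(f) = h` degree by degree, a coefficient of `f` is one of `h` minus terms `l_{k+1}
g^(p^(k+1))`, where `g` is the part already known; the degree `1 - p^(k+1)` of `l_{k+1}` compensates
the power exactly. -/
theorem isHomogeneousSeries_of_log {f : MvPowerSeries τ RatPoly} (hf : f ∈ ordIdeal τ RatPoly 1)
    (h : IsHomogeneousSeries p 1 (PowerSeries.subst f (arakiLog p))) :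
    IsHomogeneousSeries p 1 f := by
  suffices H : ∀ N, ∀ e : τ →₀ ℕ, e.degree < N →
      (coeff e f).IsWeightedHomogeneous (vWeight p) (1 - (e.degree : ℤ)) from
    fun e => H _ e (Nat.lt_succ_self _)
  intro N
  induction N with
  | zero => intro e he; simp at he
  | succ N ih =>
    intro e he
    have hg : IsHomogeneousSeries p 1 (truncDegree N f) := fun d =>
      coeff_truncDegree_mem (M := fun d =>
        MvPolynomial.weightedHomogeneousSubmodule ℚ (vWeight p) (1 - (d.degree : ℤ))) ih d
    rw [coeff_eq_sub_sum_of_isLog (p := p) hf (truncDegree_mem_ordIdeal hf)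
      (sub_truncDegree_mem_ordIdeal N f) (Nat.lt_succ_iff.1 he)]
    refine (h e).sub (MvPolynomial.IsWeightedHomogeneous.sum _ _ _ fun k _ => ?_)
    have hk := (isWeightedHomogeneous_arakiCoeff p (k + 1)).mul ((hg.pow (p ^ (k + 1))) e)
    rwa [show (1 - (p : ℤ) ^ (k + 1) + ((p ^ (k + 1) : ℕ) * 1 - (e.degree : ℤ))) =
      1 - (e.degree : ℤ) by push_cast; ring] at hk

theorem isHomogeneousSeries_log_X (s : τ) :
    IsHomogeneousSeries p 1 (PowerSeries.subst (X s : MvPowerSeries τ RatPoly) (arakiLog p)) := by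
  classical
  intro e
  have h := coeff_eq_of_sub_mem_ordIdeal (pLogSeries_subst_sub_sum_mem_ordIdeal p
    (X_mem_ordIdeal (A := RatPoly) s) (arakiCoeff p) e.degree)
    (Nat.lt_pow_self hp.out.one_lt)
  rw [arakiLog, h, map_sum]
  refine MvPolynomial.IsWeightedHomogeneous.sum _ _ _ fun k _ => ?_
  rw [coeff_C_mul, coeff_X_pow]
  split_ifs with hk
  · rw [mul_one, hk]
    simpa using isWeightedHomogeneous_arakiCoeff p k
  · rw [mul_zero]
    exact MvPolynomial.isWeightedHomogeneous_zero _ _ _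

/-- The monomial `v_v` factors only as `1 · v_v` or `v_v · 1`, and `x` has neither term. -/
theorem coeff_single_mul_eq_zero {R : Type*} [CommRing R] {x : MvPolynomial ℕ+ R} {v : ℕ+}
    (h0 : x.coeff 0 = 0) (h1 : x.coeff (Finsupp.single v 1) = 0) (y : MvPolynomial ℕ+ R) :
    (x * y).coeff (Finsupp.single v 1) = 0 := by
  classical
  rw [MvPolynomial.coeff_mul]
  refine Finset.sum_eq_zero fun d hd => ?_
  rw [Finset.HasAntidiagonal.mem_antidiagonal] at hd
  suffices x.coeff d.1 = 0 by rw [this, zero_mul]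
  by_cases hv : d.1 = 0
  · rw [hv, h0]
  · obtain ⟨i, hi⟩ := Finsupp.ne_iff.1 hv
    obtain ⟨d', hd'⟩ := eq_single_add_of_ne_zero hi
    have hdeg := congrArg Finsupp.degree hd
    rw [map_add, hd', map_add, Finsupp.degree_single, Finsupp.degree_single] at hdeg
    have e1 : d' = 0 := (Finsupp.degree_eq_zero_iff _).1 (by omega)
    have e2 : d.2 = 0 := (Finsupp.degree_eq_zero_iff _).1 (by omega)
    rw [e2, add_zero] at hd
    rw [hd, h1]

theorem coeff_zero_arakiCoeff_succ (k : ℕ) : (arakiCoeff p (k + 1)).coeff 0 = 0 := by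
  refine (isWeightedHomogeneous_arakiCoeff p (k + 1)).coeff_eq_zero 0 ?_
  have : (1 : ℤ) < (p : ℤ) ^ (k + 1) := by
    exact_mod_cast Nat.one_lt_pow (by omega) hp.out.one_lt
  rw [map_zero]
  omega

theorem coeff_single_arakiCoeff_of_ne {k : ℕ} {v : ℕ+} (hk : k ≠ v) :
    (arakiCoeff p k).coeff (Finsupp.single v 1) = 0 := by
  refine (isWeightedHomogeneous_arakiCoeff p k).coeff_eq_zero _ ?_
  rw [Finsupp.weight_single, one_smul, vWeight_eq]
  intro h
  have h1 : (p : ℤ) ^ (v : ℕ) = (p : ℤ) ^ k := by omega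
  have h2 : p ^ (v : ℕ) = p ^ k := by exact_mod_cast h1
  exact hk (Nat.pow_right_injective hp.out.two_le h2).symm

theorem coeff_single_arakiCoeff {k : ℕ} {v : ℕ+} (hv : (v : ℕ) = k + 1) :
    (arakiCoeff p (k + 1)).coeff (Finsupp.single v 1) = ((p : ℚ) - (p : ℚ) ^ p ^ (k + 1))⁻¹ := by
  rw [arakiCoeff_succ, MvPolynomial.coeff_C_mul, MvPolynomial.coeff_sum, Finset.sum_range_succ',
    Finset.sum_eq_zero, zero_add, arakiCoeff_zero, one_mul, pow_zero, pow_one, Nat.sub_zero,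
    ← hv, ratV_coe]
  · rw [MvPolynomial.coeff_X, if_pos rfl, mul_one]
  · intro i hi
    rw [Finset.mem_range] at hi
    exact coeff_single_mul_eq_zero (coeff_zero_arakiCoeff_succ i)
      (coeff_single_arakiCoeff_of_ne (by omega)) _

/-- The coefficient at `v_{k+1}` of a coefficient in degree `p^(k+1)` of a series is determined by
its logarithm and its linear part. -/
theorem coeff_single_coeff_eq {f f₁ : MvPowerSeries τ RatPoly} (hf : f ∈ ordIdeal τ RatPoly 1)
    (hf₁ : f₁ ∈ ordIdeal τ RatPoly 1) (h : f - f₁ ∈ ordIdeal τ RatPoly 2) {k : ℕ} {v : ℕ+}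
    (hv : (v : ℕ) = k + 1) {e : τ →₀ ℕ} (he : e.degree = p ^ (k + 1)) {y : ℚ}
    (hy : coeff e (f₁ ^ p ^ (k + 1)) = MvPolynomial.C y) :
    (coeff e f).coeff (Finsupp.single v 1) =
      (coeff e (PowerSeries.subst f (arakiLog p))).coeff (Finsupp.single v 1) -
        ((p : ℚ) - (p : ℚ) ^ p ^ (k + 1))⁻¹ * y := by
  have hpos := hp.out.one_lt
  -- Among the `l_{j+1}`, only `j = k` contributes: for smaller `j` the coefficient `l_{j+1}`
  -- contains neither a constant nor `v_{k+1}`, and for larger `j` the power of `f` has too high an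
  -- order.
  rw [coeff_eq_sub_sum_of_isLog (p := p) hf hf (N := p ^ (k + 1)) (by simp) he.le,
    MvPolynomial.coeff_sub, MvPolynomial.coeff_sum, Finset.sum_eq_single k]
  · rw [coeff_eq_of_sub_mem_ordIdeal (pow_sub_pow_mem_ordIdeal hf hf₁ h (k := p ^ (k + 1) + 1)
      (by omega)) (by omega), hy, mul_comm, MvPolynomial.coeff_C_mul, coeff_single_arakiCoeff hv,
      mul_comm]
  · intro j _ hjk
    rcases lt_or_gt_of_ne hjk with hj | hj
    · exact coeff_single_mul_eq_zero (coeff_zero_arakiCoeff_succ j)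
        (coeff_single_arakiCoeff_of_ne (by omega)) _
    · rw [pow_mem_ordIdeal_one hf (p ^ (j + 1)) e
        (he ▸ Nat.pow_lt_pow_right hpos (by omega)), mul_zero, MvPolynomial.coeff_zero]
  · intro hk
    exact absurd (Finset.mem_range.2 ((Nat.lt_succ_self k).trans (Nat.lt_pow_self hpos))) hk

end Homogeneous

/-! ### Homogeneity and leading coefficients of the Araki law -/

section ArakiHomogeneous

variable (p : ℕ) [hp : Fact p.Prime]

theorem isHomogeneousSeries_arakiRat : IsHomogeneousSeries p 1 (arakiRat p).toPowerSeries := by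
  refine isHomogeneousSeries_of_log (mem_ordIdeal_one.2 (arakiRat p).zero_constantCoeff) ?_
  have h : PowerSeries.subst (arakiRat p).toPowerSeries (arakiLog p) =
    PowerSeries.subst (X 0 : MvPowerSeries (Fin 2) RatPoly) (arakiLog p) +
      PowerSeries.subst (X 1 : MvPowerSeries (Fin 2) RatPoly) (arakiLog p) :=
    (isLogarithm_arakiRat p).2.2
  rw [h]
  intro d
  rw [map_add]
  exact (isHomogeneousSeries_log_X 0 d).add (isHomogeneousSeries_log_X 1 d)

theorem log_multSeries {A : Type*} [CommRing A] {F : FormalGroup A} {L : PowerSeries A}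
    (h : IsLogarithm F L) (m : ℕ) : PowerSeries.subst (multSeries F m) L =
      m • PowerSeries.subst (X () : MvPowerSeries Unit A) L := by
  have h1 := h.listSum (List.replicate m 1)
  rw [List.map_replicate, List.sum_replicate, map_one, one_mul] at h1
  rwa [multSeries_eq]

theorem isHomogeneousSeries_multSeries_arakiRat :
    IsHomogeneousSeries (τ := Unit) p 1 (multSeries (arakiRat p) p) := by
  have hmem : multSeries (arakiRat p) p ∈ ordIdeal Unit RatPoly 1 := by
    rw [multSeries_eq]; exact listSum_val_mem_ordIdeal _ _
  refine isHomogeneousSeries_of_log hmem ?_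
  rw [log_multSeries (isLogarithm_arakiRat p)]
  intro d
  rw [map_nsmul]
  exact Submodule.smul_of_tower_mem (MvPolynomial.weightedHomogeneousSubmodule ℚ (vWeight p) _) p
    (isHomogeneousSeries_log_X () d)

theorem isWeightedHomogeneous_of_polyToRat {x : PolyRing p} {r : ℤ}
    (h : (polyToRat p x).IsWeightedHomogeneous (vWeight p) r) :
    x.IsWeightedHomogeneous (vWeight p) r := by
  intro d hd
  refine h (d := d) ?_
  rw [polyToRat, MvPolynomial.coeff_map]
  exact fun h0 => hd (zLocToRat_injective p (h0.trans (map_zero _).symm))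

theorem isWeightedHomogeneous_coeff_arakiFormalGroup (d : Fin 2 →₀ ℕ) :
    (coeff d (arakiFormalGroup p).toPowerSeries).IsWeightedHomogeneous (vWeight p)
      (1 - (d.degree : ℤ)) := by
  refine isWeightedHomogeneous_of_polyToRat p ?_
  have h := isHomogeneousSeries_arakiRat p d
  rw [← arakiFormalGroup_map] at h
  exact h

theorem multSeries_arakiRat :
    multSeries (arakiRat p) p = MvPowerSeries.map (polyToRat p) (multSeries (arakiFormalGroup p) p) := by
  rw [← arakiFormalGroup_map, multSeries_map]

theorem isWeightedHomogeneous_coeff_multSeries (m : ℕ) :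
    (PowerSeries.coeff m (multSeries (arakiFormalGroup p) p)).IsWeightedHomogeneous (vWeight p)
      (1 - (m : ℤ)) := by
  refine isWeightedHomogeneous_of_polyToRat p ?_
  have h := isHomogeneousSeries_multSeries_arakiRat p (Finsupp.single () m)
  rw [multSeries_arakiRat, coeff_map, Finsupp.degree_single] at h
  exact h

/-- With `d = p - p^(p^v)`, the logarithm `p L(x)` contributes `p / d`, and the `p^v`-th power of
the linear part `p x` contributes `-p^(p^v) / d`; their sum is `1`. -/
theorem coeff_single_coeff_multSeries (v : ℕ+) :
    (PowerSeries.coeff (p ^ (v : ℕ)) (multSeries (arakiFormalGroup p) p)).coeff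
      (Finsupp.single v 1) = 1 := by
  obtain ⟨k, hk⟩ : ∃ k, (v : ℕ) = k + 1 := ⟨v - 1, by have := v.pos; omega⟩
  rw [hk]
  have hmem : multSeries (arakiRat p) p ∈ ordIdeal Unit RatPoly 1 := by
    rw [multSeries_eq]; exact listSum_val_mem_ordIdeal _ _
  have hlin := listSum_val_sub_mem_ordIdeal (arakiRat p) (List.replicate p 1)
  rw [← multSeries_eq, List.sum_replicate, nsmul_eq_mul, mul_one] at hlin
  have hy : coeff (Finsupp.single () (p ^ (k + 1)))
      ((C (p : RatPoly) * X ()) ^ p ^ (k + 1) : MvPowerSeries Unit RatPoly) =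
      MvPolynomial.C ((p : ℚ) ^ p ^ (k + 1)) := by
    rw [mul_pow, ← map_pow C, coeff_C_mul, X_pow_eq, coeff_monomial_same, mul_one, map_pow,
      map_natCast]
  have h := coeff_single_coeff_eq (p := p) hmem (C_mul_X_mem_ordIdeal _) hlin hk
    (Finsupp.degree_single _ _) hy
  have hX : coeff (Finsupp.single () (p ^ (k + 1)))
      (PowerSeries.subst (X () : MvPowerSeries Unit RatPoly) (arakiLog p)) =
      arakiCoeff p (k + 1) := by
    have h := PowerSeries.X_subst (arakiLog p)
    have h2 : PowerSeries.subst (X () : MvPowerSeries Unit RatPoly) (arakiLog p) = arakiLog p := h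
    rw [h2]
    exact coeff_pLogSeries_pow p _ _
  rw [log_multSeries (isLogarithm_arakiRat p), map_nsmul, hX, MvPolynomial.coeff_smul,
    coeff_single_arakiCoeff hk, nsmul_eq_mul, mul_comm (p : ℚ), ← mul_sub,
    inv_mul_cancel₀ (prime_sub_pow_ne_zero p k), multSeries_arakiRat, coeff_map, polyToRat,
    MvPolynomial.coeff_map] at h
  exact zLocToRat_injective p (h.trans (map_one _).symm)

/-- `L(x) + L(y)` has no mixed monomials, so the coefficient is `-1 / (p - p^(p^(k+1)))` times a
binomial coefficient. Both the denominator and the binomial are divisible by `p` exactly once. -/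
theorem isUnit_coeff_single_coeff_arakiFormalGroup (k : ℕ) {v : ℕ+} (hv : (v : ℕ) = k + 1) :
    IsUnit ((coeff (bidegree (p ^ k) (p ^ (k + 1) - p ^ k))
      (arakiFormalGroup p).toPowerSeries).coeff (Finsupp.single v 1)) := by
  have hpk : 0 < p ^ k := pow_pos hp.out.pos k
  have hlt : p ^ k < p ^ (k + 1) := Nat.pow_lt_pow_right hp.out.one_lt (Nat.lt_succ_self k)
  set a := p ^ k
  set b := p ^ (k + 1) - p ^ k
  have hab : a + b = p ^ (k + 1) := by omega
  have hX : ∀ i : Fin 2, (X i : MvPowerSeries (Fin 2) RatPoly) ∈ ordIdeal (Fin 2) RatPoly 1 :=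
    X_mem_ordIdeal
  have hy : coeff (bidegree a b) ((X 0 + X 1) ^ p ^ (k + 1) : MvPowerSeries (Fin 2) RatPoly) =
      MvPolynomial.C (((p ^ (k + 1)).choose a : ℕ) : ℚ) := by
    classical
    have hmon : ∀ i j, (X 0 ^ i * X 1 ^ j : MvPowerSeries (Fin 2) RatPoly) =
        monomial (bidegree i j) 1 := fun i j => by
      simp only [X_pow_eq, monomial_mul_monomial, mul_one, bidegree]
    rw [add_pow, map_sum, Finset.sum_eq_single a]
    · rw [← map_natCast C, mul_comm, coeff_C_mul, hmon, show p ^ (k + 1) - a = b from rfl,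
        coeff_monomial_same, mul_one, map_natCast]
    · intro i _ hi
      rw [← map_natCast C, mul_comm, coeff_C_mul, hmon, coeff_monomial_ne, mul_zero]
      intro h
      exact hi (by simpa using (DFunLike.congr_fun h 0).symm)
    · intro h
      exact absurd (Finset.mem_range.2 (by omega)) h
  have h := coeff_single_coeff_eq (p := p) (mem_ordIdeal_one.2 (arakiRat p).zero_constantCoeff)
    (add_mem (hX 0) (hX 1)) (logLawSeries_sub_mem_ordIdeal (constantCoeff_arakiLog p)
      (coeff_one_arakiLog p)) hv (by rw [degree_bidegree, hab]) hy
  have hL : PowerSeries.subst (arakiRat p).toPowerSeries (arakiLog p) =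
    PowerSeries.subst (X 0 : MvPowerSeries (Fin 2) RatPoly) (arakiLog p) +
      PowerSeries.subst (X 1 : MvPowerSeries (Fin 2) RatPoly) (arakiLog p) :=
    (isLogarithm_arakiRat p).2.2
  have hmixed : ∀ i : Fin 2, coeff (bidegree a b)
      (PowerSeries.subst (X i : MvPowerSeries (Fin 2) RatPoly) (arakiLog p)) = 0 := by
    intro i
    rw [PowerSeries.coeff_subst_single, if_neg]
    intro h
    have h0 := DFunLike.congr_fun h 0
    have h1 := DFunLike.congr_fun h 1
    fin_cases i
    · simp at h1; omega
    · simp at h0; omega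
  rw [hL, map_add, hmixed, hmixed, add_zero, MvPolynomial.coeff_zero, zero_sub,
    ← arakiFormalGroup_map] at h
  set z := (coeff (bidegree a b) (arakiFormalGroup p).toPowerSeries).coeff (Finsupp.single v 1)
  have hz : zLocToRat p z =
      -(((p : ℚ) - (p : ℚ) ^ p ^ (k + 1))⁻¹ * (((p ^ (k + 1)).choose a : ℕ) : ℚ)) := by
    rw [← h]
    exact (MvPolynomial.coeff_map _ _ _).symm
  have hfac : ((p ^ (k + 1)).choose a).factorization p = 1 := by
    rw [Nat.factorization_choose_prime_pow hp.out hlt.le hpk.ne',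
      hp.out.factorization_pow, Finsupp.single_eq_same]
    omega
  have hchoose : (p ^ (k + 1)).choose a ≠ 0 := (Nat.choose_pos hlt.le).ne'
  obtain ⟨n, hn⟩ : p ∣ (p ^ (k + 1)).choose a :=
    (hp.out.dvd_iff_one_le_factorization hchoose).2 hfac.ge
  have hpn : ¬ p ∣ n := by
    rintro ⟨n', rfl⟩
    have h2 : p ^ 2 ∣ (p ^ (k + 1)).choose a := ⟨n', by rw [hn]; ring⟩
    have := (hp.out.pow_dvd_iff_le_factorization hchoose).1 h2
    omega
  have h1 : 1 < p ^ (k + 1) := by omega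
  obtain ⟨j, hj⟩ : ∃ j, p ^ (k + 1) = j + 2 := ⟨p ^ (k + 1) - 2, by omega⟩
  have hpQ : (p : ℚ) ≠ 0 := by exact_mod_cast hp.out.ne_zero
  have h0 := prime_sub_pow_ne_zero p k
  -- After cancelling the common `p`, `z` divides the `p`-adic unit `n` in `ℤ_(p)`.
  have hmul : z * ((p : ZLoc p) ^ (j + 1) - 1) = n := by
    apply zLocToRat_injective p
    rw [map_mul, hz, map_sub, map_pow, map_natCast, map_natCast, map_one, hn]
    rw [hj] at h0 ⊢
    field_simp
    push_cast
    ring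
  have hnu := isUnit_natCast_of_algebra p (ZLoc p) n hpn
  rw [← hmul] at hnu
  exact isUnit_of_mul_isUnit_left hnu

end ArakiHomogeneous

end PnTypical

end

noncomputable section

namespace PnTypical

open MvPowerSeries

/-- Well-founded recursion; values not yet defined are replaced by `0`, so that `f v` takes a total
function. -/
theorem exists_eq_of_forall_lt {A : Type*} [Zero A] (f : ℕ+ → (ℕ+ → A) → A) :
    ∃ a : ℕ+ → A, ∀ v, a v = f v (fun i => if i < v then a i else 0) := by
  have wf : WellFounded ((· < ·) : ℕ+ → ℕ+ → Prop) := wellFounded_lt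
  refine ⟨wf.fix fun v r => f v fun i => if h : i < v then r i h else 0, fun v => ?_⟩
  rw [wf.fix_eq]
  rfl

/-! ### The Araki law is the universal p-typical law -/

section Classification

variable (p : ℕ) [hp : Fact p.Prime]

/-- The coefficient of the Araki formal group law at `x^(p^k) y^(p^(k+1) - p^k)`. -/
def arakiMixedCoeff (k : ℕ) : PolyRing p :=
  coeff (bidegree (p ^ k) (p ^ (k + 1) - p ^ k)) (arakiFormalGroup p).toPowerSeries

theorem isWeightedHomogeneous_arakiMixedCoeff (v : ℕ+) :
    (arakiMixedCoeff p v.natPred).IsWeightedHomogeneous (vWeight p) (vWeight p v) := by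
  have h := isWeightedHomogeneous_coeff_arakiFormalGroup p
    (bidegree (p ^ v.natPred) (p ^ (v.natPred + 1) - p ^ v.natPred))
  rw [degree_bidegree, Nat.add_sub_cancel' (Nat.pow_le_pow_right hp.out.pos (Nat.le_succ _)),
    Nat.cast_pow] at h
  rw [vWeight_eq, ← PNat.natPred_add_one v]
  exact h

variable {A : Type*} [CommRing A] [Algebra (ZLoc p) A]

theorem algHom_sub_algHom_of_isWeightedHomogeneous {x : PolyRing p} {v : ℕ+}
    (hx : x.IsWeightedHomogeneous (vWeight p) (vWeight p v)) {φ ψ : PolyRing p →ₐ[ZLoc p] A}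
    (h : ∀ i < v, φ (MvPolynomial.X i) = ψ (MvPolynomial.X i)) :
    φ x - ψ x = algebraMap (ZLoc p) A (x.coeff (Finsupp.single v 1)) *
      (φ (MvPolynomial.X v) - ψ (MvPolynomial.X v)) := by
  have hC : φ.toRingHom.comp MvPolynomial.C = ψ.toRingHom.comp MvPolynomial.C :=
    RingHom.ext fun z => (φ.commutes z).trans (ψ.commutes z).symm
  have h1 := ringHom_sub_ringHom_of_isWeightedHomogeneous p hx hC h
  have h2 : φ.toRingHom (MvPolynomial.C (x.coeff (Finsupp.single v 1))) =
    algebraMap (ZLoc p) A (x.coeff (Finsupp.single v 1)) := φ.commutes _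
  rw [h2] at h1
  exact h1

theorem isUnit_algebraMap_coeff_arakiMixedCoeff (v : ℕ+) :
    IsUnit (algebraMap (ZLoc p) A ((arakiMixedCoeff p v.natPred).coeff (Finsupp.single v 1))) :=
  (isUnit_coeff_single_coeff_arakiFormalGroup p v.natPred (v := v)
    (PNat.natPred_add_one v).symm).map _

/-- The mixed coefficients are triangular in the generators with unit diagonal: the image of `v_v`
is found by evaluating with `v_v` and all later generators set to `0`, then correcting by the
inverse of the diagonal unit. -/
theorem exists_algHom_arakiMixedCoeff_eq (g : ℕ → A) :
    ∃ φ : PolyRing p →ₐ[ZLoc p] A, ∀ k, φ (arakiMixedCoeff p k) = g k := by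
  obtain ⟨a, ha⟩ := exists_eq_of_forall_lt fun (v : ℕ+) (b : ℕ+ → A) =>
    Ring.inverse (algebraMap (ZLoc p) A
      ((arakiMixedCoeff p v.natPred).coeff (Finsupp.single v 1))) *
        (g v.natPred - MvPolynomial.aeval (R := ZLoc p) b (arakiMixedCoeff p v.natPred))
  refine ⟨MvPolynomial.aeval a, fun k => ?_⟩
  set v := k.succPNat
  have hk : v.natPred = k := Nat.natPred_succPNat k
  have h := algHom_sub_algHom_of_isWeightedHomogeneous p
    (isWeightedHomogeneous_arakiMixedCoeff p v) (φ := MvPolynomial.aeval a)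
    (ψ := MvPolynomial.aeval fun i => if i < v then a i else 0)
    fun i hi => by rw [MvPolynomial.aeval_X, MvPolynomial.aeval_X, if_pos hi]
  rw [MvPolynomial.aeval_X, MvPolynomial.aeval_X, if_neg (lt_irrefl v), sub_zero, ha v,
    Ring.mul_inverse_cancel_left _ _ (isUnit_algebraMap_coeff_arakiMixedCoeff p v), hk] at h
  exact sub_left_injective h

theorem algHom_ext_of_arakiMixedCoeff {φ ψ : PolyRing p →ₐ[ZLoc p] A}
    (h : ∀ k, φ (arakiMixedCoeff p k) = ψ (arakiMixedCoeff p k)) : φ = ψ := by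
  refine MvPolynomial.algHom_ext fun v => ?_
  induction v using PNat.strongInductionOn with
  | _ v ih =>
    have h1 := algHom_sub_algHom_of_isWeightedHomogeneous p
      (isWeightedHomogeneous_arakiMixedCoeff p v) ih
    rw [h, sub_self] at h1
    exact sub_eq_zero.1 ((isUnit_algebraMap_coeff_arakiMixedCoeff p v).mul_right_eq_zero.1 h1.symm)

/-- Triangularity gives the only map matching the distinguished coefficients of `G`, and
`IsPTypical.eq_of_coeff_eq` shows that matching these is already matching `G`. -/
theorem classifiesPTypical_arakiFormalGroup :
    ClassifiesPTypical.{u} p (arakiFormalGroup p) := by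
  refine ⟨isPTypical_arakiFormalGroup p, fun A _ _ G hG => ?_⟩
  obtain ⟨φ, hφ⟩ := exists_algHom_arakiMixedCoeff_eq p fun k =>
    coeff (bidegree (p ^ k) (p ^ (k + 1) - p ^ k)) G.toPowerSeries
  refine ⟨φ, ((isPTypical_arakiFormalGroup p).map _).eq_of_coeff_eq (isUnit_natCast_of_algebra p A)
    hG hφ, fun ψ hψ => algHom_ext_of_arakiMixedCoeff p fun k => ?_⟩
  rw [hφ, ← hψ]
  rfl

theorem isGradedFGL_arakiFormalGroup :
    IsGradedFGL p (polyGrading p 1) (arakiFormalGroup p) := by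
  intro d
  have h := isWeightedHomogeneous_coeff_arakiFormalGroup p d
  rw [degree_fin_two, Nat.cast_add] at h
  exact h

end Classification

/-! ### The quotients BP{n} -/

section Quotient

variable (p : ℕ) [hp : Fact p.Prime] (n : ℕ+)

theorem isGradedFGL_reduceFGL :
    IsGradedFGL p (bpnGrading p n) (reduceFGL p (arakiFormalGroup p) n) :=
  fun d => ⟨_, isGradedFGL_arakiFormalGroup p d, rfl⟩

theorem toBPn_X_eq_zero {i : ℕ+} (hi : ¬ n ∣ i) : toBPn p n (MvPolynomial.X i) = 0 :=
  Ideal.Quotient.eq_zero_iff_mem.2 (Ideal.subset_span ⟨i, hi, rfl⟩)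

theorem toBPn_surjective : Function.Surjective (toBPn p n) := Ideal.Quotient.mk_surjective

variable {p n}

theorem map_eq_zero_of_mem_vIdeal {A : Type*} [CommRing A] {φ : PolyRing p →+* A}
    (h : ∀ i : ℕ+, ¬ n ∣ i → φ (MvPolynomial.X i) = 0) {x : PolyRing p} (hx : x ∈ vIdeal p n) :
    φ x = 0 := by
  have : vIdeal p n ≤ RingHom.ker φ := by
    refine Ideal.span_le.2 ?_
    rintro _ ⟨i, hi, rfl⟩
    exact h i hi
  exact this hx

/-- The map out of `BP{n}` induced by a map that kills the `v_i` with `n ∤ i`. -/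
def bpnLift {A : Type*} [CommRing A] [Algebra (ZLoc p) A] (φ : PolyRing p →ₐ[ZLoc p] A)
    (h : ∀ i : ℕ+, ¬ n ∣ i → φ (MvPolynomial.X i) = 0) : BPn p n →ₐ[ZLoc p] A :=
  Ideal.Quotient.liftₐ (vIdeal p n) φ fun _ hx => map_eq_zero_of_mem_vIdeal (φ := φ.toRingHom) h hx

theorem bpnLift_toBPn {A : Type*} [CommRing A] [Algebra (ZLoc p) A]
    (φ : PolyRing p →ₐ[ZLoc p] A) (h : ∀ i : ℕ+, ¬ n ∣ i → φ (MvPolynomial.X i) = 0)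
    (x : PolyRing p) : bpnLift φ h (toBPn p n x) = φ x := rfl

theorem bpn_algHom_ext {A : Type*} [CommRing A] [Algebra (ZLoc p) A]
    {φ ψ : BPn p n →ₐ[ZLoc p] A}
    (h : ∀ i, φ (toBPn p n (MvPolynomial.X (n * i))) = ψ (toBPn p n (MvPolynomial.X (n * i)))) :
    φ = ψ := by
  refine Ideal.Quotient.algHom_ext _ (MvPolynomial.algHom_ext fun i => ?_)
  change φ (toBPn p n (MvPolynomial.X i)) = ψ (toBPn p n (MvPolynomial.X i))
  by_cases hi : n ∣ i
  · obtain ⟨i, rfl⟩ := hi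
    exact h i
  · rw [toBPn_X_eq_zero p n hi, map_zero, map_zero]

variable (p n)

open Classical in
/-- The map from `ℤ_(p)[v_1, v_2, …]` to `ℤ_(p)[v_n, v_{2n}, …]` killing the `v_i` with `n ∤ i`. -/
def polyProj : PolyRing p →ₐ[ZLoc p] PolyRing p :=
  MvPolynomial.aeval fun i => if h : n ∣ i then MvPolynomial.X h.choose else 0

theorem polyProj_X_of_not_dvd {i : ℕ+} (hi : ¬ n ∣ i) : polyProj p n (MvPolynomial.X i) = 0 := by
  rw [polyProj, MvPolynomial.aeval_X, dif_neg hi]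

theorem polyProj_X_mul (m : ℕ+) : polyProj p n (MvPolynomial.X (n * m)) = MvPolynomial.X m := by
  have h : n ∣ n * m := Dvd.intro m rfl
  rw [polyProj, MvPolynomial.aeval_X, dif_pos h]
  exact congrArg _ (mul_left_cancel h.choose_spec).symm

/-- The inclusion of `ℤ_(p)[v_n, v_{2n}, …]` in `ℤ_(p)[v_1, v_2, …]`. -/
def polyIncl : PolyRing p →ₐ[ZLoc p] PolyRing p := MvPolynomial.rename fun m => n * m

theorem polyIncl_X (m : ℕ+) : polyIncl p n (MvPolynomial.X m) = MvPolynomial.X (n * m) :=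
  MvPolynomial.rename_X _ _

/-- The isomorphism of `BP{n}` with `ℤ_(p)[v_n, v_{2n}, …]`. -/
def bpnEquiv : BPn p n ≃ₐ[ZLoc p] PolyRing p :=
  AlgEquiv.ofAlgHom (bpnLift (polyProj p n) fun _ hi => polyProj_X_of_not_dvd p n hi)
    ((toBPn p n).comp (polyIncl p n))
    (MvPolynomial.algHom_ext fun m => by
      rw [AlgHom.comp_apply, AlgHom.comp_apply, bpnLift_toBPn, polyIncl_X, polyProj_X_mul]; rfl)
    (by
      refine bpn_algHom_ext (p := p) (n := n) (A := BPn p n) fun m => ?_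
      rw [AlgHom.comp_apply, AlgHom.comp_apply, bpnLift_toBPn, polyProj_X_mul, polyIncl_X]; rfl)

theorem polyProj_polyIncl (x : PolyRing p) : polyProj p n (polyIncl p n x) = x :=
  (bpnEquiv p n).apply_symm_apply x

variable {p n}

theorem polyProj_mem_polyGrading {d : ℤ} {x : PolyRing p} (hx : x ∈ polyGrading p 1 d) :
    polyProj p n x ∈ polyGrading p n d := by
  rw [polyProj, MvPolynomial.aeval_def, MvPolynomial.eval₂_eq]
  refine Submodule.sum_mem _ fun e he => ?_
  rw [MvPolynomial.mem_support_iff] at he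
  have hd : Finsupp.weight (vWeight p) e = d := hx he
  rw [← hd, MvPolynomial.algebraMap_eq]
  refine MvPolynomial.IsWeightedHomogeneous.C_mul ?_ _
  rw [Finsupp.weight_apply, Finsupp.sum]
  refine MvPolynomial.IsWeightedHomogeneous.prod _ _ _ fun i _ => ?_
  refine MvPolynomial.IsWeightedHomogeneous.pow ?_ _
  split_ifs with h
  · have h1 := MvPolynomial.isWeightedHomogeneous_X (ZLoc p)
      (fun m : ℕ+ => (1 : ℤ) - (p : ℤ) ^ ((n * m : ℕ+) : ℕ)) h.choose
    rw [← h.choose_spec, ← vWeight_eq] at h1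
    exact h1
  · exact MvPolynomial.isWeightedHomogeneous_zero _ _ _

theorem polyIncl_mem_polyGrading {d : ℤ} {x : PolyRing p} (hx : x ∈ polyGrading p n d) :
    polyIncl p n x ∈ polyGrading p 1 d := by
  classical
  intro e he
  obtain ⟨e', rfl, he'⟩ := MvPolynomial.coeff_rename_ne_zero _ _ _ he
  rw [← hx he', Finsupp.weight_apply, Finsupp.weight_apply,
    Finsupp.sum_mapDomain_index (by simp) (by simp [add_mul])]
  simp only [one_mul]

variable (p n)

theorem map_bpnGrading (d : ℤ) :
    (bpnGrading p n d).map (bpnEquiv p n).toLinearMap = polyGrading p n d := by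
  refine le_antisymm ?_ fun x hx => ?_
  · rintro _ ⟨_, ⟨x, hx, rfl⟩, rfl⟩
    exact polyProj_mem_polyGrading hx
  · exact ⟨_, ⟨polyIncl p n x, polyIncl_mem_polyGrading hx, rfl⟩, polyProj_polyIncl p n x⟩

theorem map_symm_polyGrading (d : ℤ) :
    (polyGrading p n d).map (bpnEquiv p n).symm.toLinearMap = bpnGrading p n d := by
  rw [← map_bpnGrading, ← Submodule.map_comp]
  have h : (bpnEquiv p n).symm.toLinearMap ∘ₗ (bpnEquiv p n).toLinearMap = LinearMap.id :=
    LinearMap.ext (bpnEquiv p n).symm_apply_apply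
  rw [h, Submodule.map_id]

/-- The weighted decomposition of the polynomial ring is transported through `bpnEquiv`, which
matches the two families of submodules. -/
theorem isInternal_bpnGrading : DirectSum.IsInternal (bpnGrading p n) := by
  let _ : DirectSum.Decomposition (polyGrading p n) := MvPolynomial.weightedDecomposition _ _
  have h : DirectSum.IsInternal (polyGrading p n) := DirectSum.Decomposition.isInternal _
  rw [DirectSum.isInternal_submodule_iff_iSupIndep_and_iSup_eq_top] at h ⊢
  have e : bpnGrading p n =
      Submodule.orderIsoMapComap (bpnEquiv p n).symm.toLinearEquiv ∘ polyGrading p n :=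
    funext fun d => (map_symm_polyGrading p n d).symm
  rw [e]
  refine ⟨h.1.map_orderIso _, ?_⟩
  have h2 := (Submodule.orderIsoMapComap (bpnEquiv p n).symm.toLinearEquiv).map_iSup (polyGrading p n)
  rw [h.2, map_top] at h2
  exact h2.symm

theorem nonempty_gradedAlgebra_bpnGrading : Nonempty (GradedAlgebra (bpnGrading p n)) := by
  have : SetLike.GradedMonoid (bpnGrading p n) :=
    { one_mem := ⟨1, MvPolynomial.isWeightedHomogeneous_one _ _, map_one (toBPn p n)⟩
      mul_mem := by
        rintro i j _ _ ⟨x, hx, rfl⟩ ⟨y, hy, rfl⟩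
        exact ⟨x * y, MvPolynomial.IsWeightedHomogeneous.mul hx hy, map_mul (toBPn p n) x y⟩ }
  exact ⟨(isInternal_bpnGrading p n).gradedAlgebra⟩

theorem multSeries_reduceFGL (m : ℕ) :
    PowerSeries.coeff m (multSeries (reduceFGL p (arakiFormalGroup p) n) p) =
      toBPn p n (PowerSeries.coeff m (multSeries (arakiFormalGroup p) p)) := by
  rw [reduceFGL, multSeries_map]
  rfl

theorem sub_one_dvd_of_mem_polyGrading {d : ℤ} {x : PolyRing p} (hx : x ∈ polyGrading p n d)
    (h0 : x ≠ 0) : ((p ^ (n : ℕ) - 1 : ℕ) : ℤ) ∣ d := by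
  obtain ⟨e, he⟩ := MvPolynomial.ne_zero_iff.1 h0
  rw [← hx he, Finsupp.weight_apply]
  refine Finset.dvd_sum fun m _ => Dvd.dvd.mul_left ?_ _
  rw [Nat.cast_sub (Nat.one_le_pow _ _ hp.out.pos), PNat.mul_coe, pow_mul, ← dvd_neg, neg_sub]
  simpa using sub_dvd_pow_sub_pow ((p : ℤ) ^ (n : ℕ)) 1 m

/-- The coefficient of `x^m` has degree `1 - m`, while in `ℤ_(p)[v_n, v_{2n}, …]` nonzero elements
occur only in degrees divisible by `p^n - 1`. -/
theorem isGradable_multSeries_reduceFGL :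
    IsGradable p n (multSeries (reduceFGL p (arakiFormalGroup p) n) p) := by
  intro m hm
  have hm0 : 1 ≤ m := by
    by_contra h
    obtain rfl : m = 0 := by omega
    refine hm ?_
    rw [multSeries_eq]
    exact listSum_val_mem_ordIdeal _ _ _ (by simp)
  rw [multSeries_reduceFGL] at hm
  have hx : polyProj p n (PowerSeries.coeff m (multSeries (arakiFormalGroup p) p)) ≠ 0 :=
    fun h => hm ((bpnEquiv p n).injective (h.trans (map_zero _).symm))
  have h := sub_one_dvd_of_mem_polyGrading p n
    (polyProj_mem_polyGrading (isWeightedHomogeneous_coeff_multSeries p m)) hx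
  rw [← dvd_neg, neg_sub, ← Nat.cast_pred hm0, Int.natCast_dvd_natCast] at h
  obtain ⟨j, hj⟩ := h
  exact ⟨j, by rw [mul_comm, ← hj]; omega⟩

theorem isPnTypical_reduceFGL : IsPnTypical p n (reduceFGL p (arakiFormalGroup p) n) :=
  ⟨(isPTypical_arakiFormalGroup p).map _, isGradable_multSeries_reduceFGL p n⟩

variable {p n}

/-- The greatest common divisor of `p^n - 1` and `p^i - 1` is `p^(gcd(n, i)) - 1`. -/
theorem dvd_of_pow_eq_one_add {i : ℕ} {j : ℕ} (h : p ^ i = 1 + j * (p ^ (n : ℕ) - 1)) :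
    (n : ℕ) ∣ i := by
  have h1 : p ^ (n : ℕ) - 1 ∣ p ^ i - 1 := ⟨j, by rw [h, mul_comm]; omega⟩
  have h2 := Nat.pow_sub_one_gcd_pow_sub_one p (n : ℕ) i
  rw [Nat.gcd_eq_left h1] at h2
  have h3 : p ^ (n : ℕ) = p ^ (n : ℕ).gcd i := by
    have := Nat.one_le_pow (n : ℕ) p hp.out.pos
    have := Nat.one_le_pow ((n : ℕ).gcd i) p hp.out.pos
    omega
  rw [Nat.pow_right_injective hp.out.two_le h3]
  exact Nat.gcd_dvd_right _ _

theorem map_X_eq_zero_of_isPnTypical {A : Type*} [CommRing A] [Algebra (ZLoc p) A]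
    {φ : PolyRing p →ₐ[ZLoc p] A}
    (h : IsGradable p n (multSeries ((arakiFormalGroup p).map φ.toRingHom) p)) :
    ∀ i : ℕ+, ¬ n ∣ i → φ (MvPolynomial.X i) = 0 := by
  intro i
  induction i using PNat.strongInductionOn with
  | _ i ih =>
    intro hi
    set x := PowerSeries.coeff (p ^ (i : ℕ)) (multSeries (arakiFormalGroup p) p)
    have hni : ∀ j, p ^ (i : ℕ) ≠ 1 + j * (p ^ (n : ℕ) - 1) := fun j hj =>
      hi (PNat.dvd_iff.2 (dvd_of_pow_eq_one_add hj))
    classical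
    -- `ψ` is `φ` with all forbidden generators killed, so it factors through `BP{n}` and by
    -- induction agrees with `φ` below `i`. Both kill the coefficient of `p ·_F x` at `x^(p^i)`,
    -- whose `v_i`-coefficient is `1`; hence they agree at `v_i`.
    let ψ : PolyRing p →ₐ[ZLoc p] A :=
      MvPolynomial.aeval fun j => if n ∣ j then φ (MvPolynomial.X j) else 0
    have hψ : ∀ j : ℕ+, ¬ n ∣ j → ψ (MvPolynomial.X j) = 0 := fun j hj => by
      rw [MvPolynomial.aeval_X, if_neg hj]
    have hx : x.IsWeightedHomogeneous (vWeight p) (vWeight p i) := by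
      rw [vWeight_eq]
      exact_mod_cast isWeightedHomogeneous_coeff_multSeries p (p ^ (i : ℕ))
    have h1 := algHom_sub_algHom_of_isWeightedHomogeneous p hx (φ := φ) (ψ := ψ) fun j hj => by
      by_cases hnj : n ∣ j
      · rw [MvPolynomial.aeval_X, if_pos hnj]
      · rw [hψ j hnj, ih j hj hnj]
    have hφx : φ x = 0 := by
      by_contra h0
      rw [multSeries_map] at h
      exact (h _ h0).elim hni
    have hψx : ψ x = 0 := by
      have h2 : toBPn p n x = 0 := by
        by_contra h0
        rw [← multSeries_reduceFGL] at h0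
        exact (isGradable_multSeries_reduceFGL p n _ h0).elim hni
      rw [← bpnLift_toBPn ψ hψ, h2, map_zero]
    rw [hφx, hψx, coeff_single_coeff_multSeries, map_one, one_mul, hψ i hi, sub_zero,
      sub_zero] at h1
    exact h1.symm

variable (p n)

/-- The classifying map of `G` as a `p`-typical law kills the ideal by
`map_X_eq_zero_of_isPnTypical`, and uniqueness is inherited because the projection is surjective. -/
theorem classifiesPnTypical_reduceFGL :
    ClassifiesPnTypical.{u} p n (reduceFGL p (arakiFormalGroup p) n) := by
  refine ⟨isPnTypical_reduceFGL p n, fun A _ _ G hG => ?_⟩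
  obtain ⟨φ, rfl, huniq⟩ := (classifiesPTypical_arakiFormalGroup p).2 A G hG.1
  refine ⟨bpnLift φ (map_X_eq_zero_of_isPnTypical hG.2), formalGroup_map_map _ _ _, fun ψ hψ => ?_⟩
  have h := huniq (ψ.comp (toBPn p n)) ((formalGroup_map_map _ _ _).symm.trans hψ)
  exact Ideal.Quotient.algHom_ext _ h

theorem toBPn_one_injective : Function.Injective (toBPn p 1) := by
  have h : vIdeal p 1 = ⊥ := by
    rw [eq_bot_iff, vIdeal, Ideal.span_le]
    rintro _ ⟨i, hi, -⟩
    exact absurd (one_dvd i) hi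
  intro x y hxy
  have := Ideal.Quotient.eq.1 hxy
  rw [h, Ideal.mem_bot] at this
  exact sub_eq_zero.1 this

theorem exists_bpn_algHom_bpn_mul (k : ℕ+) : ∃ π : BPn p n →ₐ[ZLoc p] BPn p (k * n),
    Function.Surjective π ∧ π.comp (toBPn p n) = toBPn p (k * n) ∧
      ∀ F : FormalGroup (PolyRing p), (reduceFGL p F n).map π.toRingHom = reduceFGL p F (k * n) := by
  have h : ∀ i : ℕ+, ¬ n ∣ i → toBPn p (k * n) (MvPolynomial.X i) = 0 := fun i hi =>
    toBPn_X_eq_zero p (k * n) fun h => hi ((Dvd.intro_left k rfl).trans h)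
  refine ⟨bpnLift (n := n) (A := BPn p (k * n)) (toBPn p (k * n)) h, fun y => ?_, ?_, ?_⟩
  rotate_left
  · exact AlgHom.ext fun _ => rfl
  · exact fun F => formalGroup_map_map _ _ F
  obtain ⟨x, rfl⟩ := toBPn_surjective p (k * n) y
  exact ⟨toBPn p n x, bpnLift_toBPn _ h x⟩

end Quotient

end PnTypical

end

theorem mainTheorem9 (p : ℕ) [Fact p.Prime] :
    ∃ F : FormalGroup (PnTypical.PolyRing p),
      -- `BP = ℤ_(p)[v_1, v_2, …]` on the Araki generators, with `deg v_i = 1 - p^i`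
      PnTypical.ClassifiesPTypical.{u, 0} p F ∧
      PnTypical.IsArakiSequence p F (PnTypical.vSeq p) ∧
      PnTypical.IsGradedFGL p (PnTypical.polyGrading p 1) F ∧
      ∀ n : ℕ+,
        -- `BP{n} = BP / (v_i, n ∤ i)` is graded and classifies `p^n`-typical formal group laws
        PnTypical.ClassifiesPnTypical.{u, 0} p n (PnTypical.reduceFGL p F n) ∧
        Nonempty (GradedAlgebra (PnTypical.bpnGrading p n)) ∧
        PnTypical.IsGradedFGL p (PnTypical.bpnGrading p n)
          (PnTypical.reduceFGL p F n) ∧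
        -- `BP{n} ≅ ℤ_(p)[v_n, v_{2n}, …]` as graded rings
        (∃ e : PnTypical.BPn p n ≃ₐ[PnTypical.ZLoc p] PnTypical.PolyRing p,
          (∀ i : ℕ+, ¬ n ∣ i → e (PnTypical.toBPn p n (MvPolynomial.X i)) = 0) ∧
          (∀ m : ℕ+, e (PnTypical.toBPn p n (MvPolynomial.X (n * m))) = MvPolynomial.X m) ∧
          ∀ d : ℤ, (PnTypical.bpnGrading p n d).map e.toLinearMap =
            PnTypical.polyGrading p n d) ∧
        -- `BP{1} = BP`
        (n = 1 → Function.Bijective (PnTypical.toBPn p n)) ∧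
        -- `BP{kn}` is naturally a quotient of `BP{n}`
        ∀ k : ℕ+, ∃ π : PnTypical.BPn p n →ₐ[PnTypical.ZLoc p] PnTypical.BPn p (k * n),
          Function.Surjective π ∧
          π.comp (PnTypical.toBPn p n) = PnTypical.toBPn p (k * n) ∧
          (PnTypical.reduceFGL p F n).map π.toRingHom =
            PnTypical.reduceFGL p F (k * n) := by
  refine ⟨PnTypical.arakiFormalGroup p, PnTypical.classifiesPTypical_arakiFormalGroup p,
    PnTypical.isArakiSequence_vSeq p, PnTypical.isGradedFGL_arakiFormalGroup p, fun n =>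
    ⟨PnTypical.classifiesPnTypical_reduceFGL p n, PnTypical.nonempty_gradedAlgebra_bpnGrading p n,
      PnTypical.isGradedFGL_reduceFGL p n,
      ⟨PnTypical.bpnEquiv p n, fun _ hi => PnTypical.polyProj_X_of_not_dvd p n hi,
        PnTypical.polyProj_X_mul p n, PnTypical.map_bpnGrading p n⟩, ?_, fun k => ?_⟩⟩
  · rintro rfl
    exact ⟨PnTypical.toBPn_one_injective p, PnTypical.toBPn_surjective p 1⟩
  · obtain ⟨π, h1, h2, h3⟩ := PnTypical.exists_bpn_algHom_bpn_mul p n k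
    exact ⟨π, h1, h2, h3 _⟩
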